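/- Let $1\le \ell$, $0\le k$ and $d=k+\ell$. Let $X\subset\mathbb P^d$ be a real subvariety (the set of complex points of $\mathbb P^d$ cut out by homogeneous polynomials with real coefficients) of pure dimension $k$, and let $V\subset\mathbb P^d$ be a real linear subspace of dimension $\ell-1$ such that $X$ is hyperbolic with respect to $V$, that is, $X\cap V=\emptyset$ and for every real $\ell$-dimensional linear subspace $U\subset\mathbb P^d$ containing $V$ all points of $X\cap U$ are real. Let $\mathbb G(\ell-1,d)(\mathbb R)$ be the Grassmannian of real $(\ell-1)$-dimensional linear subspaces of $\mathbb P^d$ with its classical topology, let $Y(\mathbb R)$ be the set of those that meet $X$ (in a real or non-real point), and let $C(V)$ be the connected component of $V$ in $\mathbb G(\ell-1,d)(\mathbb R)\setminus Y(\mathbb R)$. For a real linear subspace $V_0$ of dimension $\ell-2$ (empty if $\ell=1$) put $P_{V_0}=\{V'\in\mathbb G(\ell-1,d)(\mathbb R): V_0\subset V'\}$. All cones below are taken without the point $0$. Then: (1) $C(V)$ is slice-convex: for every $W\in C(V)$ and every real $W_0\subset W$ of codimension one, the cone over $C(V)\cap P_{W_0}$ in the Plücker embedding (in $\mathbb R^{N+1}$,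 $N+1=\binom{d+1}{\ell}$) is the union of a convex cone $K$ and its negative $-K$, which are separated ($\overline K\cap(-K)=\emptyset$), so that they are its two connected components. (2) Identify $P_{W_0}$ with the real projective space of lines in $W_0^\perp\cong\mathbb R^{d-\ell+2}$. For every $W\in C(V)$ and every real $W_0\subset W$ of codimension one, the cone in $W_0^\perp$ over $C(V)\cap P_{W_0}$ is likewise the union of a convex cone and its negative, separated from each other. (3) For every real $V_0\subset V$ of codimension one, $X$ is hyperbolic with respect to every $V'\in C(V)\cap P_{V_0}$. -/

import Mathlib

open scoped LinearAlgebra.Projectivization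

noncomputable section

namespace SliceConvex

/-- Complex projective space `ℙ^d`, as the set of lines of `ℂ^(d+1)`. -/
abbrev CP (d : ℕ) : Type := ℙ ℂ (Fin (d + 1) → ℂ)

/-- `ℝ^(d+1)` with its standard scalar product. -/
abbrev RV (d : ℕ) : Type := EuclideanSpace ℝ (Fin (d + 1))

/-- The inclusion `ℝ^(d+1) ⊆ ℂ^(d+1)`. -/
def toComplex {d : ℕ} (v : RV d) : Fin (d + 1) → ℂ := fun i => (v i : ℂ)

/-- The complexification of a real linear subspace: the subspace of `ℂ^(d+1)` that it spans. -/
def complexify {d : ℕ} (V : Submodule ℝ (RV d)) : Submodule ℂ (Fin (d + 1) → ℂ) :=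
  Submodule.span ℂ (toComplex '' (V : Set (RV d)))

/-- The points of `ℙ^d` that lie on the linear subspace of `ℙ^d` given by a real subspace `V` of
`ℝ^(d+1)`. -/
def pointsOn {d : ℕ} (V : Submodule ℝ (RV d)) : Set (CP d) :=
  {x | x.submodule ≤ complexify V}

/-- The points of `ℙ^d` that have real homogeneous coordinates. -/
def realPoints (d : ℕ) : Set (CP d) :=
  {x | ∃ v : RV d, v ≠ 0 ∧ toComplex v ∈ x.submodule}

/-- `X` is the set of common zeros of homogeneous polynomials with real coefficients. -/
def IsRealSubvariety {d : ℕ} (X : Set (CP d)) : Prop :=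
  ∃ S : Set (MvPolynomial (Fin (d + 1)) ℝ),
    (∀ p ∈ S, ∃ n : ℕ, p.IsHomogeneous n) ∧
    X = {x | ∀ p ∈ S, ∀ z ∈ x.submodule, MvPolynomial.aeval z p = 0}

/-- The affine cone over `X` in `ℂ^(d+1)`, with its apex `0`. -/
def affineCone {d : ℕ} (X : Set (CP d)) : Set (Fin (d + 1) → ℂ) :=
  {z | ∀ hz : z ≠ 0, Projectivization.mk ℂ z hz ∈ X}

/-- The homogeneous vanishing ideal of `X` in `ℂ[x_0, …, x_d]`. -/
def homIdeal {d : ℕ} (X : Set (CP d)) : Ideal (MvPolynomial (Fin (d + 1)) ℂ) :=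
  MvPolynomial.vanishingIdeal ℂ (affineCone X)

/-- Every irreducible component of `X` has dimension `k`, i.e. its homogeneous coordinate ring
has Krull dimension `k + 1`. The apex belongs to `affineCone X`, so the empty set (whose ideal
is the irrelevant maximal ideal) has no pure dimension `k : ℕ`. -/
def HasPureDim {d : ℕ} (X : Set (CP d)) (k : ℕ) : Prop :=
  ∀ P ∈ (homIdeal X).minimalPrimes,
    ringKrullDim (MvPolynomial (Fin (d + 1)) ℂ ⧸ P) = ((k + 1 : ℕ) : WithBot ℕ∞)

/-- The real Grassmannian `𝔾(ℓ-1, d)(ℝ)`: the `ℓ`-dimensional linear subspaces of `ℝ^(d+1)`, i.e.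
the real `(ℓ-1)`-dimensional linear subspaces of `ℙ^d`. -/
def RealGr (ℓ d : ℕ) : Type := {V : Submodule ℝ (RV d) // Module.finrank ℝ V = ℓ}

/-- The linear subspace of `ℝ^(d+1)` that underlies a point of the Grassmannian. -/
def RealGr.space {ℓ d : ℕ} (V : RealGr ℓ d) : Submodule ℝ (RV d) := V.1

/-- The classical topology of the real Grassmannian, from the embedding that sends a subspace to
the orthogonal projection onto it. -/
instance (ℓ d : ℕ) : TopologicalSpace (RealGr ℓ d) :=
  TopologicalSpace.induced (fun V : RealGr ℓ d => V.space.starProjection) inferInstance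

/-- `Y(ℝ)`: the real `(ℓ-1)`-dimensional linear subspaces of `ℙ^d` that meet `X` (possibly in
non-real points). -/
def associatedReal {d : ℕ} (ℓ : ℕ) (X : Set (CP d)) : Set (RealGr ℓ d) :=
  {V | (X ∩ pointsOn V.space).Nonempty}

/-- `X` is hyperbolic with respect to `V`: `V` does not meet `X`, and each real `ℓ`-dimensional
linear subspace `U` of `ℙ^d` through `V` meets `X` in real points only. -/
def IsHyperbolic {ℓ d : ℕ} (X : Set (CP d)) (V : RealGr ℓ d) : Prop :=
  X ∩ pointsOn V.space = ∅ ∧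
  ∀ U : RealGr (ℓ + 1) d, V.space ≤ U.space → X ∩ pointsOn U.space ⊆ realPoints d

/-- `C(V)`: the connected component of `V` in `𝔾(ℓ-1, d)(ℝ) \ Y(ℝ)`. -/
def component {ℓ d : ℕ} (X : Set (CP d)) (V : RealGr ℓ d) : Set (RealGr ℓ d) :=
  connectedComponentIn (associatedReal ℓ X)ᶜ V

/-- `P_{V₀}`: the real `(ℓ-1)`-dimensional linear subspaces of `ℙ^d` that contain `V₀`. -/
def pencil {d : ℕ} (ℓ : ℕ) (V₀ : Submodule ℝ (RV d)) : Set (RealGr ℓ d) :=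
  {W | V₀ ≤ W.space}

/-- `S` (a cone over a set of real projective points, without `0`) is the union of a convex cone
`K` and its negative `-K`, which are separated from each other: neither meets the closure of the
other. As convex sets are connected, `K` and `-K` are then the two connected components of `S`
(if `S` is not empty). -/
def IsConvexDoubleCone {M : Type*} [AddCommGroup M] [Module ℝ M] [TopologicalSpace M]
    (S : Set M) : Prop :=
  ∃ K : ConvexCone ℝ M,
    S = {x | x ∈ K ∨ -x ∈ K} ∧ ∀ x ∈ closure (K : Set M), -x ∉ K

/-- The Plücker coordinates of a family of `ℓ` vectors: the coordinates of
`w_0 ∧ … ∧ w_{ℓ-1}`, i.e. the maximal minors of the matrix with rows `w_i`. -/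
def plucker {ℓ d : ℕ} (w : Fin ℓ → RV d) : (Fin ℓ ↪o Fin (d + 1)) → ℝ :=
  fun J => Matrix.det (Matrix.of fun i j => w i (J j))

/-- The cone (without `0`) over a set `E` of points of the Grassmannian in the Plücker embedding:
all Plücker vectors of bases of members of `E`. -/
def pluckerCone {ℓ d : ℕ} (E : Set (RealGr ℓ d)) : Set ((Fin ℓ ↪o Fin (d + 1)) → ℝ) :=
  {ω | ∃ W ∈ E, ∃ w : Fin ℓ → RV d,
    LinearIndependent ℝ w ∧ Submodule.span ℝ (Set.range w) = W.space ∧ ω = plucker w}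

/-- `E` is slice-convex with respect to `V`: for each `V₀ ⊆ V` of codimension `1`, the two pieces of
the cone over `E ∩ P_{V₀}` in the Plücker embedding are convex. -/
def IsSliceConvexAt {ℓ d : ℕ} (E : Set (RealGr ℓ d)) (V : RealGr ℓ d) : Prop :=
  ∀ V₀ : Submodule ℝ (RV d), V₀ ≤ V.space → Module.finrank ℝ V₀ + 1 = ℓ →
    IsConvexDoubleCone (pluckerCone (E ∩ pencil ℓ V₀))

/-- `E` is slice-convex: it is so with respect to each of its points. -/
def IsSliceConvex {ℓ d : ℕ} (E : Set (RealGr ℓ d)) : Prop :=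
  ∀ V ∈ E, IsSliceConvexAt E V

/-- The cone (without `0`) in `V₀^⊥` over a set `E` of points of `P_{V₀}`, where `P_{V₀}` is
identified with the real projective space of lines in `V₀^⊥` by `ℝ u ↦ V₀ + ℝ u`. -/
def sliceCone {ℓ d : ℕ} (V₀ : Submodule ℝ (RV d)) (E : Set (RealGr ℓ d)) : Set V₀ᗮ :=
  {u | u ≠ 0 ∧ ∃ W ∈ E, W.space = V₀ ⊔ Submodule.span ℝ {(u : RV d)}}

end SliceConvex

end

/-! Let `S` be the affine cone over `X`, with apex. Fix a real `W₀` of dimension `ℓ - 1` contained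
in a real `ℓ`-dimensional subspace that meets `S` only in `0`. Noether normalization makes `S +
(W₀)_ℂ` a conic hypersurface `Z` (`exists_polynomial_cone_add`), and `W₀ + ℝu` avoids `S` exactly
when `u ∉ W₀` and `u ∉ Z`. Hyperbolicity of `S` with respect to `W₀ + ℝe` makes `e` a hyperbolic
direction of `Z`, so Gårding's theory of hyperbolicity cones applies inside every pencil:
hyperbolicity passes along segments that miss `Z` (`isHyperbolicDirection_of_segment`), and the
vectors reached from `e` by such segments form an open convex cone (`hyperbolicityCone`).

Nearby subspaces have bases that can be exchanged one vector at a time, and each exchange is a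
segment in a pencil. Hence hyperbolicity is locally constant on the subspaces that avoid `S`, and so
it holds on the whole component `C(V)` (`isHyperbolicCone_of_isPreconnected`). This is (3).

For (2), let `W = W₀ + ℝe` belong to `C(V)`, with hyperbolicity cone `K` of `e`. Segments show that
`K` and `-K` lie over `C(V)`. The difficulty is that `C(V)`, which is connected only inside the
Grassmannian, might return to the pencil in another region. Suppose that it contains `W₀ + ℝu` with
`u ∉ K ∪ -K`. The segments from `e` to `u` and to `-u` then both meet `Z`, which yields real points
`x₁, x₂` of `S` with `xᵢ ≡ u + cᵢ e` modulo `W₀` and `c₁ > 0 > c₂`. Both lie over the same point `y`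
of `Wᗮ`. After a small perturbation of `u`, the real points of `S` near each `xᵢ` are the graph of a
section of the projection along `W` that is differentiable at the point below, with derivative `Dᵢ`.
By the cone property of a hyperbolic direction, no tangent direction `Dᵢ q ≠ 0` lies in a subspace
with respect to which `S` is hyperbolic. Therefore the determinant of the pairing of `D₁` and `D₂`
modulo `V'` has no zero for `V' ∈ C(V)`. It is `1` at `V' = W`, hence positive throughout. At `V' =
W₀ + ℝu`, Euler's relation `Dᵢ y = xᵢ` shows that `D₁` equals `D₂` composed with a transvection of
determinant `c₁ / c₂ < 0`, a contradiction (`mul_nonneg_of_isSectionDeriv`).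

For (1), the Plücker vector of `W₀ + ℝu` is an injective linear function of `u ∈ W₀ᗮ`, so (2)
carries over. -/

noncomputable section

namespace SliceConvex

/-! ### Noether normalization and projections of cones onto hypersurfaces. -/

open MvPolynomial

/-- A graded quotient of `ℂ[x]` is integral over the subalgebra generated by linear forms without
a common zero on its zero locus. -/
theorem isIntegral_of_zeroLocus_linear_section {n m : ℕ} {B : Type*} [CommRing B]
    (π : MvPolynomial (Fin n) ℂ →+* B) (hπ : Function.Surjective π)
    (hI : ∀ f, π f = 0 → ∀ j, π (homogeneousComponent j f) = 0)
    (y : Fin m → MvPolynomial (Fin n) ℂ) (hy : ∀ j, (y j).IsHomogeneous 1)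
    (h0 : ∀ z ∈ zeroLocus ℂ (RingHom.ker π), (∀ j, aeval z (y j) = 0) → z = 0) :
    (π.comp (aeval y : MvPolynomial (Fin m) ℂ →ₐ[ℂ] _).toRingHom).IsIntegral := by
  classical
  set φ := π.comp (aeval y : MvPolynomial (Fin m) ℂ →ₐ[ℂ] _).toRingHom with hφ
  apply RingHom.Finite.to_isIntegral
  let _ := φ.toAlgebra
  have hrad : ∀ i, ∃ N, (X i : MvPolynomial (Fin n) ℂ) ^ N ∈
      RingHom.ker π ⊔ Ideal.span (Set.range y) := by
    intro i
    have : X i ∈ (RingHom.ker π ⊔ Ideal.span (Set.range y)).radical := by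
      rw [← vanishingIdeal_zeroLocus_eq_radical (K := ℂ)]
      intro z hz
      rw [Set.mem_singleton_iff.1 (h0 z (fun p hp => hz p (Ideal.mem_sup_left hp))
        (fun j => hz _ (Ideal.mem_sup_right (Ideal.subset_span ⟨j, rfl⟩))))]
      simp
    exact this
  choose N₀ hN₀ using hrad
  -- One exponent for all variables; the added `1` makes `N - 1` the true degree of the cofactors of
  -- the linear forms.
  set N := ∑ i, N₀ i + 1 with hN
  have hpow : ∀ i, ∃ c : Fin m → MvPolynomial (Fin n) ℂ, (∀ j, (c j).IsHomogeneous (N - 1)) ∧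
      π ((X i : MvPolynomial (Fin n) ℂ) ^ N) = ∑ j, π (y j) * π (c j) := by
    intro i
    have h1 : (X i : MvPolynomial (Fin n) ℂ) ^ N ∈ RingHom.ker π ⊔ Ideal.span (Set.range y) := by
      have hle : N₀ i ≤ N := le_trans (Finset.single_le_sum (f := N₀) (fun _ _ => Nat.zero_le _)
        (Finset.mem_univ i)) (Nat.le_succ _)
      rw [← Nat.sub_add_cancel hle, pow_add]
      exact Ideal.mul_mem_left _ _ (hN₀ i)
    obtain ⟨g, hg, s, hs, hgs⟩ := Submodule.mem_sup.1 h1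
    obtain ⟨a, ha⟩ := (Ideal.mem_span_range_iff_exists_fun).1 hs
    refine ⟨fun j => homogeneousComponent (N - 1) (a j),
      fun j => homogeneousComponent_isHomogeneous _ _, ?_⟩
    have h2 : homogeneousComponent N ((X i : MvPolynomial (Fin n) ℂ) ^ N) = X i ^ N := by
      have := (isHomogeneous_X ℂ i).pow N
      rw [one_mul] at this
      rw [homogeneousComponent_of_mem this, if_pos rfl]
    have h3 : ∀ j, homogeneousComponent N (a j * y j) = homogeneousComponent (N - 1) (a j) * y j := by
      intro j
      conv_lhs => rw [← sum_homogeneousComponent (a j), Finset.sum_mul, map_sum]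
      have h5 : ∀ i, homogeneousComponent N (homogeneousComponent i (a j) * y j) =
          if i = N - 1 then homogeneousComponent i (a j) * y j else 0 := by
        intro i
        rw [homogeneousComponent_of_mem
          (((homogeneousComponent_isHomogeneous i (a j)).mul (hy j)))]
        congr 1
        exact propext ⟨fun h => by omega, fun h => by omega⟩
      simp_rw [h5]
      rw [Finset.sum_ite_eq' (Finset.range ((a j).totalDegree + 1)) (N - 1)]
      split_ifs with h6
      · rfl
      · rw [homogeneousComponent_eq_zero _ _ (by rw [Finset.mem_range] at h6; omega), zero_mul]
    have h4 := congrArg (homogeneousComponent N) hgs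
    rw [map_add, h2, ← ha, map_sum] at h4
    simp_rw [h3] at h4
    rw [← h4, map_add, hI g hg N, zero_add, map_sum]
    simp_rw [map_mul, mul_comm]
  -- By pigeonhole, a monomial of degree at least `n * N + 1` has an exponent at least `N`. Then `X
  -- i ^ N` can be traded for combinations of the `y j` with cofactors of total degree one less, so
  -- the monomials below this degree generate.
  set D₀ := n * N + 1 with hD₀
  let T : Set (Fin n →₀ ℕ) := {α | α.degree < D₀}
  have hT : T.Finite := Finsupp.finite_of_degree_lt D₀
  let M : Submodule (MvPolynomial (Fin m) ℂ) B :=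
    Submodule.span _ ((fun α => π (monomial α 1)) '' T)
  have hsmul : ∀ (a : MvPolynomial (Fin m) ℂ) (b : B), a • b = π (aeval y a) * b := by
    intro a b
    rw [Algebra.smul_def, RingHom.algebraMap_toAlgebra]
    rfl
  have hym : ∀ (j : Fin m) (b : B), b ∈ M → π (y j) * b ∈ M := by
    intro j b hb
    have := M.smul_mem (X j) hb
    rwa [hsmul, aeval_X] at this
  have hcm : ∀ (c : ℂ) (b : B), b ∈ M → π (C c) * b ∈ M := by
    intro c b hb
    have := M.smul_mem (C c) hb
    rwa [hsmul, aeval_C] at this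
  have hmon : ∀ D, ∀ α : Fin n →₀ ℕ, α.degree = D → π (monomial α 1) ∈ M := by
    intro D
    induction D with
    | zero =>
      intro α hα
      exact Submodule.subset_span ⟨α, by simp [T, hα, hD₀], rfl⟩
    | succ D ih =>
      intro α hα
      by_cases hD : D + 1 < D₀
      · exact Submodule.subset_span ⟨α, by simpa [T, hα] using hD, rfl⟩
      have hom : ∀ f : MvPolynomial (Fin n) ℂ, f.IsHomogeneous D → π f ∈ M := by
        intro f hf
        rw [f.as_sum, map_sum]
        refine Submodule.sum_mem _ fun β hβ => ?_
        have : monomial β (coeff β f) = C (coeff β f) * monomial β (1 : ℂ) := by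
          rw [C_mul_monomial, mul_one]
        rw [this, map_mul]
        refine hcm _ _ (ih β ?_)
        have := hf (mem_support_iff.1 hβ)
        rw [Finsupp.degree_eq_weight_one]
        exact this
      obtain ⟨i, hi⟩ : ∃ i, N ≤ α i := by
        by_contra! hcon
        have h1 : α.degree ≤ ∑ i : Fin n, N := by
          rw [Finsupp.degree_eq_sum]
          exact Finset.sum_le_sum fun i _ => (hcon i).le
        simp at h1
        omega
      obtain ⟨c, hc, hce⟩ := hpow i
      have hsplit : monomial α (1 : ℂ) = X i ^ N * monomial (α - Finsupp.single i N) 1 := by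
        rw [X_pow_eq_monomial, monomial_mul, one_mul]
        congr 1
        rw [add_tsub_cancel_of_le]
        simpa using hi
      have hdeg : (α - Finsupp.single i N).degree = D + 1 - N := by
        have h1 : (Finsupp.single i N + (α - Finsupp.single i N)).degree = D + 1 := by
          rw [add_tsub_cancel_of_le (by simpa using hi), hα]
        rw [map_add, Finsupp.degree_single] at h1
        omega
      have hle : N ≤ D + 1 := by
        rw [← hα]; exact hi.trans (Finsupp.le_degree i α)
      rw [hsplit, map_mul, hce, Finset.sum_mul]
      refine Submodule.sum_mem _ fun j _ => ?_
      rw [mul_assoc, ← map_mul π (c j)]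
      refine hym _ _ (hom _ ?_)
      have h5 := (hc j).mul (isHomogeneous_monomial (1 : ℂ) hdeg)
      have h6 : N - 1 + (D + 1 - N) = D := by omega
      rwa [h6] at h5
  have htop : M = ⊤ := by
    rw [eq_top_iff]
    rintro b -
    obtain ⟨f, rfl⟩ := hπ b
    rw [f.as_sum, map_sum]
    refine Submodule.sum_mem _ fun β hβ => ?_
    have : monomial β (coeff β f) = C (coeff β f) * monomial β (1 : ℂ) := by
      rw [C_mul_monomial, mul_one]
    rw [this, map_mul]
    exact hcm _ _ (hmon _ β rfl)
  exact ⟨⟨(hT.image _).toFinset, by simpa [M] using htop⟩⟩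

/-- A nonzero `r` in the kernel would make `B` integral over `ℂ[y]/(r)`, whose dimension is less
than `m`, while integral extensions do not raise the dimension. -/
theorem injective_of_isIntegral_of_ringKrullDim {m : ℕ} {B : Type*} [CommRing B] [IsDomain B]
    (φ : MvPolynomial (Fin m) ℂ →+* B) (hφ : φ.IsIntegral)
    (hB : ringKrullDim B = (m : WithBot ℕ∞)) : Function.Injective φ := by
  rw [injective_iff_map_eq_zero]
  intro r hr
  by_contra hr0
  have hle : Ideal.span {r} ≤ RingHom.ker φ := by
    rw [Ideal.span_le, Set.singleton_subset_iff]; exact hr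
  let ψ : MvPolynomial (Fin m) ℂ ⧸ Ideal.span {r} →+* B := Ideal.Quotient.lift _ φ hle
  have hψ : ψ.IsIntegral := by
    have : (ψ.comp (Ideal.Quotient.mk (Ideal.span {r}))).IsIntegral := by
      have h : ψ.comp (Ideal.Quotient.mk (Ideal.span {r})) = φ := RingHom.ext fun _ => rfl
      rwa [h]
    exact RingHom.IsIntegral.tower_top _ _ this
  have h1 : ringKrullDim B ≤ ringKrullDim (MvPolynomial (Fin m) ℂ ⧸ Ideal.span {r}) := by
    let _ := ψ.toAlgebra
    have : Algebra.IsIntegral (MvPolynomial (Fin m) ℂ ⧸ Ideal.span {r}) B := ⟨hψ⟩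
    refine Order.krullDim_le_of_strictMono (PrimeSpectrum.comap ψ) ?_
    intro P Q hPQ
    have := P.isPrime
    exact Ideal.IsIntegral.comap_lt_comap (R := MvPolynomial (Fin m) ℂ ⧸ Ideal.span {r}) hPQ
  have h2 := ringKrullDim_quotient_succ_le_of_nonZeroDivisor (mem_nonZeroDivisors_of_ne_zero hr0)
  rw [MvPolynomial.ringKrullDim_of_isNoetherianRing, ringKrullDim_eq_zero_of_field] at h2
  rw [hB] at h1
  have h3 := (add_le_add_left h1 1).trans h2
  simp only [Nat.card_eq_fintype_card, Fintype.card_fin, zero_add] at h3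
  exact absurd h3 (not_le.2 (by exact_mod_cast Nat.lt_succ_self m))

/-- Evaluation of a polynomial in `t` with coefficients in `ℂ[y]`. -/
def evalPair {m : ℕ} (y₀ : Fin m → ℂ) (t₀ : ℂ) : Polynomial (MvPolynomial (Fin m) ℂ) →+* ℂ :=
  Polynomial.eval₂RingHom (aeval y₀ : MvPolynomial (Fin m) ℂ →ₐ[ℂ] ℂ).toRingHom t₀

/-- The ring `ℂ[y]` is integrally closed, so the kernel of `ℂ[y][t] → B`, `t ↦ h`, is generated by
the minimal polynomial of `h`. A root of this polynomial is thus a maximal ideal containing the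
kernel, and lying over lifts it to `B`. Geometrically, the hypersurface `f = 0` is the whole image
of the component under `(y, h)`. -/
theorem exists_maximal_over_root_minpoly {m : ℕ} {B : Type*} [CommRing B] [IsDomain B]
    (φ : MvPolynomial (Fin m) ℂ →+* B) (hφ : φ.IsIntegral) (hinj : Function.Injective φ) (h : B) :
    ∃ f : Polynomial (MvPolynomial (Fin m) ℂ), f.eval₂ φ h = 0 ∧
      ∀ (y₀ : Fin m → ℂ) (t₀ : ℂ), evalPair y₀ t₀ f = 0 →
        ∃ Q : Ideal B, Q.IsMaximal ∧ (∀ j, φ (X j - C (y₀ j)) ∈ Q) ∧ h - φ (C t₀) ∈ Q := by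
  let _ := φ.toAlgebra
  have : Algebra.IsIntegral (MvPolynomial (Fin m) ℂ) B := ⟨hφ⟩
  have : FaithfulSMul (MvPolynomial (Fin m) ℂ) B :=
    (faithfulSMul_iff_algebraMap_injective _ _).2 hinj
  have hint : IsIntegral (MvPolynomial (Fin m) ℂ) h := hφ h
  refine ⟨minpoly (MvPolynomial (Fin m) ℂ) h, minpoly.aeval _ h, ?_⟩
  intro y₀ t₀ h0
  let Φ : Polynomial (MvPolynomial (Fin m) ℂ) →+* B :=
    (Polynomial.aeval (R := MvPolynomial (Fin m) ℂ) h).toRingHom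
  have hΦ : Φ.IsIntegral := by
    have : (Φ.comp Polynomial.C).IsIntegral := by
      have : Φ.comp Polynomial.C = φ := by
        ext <;> simp [Φ, RingHom.algebraMap_toAlgebra]
      rwa [this]
    exact RingHom.IsIntegral.tower_top _ _ this
  have hsurj : Function.Surjective (evalPair y₀ t₀) := by
    intro c
    exact ⟨Polynomial.C (C c), by simp [evalPair]⟩
  have hmax := RingHom.ker_isMaximal_of_surjective _ hsurj
  have hker : RingHom.ker Φ ≤ RingHom.ker (evalPair y₀ t₀) := by
    rw [minpoly.ker_eval hint, Ideal.span_le, Set.singleton_subset_iff]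
    exact h0
  let _ := Φ.toAlgebra
  have : Algebra.IsIntegral (Polynomial (MvPolynomial (Fin m) ℂ)) B := ⟨hΦ⟩
  obtain ⟨Q, hQ, hQc⟩ := Ideal.exists_ideal_over_maximal_of_isIntegral (S := B)
    (RingHom.ker (evalPair y₀ t₀)) hker
  have hmem : ∀ g, evalPair y₀ t₀ g = 0 → Φ g ∈ Q := by
    intro g hg
    have : g ∈ Q.comap (algebraMap (Polynomial (MvPolynomial (Fin m) ℂ)) B) := by
      rw [hQc]; exact hg
    exact this
  refine ⟨Q, hQ, fun j => ?_, ?_⟩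
  · have := hmem (Polynomial.C (X j - C (y₀ j))) (by simp [evalPair])
    simpa [Φ, RingHom.algebraMap_toAlgebra] using this
  · have := hmem (Polynomial.X - Polynomial.C (C t₀)) (by simp [evalPair])
    simpa [Φ, RingHom.algebraMap_toAlgebra] using this

/-- A linear functional as a linear form. -/
def linearForm {n : ℕ} (L : (Fin n → ℂ) →ₗ[ℂ] ℂ) : MvPolynomial (Fin n) ℂ :=
  ∑ i, C (L (Pi.single i 1)) * X i

theorem eval_linearForm {n : ℕ} (L : (Fin n → ℂ) →ₗ[ℂ] ℂ) (z : Fin n → ℂ) :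
    eval z (linearForm L) = L z := by
  rw [LinearMap.pi_apply_eq_sum_univ L z]
  simp only [linearForm, map_sum, map_mul, eval_C, eval_X, smul_eq_mul]
  refine Finset.sum_congr rfl fun i _ => ?_
  rw [mul_comm]
  congr 2
  ext j
  simp [Pi.single_apply, eq_comm]

theorem isHomogeneous_linearForm {n : ℕ} (L : (Fin n → ℂ) →ₗ[ℂ] ℂ) :
    (linearForm L).IsHomogeneous 1 := by
  refine IsHomogeneous.sum _ _ _ fun i _ => ?_
  simpa using (isHomogeneous_C (Fin n) (L (Pi.single i 1))).mul (isHomogeneous_X ℂ i)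

theorem aeval_smul_of_isHomogeneous {n m : ℕ} {R : Type*} [CommSemiring R] [Algebra R ℂ]
    {f : MvPolynomial (Fin n) R} (hf : f.IsHomogeneous m) (c : ℂ) (z : Fin n → ℂ) :
    aeval (c • z) f = c ^ m * aeval z f := by
  simp only [aeval_def, eval₂_eq', Finset.mul_sum]
  refine Finset.sum_congr rfl fun d hd => ?_
  have h1 : ∑ i, d i = m := by
    rw [← Finsupp.degree_eq_sum, Finsupp.degree_eq_weight_one]
    exact hf (mem_support_iff.1 hd)
  simp only [Pi.smul_apply, smul_eq_mul, mul_pow, Finset.prod_mul_distrib, Finset.prod_pow_eq_pow_sum,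
    h1]
  ring

/-- For `z ∈ S` the polynomial `c ↦ f (c z)` vanishes identically, and its coefficients are the
values at `z` of the components of `f`. -/
theorem homogeneousComponent_mem_vanishingIdeal {n : ℕ} {S : Set (Fin n → ℂ)}
    (hS : ∀ z ∈ S, ∀ c : ℂ, c • z ∈ S) {f : MvPolynomial (Fin n) ℂ}
    (hf : f ∈ vanishingIdeal ℂ S) (j : ℕ) : homogeneousComponent j f ∈ vanishingIdeal ℂ S := by
  intro z hz
  let q : Polynomial ℂ := ∑ i ∈ Finset.range (f.totalDegree + 1),
    Polynomial.C (aeval z (homogeneousComponent i f)) * Polynomial.X ^ i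
  have hq : q = 0 := by
    refine Polynomial.funext fun c => ?_
    have h1 := hf _ (hS z hz c)
    rw [← sum_homogeneousComponent f, map_sum] at h1
    simp only [q, Polynomial.eval_finsetSum, Polynomial.eval_mul, Polynomial.eval_C,
      Polynomial.eval_pow, Polynomial.eval_X, Polynomial.eval_zero]
    rw [← h1]
    refine Finset.sum_congr rfl fun i _ => ?_
    rw [aeval_smul_of_isHomogeneous (homogeneousComponent_isHomogeneous i f), mul_comm]
  by_cases hj : j ∈ Finset.range (f.totalDegree + 1)
  · have h2 := congrArg (fun p => Polynomial.coeff p j) hq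
    simpa [q, Polynomial.finsetSum_coeff, Polynomial.coeff_C_mul, Polynomial.coeff_X_pow, hj] using h2
  · rw [homogeneousComponent_eq_zero _ _ (by rw [Finset.mem_range] at hj; omega), map_zero]

/-- Projecting an equidimensional affine cone along a linear subspace so that the image is a
hypersurface. -/
theorem exists_polynomial_cone_add {n m : ℕ} (S : Set (Fin n → ℂ))
    (hS : ∀ z ∈ S, ∀ c : ℂ, c • z ∈ S)
    (hcl : zeroLocus ℂ (vanishingIdeal ℂ S) ⊆ S)
    (hdim : ∀ P ∈ (vanishingIdeal ℂ S).minimalPrimes,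
      ringKrullDim (MvPolynomial (Fin n) ℂ ⧸ P) = (m : WithBot ℕ∞))
    (W₀ : Submodule ℂ (Fin n → ℂ)) (v : Fin n → ℂ) (hv : v ∉ W₀)
    (hfin : Module.finrank ℂ (W₀ ⊔ Submodule.span ℂ {v} : Submodule ℂ (Fin n → ℂ)) + m = n)
    (h0 : ∀ z ∈ S, z ∈ W₀ ⊔ Submodule.span ℂ {v} → z = 0) :
    ∃ p : MvPolynomial (Fin n) ℂ, ∀ z, eval z p = 0 ↔ ∃ w ∈ W₀, z + w ∈ S := by
  classical
  set W := W₀ ⊔ Submodule.span ℂ {v} with hW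
  obtain ⟨y, hy⟩ : ∃ y : (Fin n → ℂ) →ₗ[ℂ] (Fin m → ℂ), LinearMap.ker y = W := by
    have h1 : Module.finrank ℂ ((Fin n → ℂ) ⧸ W) = Module.finrank ℂ (Fin m → ℂ) := by
      have := Submodule.finrank_quotient_add_finrank W
      rw [Module.finrank_fin_fun] at this ⊢
      omega
    let e := LinearEquiv.ofFinrankEq _ _ h1
    exact ⟨e.toLinearMap ∘ₗ W.mkQ, by rw [LinearEquiv.ker_comp, Submodule.ker_mkQ]⟩
  -- The forms `y` cut out `W` and `h` separates `W₀` from `v`; together, `(y, h)` is a linear map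
  -- with kernel exactly `W₀`, that is, the projection along `W₀`.
  obtain ⟨h, hhv, hhW⟩ := Submodule.exists_le_ker_of_notMem hv
  have hsep : ∀ z, y z = 0 → h z = 0 → z ∈ W₀ := by
    intro z h1 h2
    have h3 : z ∈ W := by rw [← hy]; exact h1
    obtain ⟨a, ha, b, hb, rfl⟩ := Submodule.mem_sup.1 h3
    obtain ⟨c, rfl⟩ := Submodule.mem_span_singleton.1 hb
    have h4 : h a = 0 := hhW ha
    rw [map_add, h4, zero_add, map_smul, smul_eq_mul, mul_eq_zero] at h2
    rcases h2 with h2 | h2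
    · simpa [h2] using ha
    · exact absurd h2 hhv
  have hyW : ∀ w ∈ W₀, y w = 0 := fun w hw => by
    have : w ∈ LinearMap.ker y := by rw [hy]; exact Submodule.mem_sup_left hw
    exact this
  set I := vanishingIdeal ℂ S with hI
  let Y : Fin m → MvPolynomial (Fin n) ℂ := fun j => linearForm (LinearMap.proj j ∘ₗ y)
  have hY : ∀ j z, eval z (Y j) = y z j := fun j z => eval_linearForm _ z
  let H := linearForm h
  have hH : ∀ z, eval z H = h z := eval_linearForm h
  have hint := isIntegral_of_zeroLocus_linear_section (Ideal.Quotient.mk I)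
    Ideal.Quotient.mk_surjective
    (fun f hf j => by
      rw [Ideal.Quotient.eq_zero_iff_mem] at hf ⊢
      exact homogeneousComponent_mem_vanishingIdeal hS hf j)
    Y (fun j => isHomogeneous_linearForm _)
    (fun z hz hz0 => by
      rw [Ideal.mk_ker] at hz
      refine h0 z (hcl hz) ?_
      rw [← hy, LinearMap.mem_ker]
      ext j
      have := hz0 j
      rwa [aeval_eq_eval, hY] at this)
  have hpair : ∀ (f : Polynomial (MvPolynomial (Fin m) ℂ)) z,
      eval z (f.eval₂ (aeval Y : _ →ₐ[ℂ] MvPolynomial (Fin n) ℂ).toRingHom H) =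
        evalPair (y z) (h z) f := by
    intro f z
    rw [Polynomial.hom_eval₂, evalPair, Polynomial.coe_eval₂RingHom, hH]
    congr 1
    apply MvPolynomial.ringHom_ext
    · intro c; simp
    · intro j; simp [hY]
  have hP : ∀ P ∈ I.minimalPrimes, ∃ p : MvPolynomial (Fin n) ℂ, p ∈ P ∧
      (∀ z, ∀ w ∈ W₀, eval (z + w) p = eval z p) ∧
      ∀ z, eval z p = 0 → ∃ w ∈ W₀, z + w ∈ S := by
    intro P hP
    have hPp : P.IsPrime := hP.1.1
    let φ : MvPolynomial (Fin m) ℂ →+* MvPolynomial (Fin n) ℂ ⧸ P :=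
      (Ideal.Quotient.mk P).comp (aeval Y : MvPolynomial (Fin m) ℂ →ₐ[ℂ] _).toRingHom
    have hφ : φ.IsIntegral := by
      have h1 : φ = (Ideal.Quotient.factor hP.1.2).comp ((Ideal.Quotient.mk I).comp
        (aeval Y : MvPolynomial (Fin m) ℂ →ₐ[ℂ] _).toRingHom) := rfl
      rw [h1]
      exact hint.trans _ _ (RingHom.isIntegral_of_surjective _
        (Ideal.Quotient.factor_surjective hP.1.2))
    obtain ⟨f, hf, hroot⟩ := exists_maximal_over_root_minpoly φ hφ
      (injective_of_isIntegral_of_ringKrullDim φ hφ (hdim P hP)) (Ideal.Quotient.mk P H)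
    refine ⟨f.eval₂ (aeval Y : _ →ₐ[ℂ] MvPolynomial (Fin n) ℂ).toRingHom H, ?_, ?_, ?_⟩
    · rw [← Ideal.Quotient.eq_zero_iff_mem, Polynomial.hom_eval₂]
      exact hf
    · intro z w hw
      have h4 : h w = 0 := hhW hw
      rw [hpair, hpair, map_add, map_add, hyW w hw, h4, add_zero, add_zero]
    · intro z hz
      rw [hpair] at hz
      obtain ⟨Q, hQ, hQ1, hQ2⟩ := hroot _ _ hz
      have hQ' : (Q.comap (Ideal.Quotient.mk P)).IsMaximal :=
        Ideal.comap_isMaximal_of_surjective _ Ideal.Quotient.mk_surjective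
      obtain ⟨u, hu⟩ := eq_vanishingIdeal_singleton_of_isMaximal ℂ hQ'
      have hmem : ∀ g, Ideal.Quotient.mk P g ∈ Q → eval u g = 0 := by
        intro g hg
        have h5 : g ∈ Q.comap (Ideal.Quotient.mk P) := hg
        rw [hu, mem_vanishingIdeal_singleton_iff, aeval_eq_eval] at h5
        exact h5
      refine ⟨u - z, hsep _ ?_ ?_, ?_⟩
      · ext j
        have h6 := hmem (Y j - C (y z j)) (by simpa [φ] using hQ1 j)
        rw [map_sub, hY, eval_C] at h6
        simpa using h6
      · have h6 := hmem (H - C (h z)) (by simpa [φ] using hQ2)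
        rw [map_sub, hH, eval_C] at h6
        simpa using h6
      · rw [add_sub_cancel]
        refine hcl fun g hg => ?_
        refine hmem g ?_
        rw [Ideal.Quotient.eq_zero_iff_mem.2 (hP.1.2 hg)]
        exact Q.zero_mem
  choose! p hp1 hp2 hp3 using hP
  have hfinite := Ideal.finite_minimalPrimes_of_isNoetherianRing _ I
  -- Each component of `S` projects onto a hypersurface, and the product of their equations
  -- describes the union.
  refine ⟨∏ P ∈ hfinite.toFinset, p P, fun z => ⟨fun hz => ?_, ?_⟩⟩
  · rw [map_prod, Finset.prod_eq_zero_iff] at hz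
    obtain ⟨P, hP, hz⟩ := hz
    exact hp3 P (hfinite.mem_toFinset.1 hP) z hz
  · rintro ⟨w, hw, hzw⟩
    have h7 : I ≤ vanishingIdeal ℂ {z + w} :=
      vanishingIdeal_anti_mono (by simpa using hzw)
    have : (vanishingIdeal ℂ {z + w} : Ideal (MvPolynomial (Fin n) ℂ)).IsPrime :=
      inferInstance
    obtain ⟨P, hP, hPle⟩ := Ideal.exists_minimalPrimes_le h7
    rw [map_prod]
    refine Finset.prod_eq_zero (hfinite.mem_toFinset.2 hP) ?_
    rw [← hp2 P hP z w hw]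
    have := hPle (hp1 P hP)
    rwa [mem_vanishingIdeal_singleton_iff, aeval_eq_eval] at this

open Filter Topology

/-! ### Real vectors inside complex space. -/

section toComplex
variable {d : ℕ}

theorem toComplex_add (x y : RV d) : toComplex (x + y) = toComplex x + toComplex y := by
  ext i; simp [toComplex]

theorem toComplex_smul (r : ℝ) (x : RV d) : toComplex (r • x) = (r : ℂ) • toComplex x := by
  ext i; simp [toComplex]

theorem toComplex_neg (x : RV d) : toComplex (-x) = -toComplex x := by
  ext i; simp [toComplex]

theorem toComplex_sub (x y : RV d) : toComplex (x - y) = toComplex x - toComplex y := by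
  ext i; simp [toComplex]

@[simp] theorem toComplex_zero : toComplex (0 : RV d) = 0 := by
  ext i; simp [toComplex]

theorem toComplex_injective : Function.Injective (toComplex (d := d)) := by
  intro x y h
  ext i
  have := congrFun h i
  simpa [toComplex] using this

theorem continuous_toComplex : Continuous (toComplex (d := d)) := by
  unfold toComplex
  fun_prop

theorem toComplex_sum {α : Type*} (s : Finset α) (f : α → RV d) :
    toComplex (∑ i ∈ s, f i) = ∑ i ∈ s, toComplex (f i) := by
  classical
  induction s using Finset.induction_on with
  | empty => simp
  | insert a s ha ih => rw [Finset.sum_insert ha, Finset.sum_insert ha, toComplex_add, ih]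

theorem re_add_im_injective {a b a' b' : RV d}
    (h : toComplex a + Complex.I • toComplex b = toComplex a' + Complex.I • toComplex b') :
    a = a' ∧ b = b' := by
  have h1 : ∀ i, (a i = a' i) ∧ (b i = b' i) := by
    intro i
    have := congrFun h i
    have hre := congrArg Complex.re this
    have him := congrArg Complex.im this
    simp [toComplex] at hre him
    exact ⟨hre, him⟩
  exact ⟨PiLp.ext fun i => (h1 i).1, PiLp.ext fun i => (h1 i).2⟩

end toComplex

/-! ### Persistence of zeros and conic hypersurfaces. -/

/-- Zeros of a continuous family of entire functions persist under small perturbations. -/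
theorem eventually_exists_zero {T : Type*} [TopologicalSpace T] (F : T → ℂ → ℂ)
    (hF : Continuous (Function.uncurry F)) (hd : ∀ a, Differentiable ℂ (F a)) (a₀ : T)
    (h0 : F a₀ 0 = 0) (hne : ∃ t, F a₀ t ≠ 0) {ε : ℝ} (hε : 0 < ε) :
    ∀ᶠ a in 𝓝 a₀, ∃ t, ‖t‖ < ε ∧ F a t = 0 := by
  have han : AnalyticOnNhd ℂ (F a₀) Set.univ := fun z _ => (hd a₀).analyticAt z
  have hev : ∀ᶠ t in 𝓝[≠] (0 : ℂ), F a₀ t ≠ 0 := by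
    rcases (han 0 trivial).eventually_eq_zero_or_eventually_ne_zero with h | h
    · obtain ⟨t, ht⟩ := hne
      exact absurd (han.eqOn_zero_of_preconnected_of_eventuallyEq_zero isPreconnected_univ
        (Set.mem_univ 0) h (Set.mem_univ t)) ht
    · exact h
  obtain ⟨δ, hδ, hδ'⟩ := Metric.eventually_nhds_iff.1 (eventually_nhdsWithin_iff.1 hev)
  set r := min δ ε / 2 with hr
  have hr0 : 0 < r := by positivity
  have hrδ : r < δ := by
    have := min_le_left δ ε
    have : 0 < min δ ε := lt_min hδ hε
    linarith
  have hrε : r < ε := by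
    have := min_le_right δ ε
    have : 0 < min δ ε := lt_min hδ hε
    linarith
  have hsph : ∀ t ∈ Metric.sphere (0 : ℂ) r, F a₀ t ≠ 0 := by
    intro t ht
    have ht' : ‖t‖ = r := by simpa using ht
    refine hδ' (by simpa [ht'] using hrδ) ?_
    rintro rfl
    simp at ht'
    linarith
  -- On a circle free of zeros `|F a₀|` is at least `m`. If `F a` is within `m / 4` of it on the
  -- disc, the quantitative open mapping theorem puts `0` in the image of the disc under `F a`.
  obtain ⟨m, hm, hmle⟩ : ∃ m > 0, ∀ t ∈ Metric.sphere (0 : ℂ) r, m ≤ ‖F a₀ t‖ := by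
    have hne' : (Metric.sphere (0 : ℂ) r).Nonempty := NormedSpace.sphere_nonempty.2 hr0.le
    obtain ⟨t₀, ht₀, hmin⟩ := (isCompact_sphere (0 : ℂ) r).exists_isMinOn hne'
      ((hd a₀).continuous.norm.continuousOn)
    exact ⟨‖F a₀ t₀‖, norm_pos_iff.2 (hsph t₀ ht₀), fun t ht => hmin ht⟩
  have hclose : ∀ᶠ a in 𝓝 a₀, ∀ t ∈ Metric.closedBall (0 : ℂ) r, ‖F a t - F a₀ t‖ < m / 4 := by
    refine (isCompact_closedBall (0 : ℂ) r).eventually_forall_of_forall_eventually ?_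
    intro t _
    have hc : Continuous fun q : T × ℂ => ‖F q.1 q.2 - F a₀ q.2‖ := by
      refine (hF.sub ?_).norm
      exact (hd a₀).continuous.comp continuous_snd
    have := hc.tendsto (a₀, t)
    simp only [sub_self, norm_zero] at this
    exact this.eventually (gt_mem_nhds (by positivity))
  filter_upwards [hclose] with a ha
  have h00 : ‖F a 0‖ < m / 4 := by
    have := ha 0 (by simp [hr0.le])
    rwa [h0, sub_zero] at this
  have hbd : ∀ z ∈ Metric.sphere (0 : ℂ) r, m / 2 ≤ ‖F a z - F a 0‖ := by
    intro z hz
    have h1 := ha z (Metric.sphere_subset_closedBall hz)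
    have h2 := hmle z hz
    have h3 : ‖F a₀ z‖ ≤ ‖F a z - F a 0‖ + ‖F a z - F a₀ z‖ + ‖F a 0‖ := by
      have : F a₀ z = (F a z - F a 0) - (F a z - F a₀ z) + F a 0 := by ring
      calc ‖F a₀ z‖ = ‖(F a z - F a 0) - (F a z - F a₀ z) + F a 0‖ := by rw [← this]
        _ ≤ ‖(F a z - F a 0) - (F a z - F a₀ z)‖ + ‖F a 0‖ := norm_add_le _ _
        _ ≤ _ := by gcongr; exact norm_sub_le _ _
    linarith
  have hfreq : ∃ᶠ z in 𝓝 (0 : ℂ), F a z ≠ F a 0 := by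
    intro hcon
    have hcon' : ∀ᶠ z in 𝓝 (0 : ℂ), F a z = F a 0 := by simpa using hcon
    have h4 := AnalyticOnNhd.eqOn_of_preconnected_of_eventuallyEq
      (fun z _ => (hd a).analyticAt z) (analyticOnNhd_const (v := F a 0)) isPreconnected_univ
      (Set.mem_univ (0 : ℂ)) hcon'
    obtain ⟨z, hz⟩ : (Metric.sphere (0 : ℂ) r).Nonempty := NormedSpace.sphere_nonempty.2 hr0.le
    have h5 := hbd z hz
    rw [h4 (Set.mem_univ z)] at h5
    simp at h5
    linarith
  have hsub := (hd a).diffContOnCl.ball_subset_image_closedBall (z₀ := 0) hr0 hbd hfreq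
  obtain ⟨t, ht, ht0⟩ := hsub (show (0 : ℂ) ∈ Metric.ball (F a 0) (m / 2 / 2) by
    rw [Metric.mem_ball, dist_comm, dist_zero_right]; linarith)
  exact ⟨t, lt_of_le_of_lt (by simpa using ht) hrε, ht0⟩

/-- The restriction of a polynomial to a line. -/
def restrictLine {n : ℕ} (p : MvPolynomial (Fin n) ℂ) (a b : Fin n → ℂ) : Polynomial ℂ :=
  aeval (fun i => Polynomial.C (a i) + Polynomial.X * Polynomial.C (b i)) p

theorem eval_restrictLine {n : ℕ} (p : MvPolynomial (Fin n) ℂ) (a b : Fin n → ℂ) (s : ℂ) :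
    (restrictLine p a b).eval s = eval (a + s • b) p := by
  rw [restrictLine, ← Polynomial.coe_evalRingHom, MvPolynomial.aeval_def, MvPolynomial.hom_eval₂,
    eval, coe_eval₂Hom]
  congr 1
  · ext; simp
  · ext i; simp; exact mul_comm _ _

/-- The zero set of a polynomial that is invariant under complex scalars. -/
structure IsConicHypersurface {n : ℕ} (Z : Set (Fin n → ℂ)) : Prop where
  smul_mem : ∀ z ∈ Z, ∀ c : ℂ, c • z ∈ Z
  exists_polynomial : ∃ p : MvPolynomial (Fin n) ℂ, ∀ z, z ∈ Z ↔ eval z p = 0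

namespace IsConicHypersurface

variable {n : ℕ} {Z : Set (Fin n → ℂ)} (hZ : IsConicHypersurface Z)
include hZ

theorem isClosed : IsClosed Z := by
  obtain ⟨p, hp⟩ := hZ.exists_polynomial
  have : Z = (fun z => eval z p) ⁻¹' {0} := by ext z; simp [hp]
  rw [this]
  exact isClosed_singleton.preimage p.continuous_eval

theorem smul_mem_iff {c : ℂ} (hc : c ≠ 0) {z : Fin n → ℂ} : c • z ∈ Z ↔ z ∈ Z :=
  ⟨fun h => by simpa [smul_smul, hc] using hZ.smul_mem _ h c⁻¹, fun h => hZ.smul_mem z h c⟩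

/-- A ball of radius `δ` around `v` misses `Z`, and `z + t v ∈ Z` gives `t⁻¹ z + v ∈ Z`; so `R =
δ⁻¹` bounds the roots along `v`. -/
theorem exists_bound {v : Fin n → ℂ} (hv : v ∉ Z) :
    ∃ R : ℝ, 0 < R ∧ ∀ (z : Fin n → ℂ) (t : ℂ), z + t • v ∈ Z → ‖t‖ ≤ R * ‖z‖ := by
  obtain ⟨δ, hδ, hball⟩ := Metric.isOpen_iff.1 hZ.isClosed.isOpen_compl v hv
  refine ⟨δ⁻¹, inv_pos.2 hδ, fun z t h => ?_⟩
  by_contra! hcon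
  have ht : t ≠ 0 := by
    rintro rfl
    simp at hcon
    have : 0 ≤ δ⁻¹ * ‖z‖ := by positivity
    linarith
  refine hball (a := t⁻¹ • z + v) ?_ ?_
  · rw [Metric.mem_ball, dist_eq_norm, add_sub_cancel_right, norm_smul, norm_inv]
    have h1 : ‖z‖ < δ * ‖t‖ := by
      rwa [inv_mul_lt_iff₀ hδ] at hcon
    rwa [inv_mul_lt_iff₀ (norm_pos_iff.2 ht), mul_comm]
  · have := hZ.smul_mem _ h t⁻¹
    rwa [smul_add, smul_smul, inv_mul_cancel₀ ht, one_smul] at this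

/-- Roots in the direction `v` depend continuously on the base point. The restriction to the line is
not identically zero because `exists_bound` confines its roots. -/
theorem eventually_exists_add_smul_mem {v z : Fin n → ℂ} (hv : v ∉ Z) (hz : z ∈ Z) {ε : ℝ}
    (hε : 0 < ε) : ∀ᶠ y in 𝓝 z, ∃ s : ℂ, ‖s‖ < ε ∧ y + s • v ∈ Z := by
  obtain ⟨p, hp⟩ := hZ.exists_polynomial
  have := eventually_exists_zero (fun (y : Fin n → ℂ) (s : ℂ) => eval (y + s • v) p) ?_ ?_ z
    ?_ ?_ hε
  · filter_upwards [this] with y hy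
    obtain ⟨s, hs, h⟩ := hy
    exact ⟨s, hs, (hp _).2 h⟩
  · exact p.continuous_eval.comp (by fun_prop)
  · intro a
    simp only [← eval_restrictLine]
    exact Polynomial.differentiable _
  · simpa using (hp z).1 hz
  · obtain ⟨R, hR, hb⟩ := hZ.exists_bound hv
    refine ⟨((R * ‖z‖ + 1 : ℝ) : ℂ), fun h => ?_⟩
    have h2 := hb z _ ((hp _).2 h)
    rw [Complex.norm_real, Real.norm_of_nonneg (by positivity)] at h2
    linarith

/-- Continuation of the absence of roots in a closed half plane along a path. -/
theorem halfPlane_continuation {γ : ℝ → Fin n → ℂ} (hγ : Continuous γ) {v : Fin n → ℂ}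
    (hv : v ∉ Z)
    (him : ∀ β ∈ Set.Icc (0 : ℝ) 1, ∀ τ : ℝ, γ β + ((τ : ℂ) * Complex.I) • v ∉ Z)
    (h0 : ∀ t : ℂ, 0 ≤ t.re → γ 0 + t • v ∉ Z) {β : ℝ} (hβ : β ∈ Set.Icc (0 : ℝ) 1) {t : ℂ}
    (ht : 0 ≤ t.re) : γ β + t • v ∉ Z := by
  obtain ⟨R, hR, hb⟩ := hZ.exists_bound hv
  obtain ⟨M, hM⟩ := (isCompact_Icc (a := (0 : ℝ)) (b := 1)).exists_bound_of_continuousOn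
    hγ.continuousOn
  let E : Set (ℝ × ℂ) := (Set.Icc (0 : ℝ) 1 ×ˢ Metric.closedBall (0 : ℂ) (R * M)) ∩
    {q | 0 ≤ q.2.re ∧ γ q.1 + q.2 • v ∈ Z}
  have hE : IsCompact E := by
    refine (isCompact_Icc.prod (isCompact_closedBall _ _)).inter_right ?_
    refine IsClosed.inter ?_ ?_
    · exact isClosed_le continuous_const (Complex.continuous_re.comp continuous_snd)
    · exact hZ.isClosed.preimage (by fun_prop)
  let B : Set ℝ := Prod.fst '' E
  have hBiff : ∀ b, b ∈ B ↔ b ∈ Set.Icc (0 : ℝ) 1 ∧ ∃ t : ℂ, 0 ≤ t.re ∧ γ b + t • v ∈ Z := by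
    intro b
    constructor
    · rintro ⟨⟨b, t⟩, ⟨⟨h1, -⟩, h2, h3⟩, rfl⟩
      exact ⟨h1, t, h2, h3⟩
    · rintro ⟨h1, t, h2, h3⟩
      refine ⟨⟨b, t⟩, ⟨⟨h1, ?_⟩, h2, h3⟩, rfl⟩
      rw [mem_closedBall_zero_iff]
      exact (hb _ _ h3).trans (by gcongr; exact hM b h1)
  have hBc : IsClosed B := (hE.image continuous_fst).isClosed
  -- No root lies on the imaginary axis, so a root in the closed half plane has positive real part
  -- and stays in the half plane under small moves. Thus the parameters with a root form an open and
  -- closed subset of the interval.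
  have hBo : ∀ b ∈ B, ∀ᶠ b' in 𝓝 b, b' ∈ Set.Icc (0 : ℝ) 1 → b' ∈ B := by
    intro b hbB
    obtain ⟨h1, t, h2, h3⟩ := (hBiff b).1 hbB
    have hpos : 0 < t.re := by
      refine lt_of_le_of_ne h2 fun h => him b h1 t.im ?_
      have : t = (t.im : ℂ) * Complex.I := by
        apply Complex.ext <;> simp [← h]
      rwa [← this]
    have h4 := hZ.eventually_exists_add_smul_mem hv h3 hpos
    have h5 : Tendsto (fun b' => γ b' + t • v) (𝓝 b) (𝓝 (γ b + t • v)) :=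
      (hγ.add continuous_const).tendsto b
    filter_upwards [h5.eventually h4] with b' hb' hI
    obtain ⟨s, hs, hmem⟩ := hb'
    refine (hBiff b').2 ⟨hI, t + s, ?_, ?_⟩
    · have := (abs_le.1 ((Complex.abs_re_le_norm s))).1
      rw [Complex.add_re]; linarith
    · rwa [add_smul, ← add_assoc]
  intro hmem
  have hβB : β ∈ B := (hBiff β).2 ⟨hβ, t, ht, hmem⟩
  have hclopen : IsClopen ((↑) ⁻¹' B : Set (Set.Icc (0 : ℝ) 1)) := by
    refine ⟨hBc.preimage continuous_subtype_val, ?_⟩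
    rw [isOpen_iff_mem_nhds]
    intro b hb
    have := (continuous_subtype_val.tendsto b).eventually (hBo b hb)
    filter_upwards [this] with b' hb'
    exact hb' b'.2
  have hconn : PreconnectedSpace (Set.Icc (0 : ℝ) 1) :=
    isPreconnected_iff_preconnectedSpace.1 isPreconnected_Icc
  have huniv := hclopen.eq_univ ⟨⟨β, hβ⟩, hβB⟩
  have h00 : (⟨0, by simp⟩ : Set.Icc (0 : ℝ) 1) ∈ ((↑) ⁻¹' B : Set (Set.Icc (0 : ℝ) 1)) := by
    rw [huniv]; trivial
  obtain ⟨-, t, h2, h3⟩ := (hBiff 0).1 h00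
  exact h0 t h2 h3

end IsConicHypersurface

/-! ### Hyperbolic directions and Gårding's hyperbolicity cone. -/

/-- The real vector `e` is a hyperbolic direction of `Z`: no vector with imaginary part `e` is
in `Z`. -/
def IsHyperbolicDirection {d : ℕ} (Z : Set (Fin (d + 1) → ℂ)) (e : RV d) : Prop :=
  ∀ x : RV d, toComplex x + Complex.I • toComplex e ∉ Z

/-- The expansion of a polynomial at a point, with the lowest order form split off. -/
theorem exists_lowest_order_form {n : ℕ} (p : MvPolynomial (Fin n) ℂ) (hp : p ≠ 0)
    (x : Fin n → ℂ) : ∃ (M : ℕ) (q : Polynomial (MvPolynomial (Fin n) ℂ)), q.eval 0 ≠ 0 ∧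
      ∀ (τ : ℂ) (u : Fin n → ℂ), eval (x + τ • u) p = τ ^ M * eval u (q.eval (C τ)) := by
  let P : Polynomial (MvPolynomial (Fin n) ℂ) :=
    aeval (fun i => Polynomial.C (C (x i)) + Polynomial.X * Polynomial.C (X i)) p
  have hP : ∀ (τ : ℂ) (u : Fin n → ℂ), eval u (P.eval (C τ)) = eval (x + τ • u) p := by
    intro τ u
    have : ((eval u).comp (Polynomial.evalRingHom (C τ))).comp
      (aeval (fun i => Polynomial.C (C (x i)) + Polynomial.X * Polynomial.C (X i)) :
        MvPolynomial (Fin n) ℂ →ₐ[ℂ] Polynomial (MvPolynomial (Fin n) ℂ)).toRingHom =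
        eval (x + τ • u) := by
      apply MvPolynomial.ringHom_ext
      · intro c
        simp [MvPolynomial.algebraMap_eq]
      · intro i; simp; exact mul_comm _ _
    exact congrArg (fun f => f p) this
  have hP0 : P ≠ 0 := by
    intro h0
    refine hp (MvPolynomial.funext fun z => ?_)
    have h1 := hP 1 (z - x)
    rw [h0] at h1
    simpa using h1.symm
  obtain ⟨P', hP', hndvd⟩ := Polynomial.exists_eq_pow_rootMultiplicity_mul_and_not_dvd P hP0 0
  refine ⟨P.rootMultiplicity 0, P', fun h => hndvd (Polynomial.dvd_iff_isRoot.2 h), ?_⟩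
  intro τ u
  rw [← hP]
  conv_lhs => rw [hP']
  simp

theorem continuous_eval_eval_C {n : ℕ} (q : Polynomial (MvPolynomial (Fin n) ℂ)) :
    Continuous fun r : ℂ × (Fin n → ℂ) => eval r.2 (q.eval (C r.1)) := by
  have : (fun r : ℂ × (Fin n → ℂ) => eval r.2 (q.eval (C r.1))) =
      fun r => ∑ i ∈ Finset.range (q.natDegree + 1), eval r.2 (q.coeff i) * r.1 ^ i := by
    funext r
    simp [Polynomial.eval_eq_sum_range, map_sum]
  rw [this]
  refine continuous_finsetSum _ fun i _ => ?_
  exact ((q.coeff i).continuous_eval.comp continuous_snd).mul (continuous_fst.pow i)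

/-- Real points are Zariski dense in complex space. -/
theorem exists_real_eval_ne_zero {d : ℕ} {q : MvPolynomial (Fin (d + 1)) ℂ} (hq : q ≠ 0) :
    ∃ b : RV d, eval (toComplex b) q ≠ 0 := by
  by_contra! hcon
  refine hq (MvPolynomial.funext_set (fun _ => Set.range ((↑) : ℝ → ℂ))
    (fun _ => Set.infinite_range_of_injective Complex.ofReal_injective) fun z hz => ?_)
  choose r hr using fun i => hz i trivial
  have hz' : z = toComplex (WithLp.toLp 2 r : RV d) := by
    ext i
    simp [toComplex, hr]
  rw [map_zero, hz']
  exact hcon _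

namespace IsConicHypersurface

variable {d : ℕ} {Z : Set (Fin (d + 1) → ℂ)} (hZ : IsConicHypersurface Z)
include hZ

theorem add_smul_notMem {e : RV d} (he : IsHyperbolicDirection Z e) (x : RV d) {t : ℂ}
    (ht : t.im ≠ 0) : toComplex x + t • toComplex e ∉ Z := by
  intro h
  have him : (t.im : ℂ) ≠ 0 := by exact_mod_cast ht
  refine he (t.im⁻¹ • (x + t.re • e)) ?_
  have h2 := hZ.smul_mem _ h ((t.im : ℂ)⁻¹)
  convert h2 using 1
  rw [toComplex_smul, toComplex_add, toComplex_smul]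
  have h3 : t • toComplex e = (t.re : ℂ) • toComplex e + ((t.im : ℂ) * Complex.I) • toComplex e := by
    rw [← add_smul, Complex.re_add_im]
  rw [h3, smul_add, smul_add, smul_add, smul_smul _ ((t.im : ℂ) * Complex.I), ← mul_assoc,
    inv_mul_cancel₀ him, one_mul, ← add_assoc]
  push_cast
  rfl

theorem _root_.SliceConvex.IsHyperbolicDirection.notMem {e : RV d}
    (he : IsHyperbolicDirection Z e) : toComplex e ∉ Z := by
  intro h
  exact he 0 (by simpa using hZ.smul_mem _ h Complex.I)

theorem add_mul_I_smul_notMem {e : RV d} (he : IsHyperbolicDirection Z e) (x : RV d) (τ : ℝ)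
    (hx : toComplex x ∉ Z) : toComplex x + ((τ : ℂ) * Complex.I) • toComplex e ∉ Z := by
  by_cases hτ : τ = 0
  · simpa [hτ] using hx
  · exact hZ.add_smul_notMem he x (by simpa using hτ)

/-- The cone condition on a pair of directions passes to combinations with complex coefficients in
a half plane. -/
theorem halfPlane_notMem {e u : RV d} (he : IsHyperbolicDirection Z e)
    (hu : ∀ a b : ℝ, 0 ≤ a → 0 ≤ b → 0 < a + b → toComplex (a • e + b • u) ∉ Z) {a : ℝ} (ha : 0 < a)
    {t : ℂ} (ht : 0 ≤ t.re) : toComplex (a • e) + t • toComplex u ∉ Z := by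
  by_cases him : t.im = 0
  · have h1 := hu a t.re ha.le ht (by linarith)
    rw [toComplex_add, toComplex_smul t.re] at h1
    have : t = (t.re : ℂ) := by apply Complex.ext <;> simp [him]
    rwa [this]
  · intro h
    have ht0 : t ≠ 0 := by rintro rfl; simp at him
    have h2 := hZ.smul_mem _ h t⁻¹
    rw [smul_add, smul_smul t⁻¹ t, inv_mul_cancel₀ ht0, one_smul, toComplex_smul, smul_smul,
      add_comm (_ • toComplex e)] at h2
    refine hZ.add_smul_notMem he u (t := t⁻¹ * a) ?_ h2
    rw [Complex.im_mul_ofReal, Complex.inv_im]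
    refine mul_ne_zero (div_ne_zero (neg_ne_zero.2 him) ?_) ha.ne'
    exact (Complex.normSq_pos.2 ht0).ne'

/-- After multiplication by `-I`, a violation is a root `t = 1` of `-I x + t u`. For `ε > 0`, the
family `ε e - I β x + t u` has no root with `Re t = 0`: multiplied by `I`, such a point has
imaginary part `ε e`. For `β = 0` the segment condition excludes `Re t ≥ 0`, and continuation in `β`
excludes it for `β = 1`. A root `t = 1` at `ε = 0` would persist, with positive real part, for small
`ε > 0`. -/
theorem isHyperbolicDirection_of_segment {e u : RV d} (he : IsHyperbolicDirection Z e)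
    (hu : ∀ a b : ℝ, 0 ≤ a → 0 ≤ b → 0 < a + b → toComplex (a • e + b • u) ∉ Z) :
    IsHyperbolicDirection Z u := by
  have huZ : toComplex u ∉ Z := by simpa using hu 0 1 le_rfl zero_le_one (by norm_num)
  intro x hx
  have key : ∀ ε : ℝ, 0 < ε → ∀ t : ℂ, 0 ≤ t.re →
      toComplex (ε • e) - Complex.I • toComplex x + t • toComplex u ∉ Z := by
    intro ε hε t ht
    have := hZ.halfPlane_continuation
      (γ := fun β => toComplex (ε • e) - ((β : ℂ) * Complex.I) • toComplex x) (by fun_prop) huZ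
      ?_ ?_ (β := 1) (by simp) ht
    · simpa using this
    · intro β _ τ h
      have h1 := hZ.smul_mem _ h (Complex.I)
      refine hZ.add_smul_notMem he (β • x - τ • u) (t := ε * Complex.I) (by simpa using hε.ne') ?_
      convert h1 using 1
      rw [toComplex_sub, toComplex_smul, toComplex_smul, toComplex_smul, smul_add, smul_sub,
        smul_smul, smul_smul, smul_smul]
      have e1 : Complex.I * ((β : ℂ) * Complex.I) = -β := by
        rw [mul_comm, mul_assoc, Complex.I_mul_I]; ring
      have e2 : Complex.I * ((τ : ℂ) * Complex.I) = -τ := by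
        rw [mul_comm, mul_assoc, Complex.I_mul_I]; ring
      rw [e1, e2, neg_smul, neg_smul, mul_comm Complex.I]
      abel
    · intro t ht
      simpa using hZ.halfPlane_notMem he hu hε ht
  have hz : toComplex u - Complex.I • toComplex x ∈ Z := by
    have h1 := hZ.smul_mem _ hx (-Complex.I)
    convert h1 using 1
    rw [smul_add, smul_smul, neg_mul, Complex.I_mul_I, neg_neg, one_smul, neg_smul]
    abel
  have h2 := hZ.eventually_exists_add_smul_mem huZ hz one_pos
  have h3 : Tendsto (fun ε : ℝ => toComplex (ε • e) + (toComplex u - Complex.I • toComplex x))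
      (𝓝[>] 0) (𝓝 (toComplex u - Complex.I • toComplex x)) := by
    have hc : Continuous fun ε : ℝ =>
        toComplex (ε • e) + (toComplex u - Complex.I • toComplex x) :=
      (continuous_toComplex.comp (by fun_prop)).add continuous_const
    have := hc.tendsto 0
    simp only [zero_smul, toComplex_zero, zero_add] at this
    exact this.mono_left nhdsWithin_le_nhds
  obtain ⟨ε, ⟨s, hs, hmem⟩, hε⟩ := ((h3.eventually h2).and self_mem_nhdsWithin).exists
  refine key ε hε (1 + s) ?_ ?_
  · have := (abs_le.1 (Complex.abs_re_le_norm s)).1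
    rw [Complex.add_re, Complex.one_re]; linarith
  · convert hmem using 1
    rw [add_smul, one_smul]
    abel

/-- Gårding's convexity theorem. -/
theorem add_notMem_of_segments {e u u' : RV d} (he : IsHyperbolicDirection Z e)
    (hu : ∀ a b : ℝ, 0 ≤ a → 0 ≤ b → 0 < a + b → toComplex (a • e + b • u) ∉ Z)
    (hu' : ∀ a b : ℝ, 0 ≤ a → 0 ≤ b → 0 < a + b → toComplex (a • e + b • u') ∉ Z)
    {a b c : ℝ} (ha : 0 ≤ a) (hb : 0 ≤ b) (hc : 0 ≤ c) (h : 0 < a + b + c) :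
    toComplex (a • e + b • u + c • u') ∉ Z := by
  by_cases hab : a + b = 0
  · have ha0 : a = 0 := by linarith
    have hb0 : b = 0 := by linarith
    simpa [ha0, hb0] using hu' 0 c le_rfl hc (by linarith)
  have hab' : 0 < a + b := lt_of_le_of_ne (by positivity) (Ne.symm hab)
  have hyp' := hZ.isHyperbolicDirection_of_segment he hu'
  -- The base point moves from `e` to `u` while `u'` is the direction. Since `u'` is hyperbolic and
  -- the segment from `e` to `u` misses `Z`, no root crosses the imaginary axis. Normalizing by `a +
  -- b` turns the given combination into a point of this family with `t ≥ 0`.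
  have hcont := hZ.halfPlane_continuation (v := toComplex u')
    (γ := fun β : ℝ => toComplex ((1 - β) • e + β • u)) (continuous_toComplex.comp (by fun_prop))
    (hyp'.notMem hZ) ?_ ?_ (β := b / (a + b))
    ⟨by positivity, (div_le_one hab').2 (by linarith)⟩ (t := ((c / (a + b) : ℝ) : ℂ))
    (by rw [Complex.ofReal_re]; positivity)
  · intro hmem
    apply hcont
    have h1 := hZ.smul_mem _ hmem ((a + b : ℝ) : ℂ)⁻¹
    convert h1 using 1
    rw [← toComplex_smul, ← toComplex_add, ← Complex.ofReal_inv, ← toComplex_smul]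
    congr 1
    rw [smul_add, smul_add, smul_smul, smul_smul, smul_smul]
    congr 2
    · congr 1
      field_simp
      ring
    · congr 1
      field_simp
    · field_simp
  · intro β hβ τ
    exact hZ.add_mul_I_smul_notMem hyp' _ τ (hu _ _ (by linarith [hβ.2]) hβ.1 (by linarith))
  · intro t ht
    have := hZ.halfPlane_notMem he hu' one_pos ht
    simpa using this

/-- The hyperbolicity cone of `Z` in the direction `e`. -/
def hyperbolicityCone {e : RV d} (he : IsHyperbolicDirection Z e) : ConvexCone ℝ (RV d) where
  carrier := {u | ∀ a b : ℝ, 0 ≤ a → 0 ≤ b → 0 < a + b → toComplex (a • e + b • u) ∉ Z}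
  smul_mem' := by
    intro c hc u hu a b ha hb hab
    rw [smul_smul]
    refine hu a (b * c) ha (by positivity) ?_
    rcases ha.lt_or_eq with h | h
    · positivity
    · have : 0 < b := by linarith
      positivity
  add_mem' := by
    intro u hu u' hu' a b ha hb hab
    rw [smul_add, ← add_assoc]
    exact hZ.add_notMem_of_segments he hu hu' ha hb hb (by linarith)

theorem mem_hyperbolicityCone {e : RV d} (he : IsHyperbolicDirection Z e) {u : RV d} :
    u ∈ hZ.hyperbolicityCone he ↔
      ∀ a b : ℝ, 0 ≤ a → 0 ≤ b → 0 < a + b → toComplex (a • e + b • u) ∉ Z := Iff.rfl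

/-- The normalized points of the segment from `e` to `u` stay in a ball around `e` that misses `Z`.
-/
theorem exists_ball_segment_notMem {e : RV d} (he : toComplex e ∉ Z) :
    ∃ r > 0, ∀ u : RV d, ‖u - e‖ < r →
      ∀ a b : ℝ, 0 ≤ a → 0 ≤ b → 0 < a + b → toComplex (a • e + b • u) ∉ Z := by
  have ho : IsOpen (toComplex ⁻¹' Zᶜ : Set (RV d)) :=
    hZ.isClosed.isOpen_compl.preimage continuous_toComplex
  obtain ⟨r, hr, hball⟩ := Metric.isOpen_iff.1 ho e he
  refine ⟨r, hr, fun u hu a b ha hb hab hmem => ?_⟩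
  refine hball (a := e + (b / (a + b)) • (u - e)) ?_ ?_
  · rw [Metric.mem_ball, dist_eq_norm, add_sub_cancel_left, norm_smul, Real.norm_of_nonneg
      (by positivity)]
    have : b / (a + b) ≤ 1 := (div_le_one hab).2 (by linarith)
    nlinarith [norm_nonneg (u - e)]
  · have h1 := hZ.smul_mem _ hmem (((a + b)⁻¹ : ℝ) : ℂ)
    rw [← toComplex_smul] at h1
    convert h1 using 2
    rw [smul_add, smul_smul, smul_smul, smul_sub]
    have : (a + b)⁻¹ * a = 1 - b / (a + b) := by field_simp; ring
    rw [this, sub_smul, one_smul, div_eq_inv_mul]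
    abel

theorem exists_ball_isHyperbolicDirection {e : RV d} (he : IsHyperbolicDirection Z e) :
    ∃ r > 0, ∀ u : RV d, ‖u - e‖ < r → IsHyperbolicDirection Z u := by
  obtain ⟨r, hr, h⟩ := hZ.exists_ball_segment_notMem (he.notMem hZ)
  exact ⟨r, hr, fun u hu => hZ.isHyperbolicDirection_of_segment he (h u hu)⟩

/-- Near a real point of `Z`, a small double cone around a hyperbolic direction meets `Z` in the
apex only. -/
theorem exists_doubleCone_notMem {e : RV d} (he : IsHyperbolicDirection Z e) (x : RV d) :
    ∃ δ > 0, ∀ u : RV d, ‖u - e‖ < δ → ∀ τ : ℝ, τ ≠ 0 → |τ| < δ → toComplex (x + τ • u) ∉ Z := by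
  obtain ⟨p, hp⟩ := hZ.exists_polynomial
  have hp0 : p ≠ 0 := by
    rintro rfl
    exact he.notMem hZ ((hp _).2 (map_zero _))
  obtain ⟨M, q, hq0, hfac⟩ := exists_lowest_order_form p hp0 (toComplex x)
  obtain ⟨b, hb⟩ := exists_real_eval_ne_zero hq0
  obtain ⟨r, hr, hball⟩ := hZ.exists_ball_isHyperbolicDirection he
  -- The lowest order form at `x` does not vanish at `e`. Otherwise, for small `τ > 0`, a zero
  -- persists at `x + I τ (e + s (b - e))` with `s` small. Its imaginary part is `τ (e + Re s (b -
  -- e))`, a positive multiple of a direction near `e`, hence hyperbolic.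
  have hqe : eval (toComplex e) (q.eval 0) ≠ 0 := by
    intro hG0
    have hη : 0 < r / (‖b - e‖ + 1) := by positivity
    have hev := eventually_exists_zero
      (fun (τ : ℝ) (s : ℂ) =>
        eval (toComplex e + s • toComplex (b - e)) (q.eval (C (Complex.I * τ))))
      ((continuous_eval_eval_C q).comp (f := fun r : ℝ × ℂ => ((Complex.I * (r.1 : ℂ) : ℂ),
        toComplex e + r.2 • toComplex (b - e))) (by fun_prop))
      (fun τ => by
        simp only [← eval_restrictLine]
        exact Polynomial.differentiable _) 0 (by simpa using hG0)
      ⟨1, by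
        rw [one_smul, toComplex_sub, add_sub_cancel]
        simpa using hb⟩ hη
    obtain ⟨τ, ⟨s, hs, h0⟩, hτ⟩ :=
      ((hev.filter_mono nhdsWithin_le_nhds).and (self_mem_nhdsWithin (s := Set.Ioi (0 : ℝ)))).exists
    have hmem : toComplex x + (Complex.I * τ) • (toComplex e + s • toComplex (b - e)) ∈ Z := by
      rw [hp, hfac, h0, mul_zero]
    have hyp : IsHyperbolicDirection Z (e + s.re • (b - e)) := by
      refine hball _ ?_
      rw [add_sub_cancel_left, norm_smul, Real.norm_eq_abs]
      have h1 := (Complex.abs_re_le_norm s).trans hs.le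
      calc |s.re| * ‖b - e‖ ≤ r / (‖b - e‖ + 1) * ‖b - e‖ := by gcongr
        _ < r / (‖b - e‖ + 1) * (‖b - e‖ + 1) := by gcongr; linarith
        _ = r := by field_simp
    refine hZ.add_smul_notMem hyp (x - (τ * s.im) • (b - e)) (t := Complex.I * τ)
      (by simpa using (Set.mem_Ioi.1 hτ).ne') ?_
    convert hmem using 1
    rw [toComplex_sub, toComplex_add, toComplex_smul, toComplex_smul]
    have hs' : s • toComplex (b - e) = (s.re : ℂ) • toComplex (b - e) +
        ((s.im : ℂ) * Complex.I) • toComplex (b - e) := by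
      rw [← add_smul, Complex.re_add_im]
    have e1 : (Complex.I * (τ : ℂ)) • ((s.im : ℂ) * Complex.I) • toComplex (b - e) =
        -(((τ * s.im : ℝ) : ℂ) • toComplex (b - e)) := by
      rw [smul_smul, ← neg_smul]
      congr 1
      push_cast
      linear_combination (τ : ℂ) * s.im * Complex.I_mul_I
    rw [hs', smul_add, smul_add, smul_add, e1]
    abel
  have hne : ∀ᶠ r in 𝓝 ((0 : ℝ), e), eval (toComplex r.2) (q.eval (C (r.1 : ℂ))) ≠ 0 := by
    have hf : Continuous fun r : ℝ × RV d => ((r.1 : ℂ), toComplex r.2) :=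
      (Complex.continuous_ofReal.comp continuous_fst).prodMk
        (continuous_toComplex.comp continuous_snd)
    have hc := (continuous_eval_eval_C q).comp hf
    exact hc.continuousAt.eventually_ne (by simpa using hqe)
  obtain ⟨δ, hδ, hδ'⟩ := Metric.eventually_nhds_iff.1 hne
  refine ⟨δ, hδ, fun u hu τ hτ hτδ hmem => ?_⟩
  have h1 := hδ' (y := (τ, u)) (by
    rw [Prod.dist_eq, max_lt_iff, dist_eq_norm, dist_eq_norm]
    exact ⟨by simpa using hτδ, hu⟩)
  rw [toComplex_add, toComplex_smul, hp, hfac] at hmem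
  exact mul_ne_zero (pow_ne_zero _ (by exact_mod_cast hτ)) h1 hmem

end IsConicHypersurface

/-! ### Complexification of real subspaces. -/

section complexify
variable {d : ℕ}

theorem mem_complexify_iff {V : Submodule ℝ (RV d)} {z : Fin (d + 1) → ℂ} :
    z ∈ complexify V ↔ ∃ a ∈ V, ∃ b ∈ V, z = toComplex a + Complex.I • toComplex b := by
  constructor
  · intro h
    induction h using Submodule.span_induction with
    | mem z hz =>
      obtain ⟨a, ha, rfl⟩ := hz
      exact ⟨a, ha, 0, V.zero_mem, by simp⟩
    | zero => exact ⟨0, V.zero_mem, 0, V.zero_mem, by simp⟩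
    | add z w _ _ hz hw =>
      obtain ⟨a, ha, b, hb, rfl⟩ := hz
      obtain ⟨a', ha', b', hb', rfl⟩ := hw
      refine ⟨a + a', V.add_mem ha ha', b + b', V.add_mem hb hb', ?_⟩
      rw [toComplex_add, toComplex_add, smul_add]
      abel
    | smul c z _ hz =>
      obtain ⟨a, ha, b, hb, rfl⟩ := hz
      refine ⟨c.re • a - c.im • b, V.sub_mem (V.smul_mem _ ha) (V.smul_mem _ hb),
        c.re • b + c.im • a, V.add_mem (V.smul_mem _ hb) (V.smul_mem _ ha), ?_⟩
      simp only [toComplex_sub, toComplex_add, toComplex_smul]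
      conv_lhs => rw [← Complex.re_add_im c]
      ext i
      simp only [Pi.smul_apply, Pi.add_apply, Pi.sub_apply, smul_eq_mul]
      linear_combination (c.im : ℂ) * toComplex b i * Complex.I_mul_I
  · rintro ⟨a, ha, b, hb, rfl⟩
    exact Submodule.add_mem _ (Submodule.subset_span ⟨a, ha, rfl⟩)
      (Submodule.smul_mem _ _ (Submodule.subset_span ⟨b, hb, rfl⟩))

theorem re_add_im_mem_complexify {V : Submodule ℝ (RV d)} {a b : RV d} :
    toComplex a + Complex.I • toComplex b ∈ complexify V ↔ a ∈ V ∧ b ∈ V := by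
  rw [mem_complexify_iff]
  constructor
  · rintro ⟨a', ha', b', hb', h⟩
    obtain ⟨rfl, rfl⟩ := re_add_im_injective h
    exact ⟨ha', hb'⟩
  · rintro ⟨ha, hb⟩
    exact ⟨a, ha, b, hb, rfl⟩

theorem toComplex_mem_complexify {V : Submodule ℝ (RV d)} {a : RV d} :
    toComplex a ∈ complexify V ↔ a ∈ V := by
  have := re_add_im_mem_complexify (V := V) (a := a) (b := 0)
  simpa using this

theorem complexify_mono {V W : Submodule ℝ (RV d)} (h : V ≤ W) : complexify V ≤ complexify W :=
  Submodule.span_mono (Set.image_mono h)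

theorem complexify_sup_span (V : Submodule ℝ (RV d)) (e : RV d) :
    complexify (V ⊔ Submodule.span ℝ {e}) = complexify V ⊔ Submodule.span ℂ {toComplex e} := by
  apply le_antisymm
  · refine Submodule.span_le.2 ?_
    rintro _ ⟨x, hx, rfl⟩
    obtain ⟨a, ha, b, hb, rfl⟩ := Submodule.mem_sup.1 hx
    obtain ⟨c, rfl⟩ := Submodule.mem_span_singleton.1 hb
    rw [toComplex_add, toComplex_smul]
    exact Submodule.add_mem_sup (toComplex_mem_complexify.2 ha)
      (Submodule.smul_mem _ _ (Submodule.mem_span_singleton_self _))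
  · refine sup_le (complexify_mono le_sup_left) ?_
    rw [Submodule.span_singleton_le_iff_mem, toComplex_mem_complexify]
    exact Submodule.mem_sup_right (Submodule.mem_span_singleton_self _)

theorem mem_complexify_sup_span {V : Submodule ℝ (RV d)} {e : RV d} {z : Fin (d + 1) → ℂ} :
    z ∈ complexify (V ⊔ Submodule.span ℝ {e}) ↔
      ∃ w ∈ complexify V, ∃ c : ℂ, z = w + c • toComplex e := by
  rw [complexify_sup_span, Submodule.mem_sup]
  constructor
  · rintro ⟨w, hw, y, hy, rfl⟩
    obtain ⟨c, rfl⟩ := Submodule.mem_span_singleton.1 hy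
    exact ⟨w, hw, c, rfl⟩
  · rintro ⟨w, hw, c, rfl⟩
    exact ⟨w, hw, _, Submodule.smul_mem _ _ (Submodule.mem_span_singleton_self _), rfl⟩

theorem linearIndependent_toComplex {α : Type*} [Fintype α] {w : α → RV d}
    (hw : LinearIndependent ℝ w) : LinearIndependent ℂ (fun i => toComplex (w i)) := by
  rw [Fintype.linearIndependent_iff] at hw ⊢
  intro c hc
  have h : toComplex (∑ i, (c i).re • w i) + Complex.I • toComplex (∑ i, (c i).im • w i) =
      toComplex 0 + Complex.I • toComplex 0 := by
    rw [toComplex_zero, smul_zero, add_zero, ← hc, toComplex_sum, toComplex_sum, Finset.smul_sum,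
      ← Finset.sum_add_distrib]
    refine Finset.sum_congr rfl fun i _ => ?_
    rw [toComplex_smul, toComplex_smul, smul_smul, ← add_smul, mul_comm Complex.I,
      Complex.re_add_im]
  obtain ⟨h1, h2⟩ := re_add_im_injective h
  intro i
  exact Complex.ext (hw _ h1 i) (hw _ h2 i)

theorem complexify_span_range {α : Type*} (w : α → RV d) :
    complexify (Submodule.span ℝ (Set.range w)) =
      Submodule.span ℂ (Set.range fun i => toComplex (w i)) := by
  apply le_antisymm
  · refine Submodule.span_le.2 ?_
    rintro _ ⟨x, hx, rfl⟩
    induction hx using Submodule.span_induction with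
    | mem x hx =>
      obtain ⟨i, rfl⟩ := hx
      exact Submodule.subset_span ⟨i, rfl⟩
    | zero => simp
    | add x y _ _ hx hy => rw [toComplex_add]; exact Submodule.add_mem _ hx hy
    | smul r x _ hx => rw [toComplex_smul]; exact Submodule.smul_mem _ _ hx
  · refine Submodule.span_le.2 ?_
    rintro _ ⟨i, rfl⟩
    exact toComplex_mem_complexify.2 (Submodule.subset_span ⟨i, rfl⟩)

theorem finrank_complexify (V : Submodule ℝ (RV d)) :
    Module.finrank ℂ (complexify V) = Module.finrank ℝ V := by
  let b := Module.finBasis ℝ V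
  have h1 : LinearIndependent ℝ fun i => (b i : RV d) :=
    b.linearIndependent.map' V.subtype V.ker_subtype
  have h2 : Submodule.span ℝ (Set.range fun i => (b i : RV d)) = V := by
    have : (Set.range fun i => (b i : RV d)) = V.subtype '' Set.range b := by
      rw [← Set.range_comp]; rfl
    rw [this, Submodule.span_image, b.span_eq, Submodule.map_top, Submodule.range_subtype]
  conv_lhs => rw [← h2, complexify_span_range]
  rw [finrank_span_eq_card (linearIndependent_toComplex h1), Fintype.card_fin]

end complexify

/-! ### Hyperbolic cones and their projections along members of a pencil. -/

section hyperbolicity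
variable {d : ℕ}

/-- The sum of a set and the complexification of a real subspace. -/
def coneAlong (S : Set (Fin (d + 1) → ℂ)) (W₀ : Submodule ℝ (RV d)) : Set (Fin (d + 1) → ℂ) :=
  {z | ∃ w ∈ complexify W₀, z + w ∈ S}

/-- The real subspace `W` meets the cone `S` in the apex only. -/
def Avoids (S : Set (Fin (d + 1) → ℂ)) (W : Submodule ℝ (RV d)) : Prop :=
  ∀ z ∈ S, z ∈ complexify W → z = 0

/-- Hyperbolicity of a cone: the fibres of the projection along `W` over nonzero real points are
real. -/
structure IsHyperbolicCone (S : Set (Fin (d + 1) → ℂ)) (W : Submodule ℝ (RV d)) : Prop where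
  avoids : Avoids S W
  real : ∀ u ∉ W, ∀ z ∈ S, z - toComplex u ∈ complexify W → ∃ r, z = toComplex r

/-- A closed complex cone all whose images under projections along real subspaces of dimension
`ℓ - 1` contained in a real subspace of dimension `ℓ` avoiding it are hypersurfaces. -/
structure IsProjectableCone (ℓ : ℕ) (S : Set (Fin (d + 1) → ℂ)) : Prop where
  zero_mem : (0 : Fin (d + 1) → ℂ) ∈ S
  smul_mem : ∀ z ∈ S, ∀ c : ℂ, c • z ∈ S
  isClosed : IsClosed S
  isConicHypersurface : ∀ (W₀ : Submodule ℝ (RV d)) (v : RV d), v ∉ W₀ →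
    Module.finrank ℝ W₀ + 1 = ℓ → Avoids S (W₀ ⊔ Submodule.span ℝ {v}) →
      IsConicHypersurface (coneAlong S W₀)

theorem Avoids.mono {S : Set (Fin (d + 1) → ℂ)} {V W : Submodule ℝ (RV d)} (h : Avoids S W)
    (hVW : V ≤ W) : Avoids S V := fun z hz hzV => h z hz (complexify_mono hVW hzV)

variable {ℓ : ℕ} {S : Set (Fin (d + 1) → ℂ)} (hS : IsProjectableCone ℓ S)
include hS

/-- The dictionary between a hypersurface and a pencil: a point `w + c u` of `S` with `w` in the
complexification of `W₀` and `c ≠ 0` can be rescaled to `c = 1`. -/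
theorem IsProjectableCone.notMem_coneAlong_iff {W₀ : Submodule ℝ (RV d)} (h0 : Avoids S W₀)
    {u : RV d} : toComplex u ∉ coneAlong S W₀ ↔
      u ∉ W₀ ∧ Avoids S (W₀ ⊔ Submodule.span ℝ {u}) := by
  constructor
  · intro h
    refine ⟨fun hu => h ⟨-toComplex u, Submodule.neg_mem _ (toComplex_mem_complexify.2 hu),
      by simpa using hS.zero_mem⟩, fun z hz hzW => ?_⟩
    obtain ⟨w, hw, c, rfl⟩ := mem_complexify_sup_span.1 hzW
    by_cases hc : c = 0
    · subst hc
      exact h0 _ hz (by simpa using hw)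
    · refine absurd ⟨c⁻¹ • w, Submodule.smul_mem _ _ hw, ?_⟩ h
      have := hS.smul_mem _ hz c⁻¹
      rwa [smul_add, smul_smul, inv_mul_cancel₀ hc, one_smul, add_comm (c⁻¹ • w)] at this
  · rintro ⟨hu, hav⟩ ⟨w, hw, hmem⟩
    have h1 := hav _ hmem (by
      rw [add_comm (toComplex u)]
      exact mem_complexify_sup_span.2 ⟨w, hw, 1, by rw [one_smul]⟩)
    rw [add_eq_zero_iff_eq_neg] at h1
    exact hu (toComplex_mem_complexify.1 (h1 ▸ Submodule.neg_mem _ hw))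

-- A point of `S` equal to `x + I e` modulo the complexification of `W₀` has imaginary part in `e +
-- W₀`, which does not contain `0`. It is therefore a nonreal point over the real point `x`, or,
-- when `x` lies in the subspace itself, a nonzero point of `S` on it.
omit hS in
theorem IsHyperbolicCone.isHyperbolicDirection {W₀ : Submodule ℝ (RV d)} {e : RV d}
    (h : IsHyperbolicCone S (W₀ ⊔ Submodule.span ℝ {e})) (he : e ∉ W₀) :
    IsHyperbolicDirection (coneAlong S W₀) e := by
  rintro x ⟨w, hw, hmem⟩
  obtain ⟨a, ha, b, hb, rfl⟩ := mem_complexify_iff.1 hw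
  have hz : toComplex x + Complex.I • toComplex e + (toComplex a + Complex.I • toComplex b) =
      toComplex (x + a) + Complex.I • toComplex (e + b) := by
    rw [toComplex_add, toComplex_add, smul_add]; abel
  rw [hz] at hmem
  have heb : e + b ≠ 0 := fun h0 => he (by
    rw [add_eq_zero_iff_eq_neg] at h0
    rw [h0]; exact W₀.neg_mem hb)
  have hebW : e + b ∈ W₀ ⊔ Submodule.span ℝ {e} := Submodule.add_mem _
    (Submodule.mem_sup_right (Submodule.mem_span_singleton_self _)) (Submodule.mem_sup_left hb)
  have haW : a ∈ W₀ ⊔ Submodule.span ℝ {e} := Submodule.mem_sup_left ha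
  by_cases hx : x ∈ W₀ ⊔ Submodule.span ℝ {e}
  · have h1 := h.avoids _ hmem (re_add_im_mem_complexify.2 ⟨Submodule.add_mem _ hx haW, hebW⟩)
    have h2 : toComplex (x + a) + Complex.I • toComplex (e + b) =
      toComplex 0 + Complex.I • toComplex 0 := by simpa using h1
    exact heb (re_add_im_injective h2).2
  · obtain ⟨r, hr⟩ := h.real x hx _ hmem (by
      have : toComplex (x + a) + Complex.I • toComplex (e + b) - toComplex x =
        toComplex a + Complex.I • toComplex (e + b) := by rw [toComplex_add]; abel
      rw [this]
      exact re_add_im_mem_complexify.2 ⟨haW, hebW⟩)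
    have h2 : toComplex (x + a) + Complex.I • toComplex (e + b) =
      toComplex r + Complex.I • toComplex 0 := by simpa using hr
    exact heb (re_add_im_injective h2).2

/-- Hyperbolicity propagates along segments in a pencil. -/
theorem IsProjectableCone.isHyperbolicCone_of_segment {W₀ : Submodule ℝ (RV d)} {e u : RV d}
    (hfin : Module.finrank ℝ W₀ + 1 = ℓ)
    (h : IsHyperbolicCone S (W₀ ⊔ Submodule.span ℝ {e})) (he : e ∉ W₀)
    (hu : ∀ a b : ℝ, 0 ≤ a → 0 ≤ b → 0 < a + b → toComplex (a • e + b • u) ∉ coneAlong S W₀) :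
    IsHyperbolicCone S (W₀ ⊔ Submodule.span ℝ {u}) := by
  have hZ := hS.isConicHypersurface W₀ e he hfin h.avoids
  have h0 : Avoids S W₀ := h.avoids.mono le_sup_left
  have huH := hZ.isHyperbolicDirection_of_segment (h.isHyperbolicDirection he) hu
  refine ⟨((hS.notMem_coneAlong_iff h0).1 (huH.notMem hZ)).2, fun x hx z hz hzx => ?_⟩
  obtain ⟨w, hw, c, hc⟩ := mem_complexify_sup_span.1 hzx
  rw [sub_eq_iff_eq_add] at hc
  have hzc : toComplex x + c • toComplex u ∈ coneAlong S W₀ :=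
    ⟨w, hw, by convert hz using 1; rw [hc]; abel⟩
  have hcim : c.im = 0 := by
    by_contra him
    exact hZ.add_smul_notMem huH x him hzc
  have hcre : c = (c.re : ℂ) := by apply Complex.ext <;> simp [hcim]
  have hzx' : z - toComplex (x + c.re • u) = w := by
    rw [hc, toComplex_add, toComplex_smul, ← hcre]; abel
  -- Realness of the fibre is known only over points outside `W₀ + ℝe`. Over a point inside,
  -- avoidance forces `z = 0`, which would put `x` in `W₀ + ℝu`.
  by_cases hx' : x + c.re • u ∈ W₀ ⊔ Submodule.span ℝ {e}
  · exfalso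
    have hz0 := h.avoids z hz (by
      have : z = w + toComplex (x + c.re • u) := by rw [← hzx']; abel
      rw [this]
      exact Submodule.add_mem _ (complexify_mono le_sup_left hw) (toComplex_mem_complexify.2 hx'))
    rw [hz0, zero_sub, ← toComplex_neg] at hzx'
    rw [← hzx', toComplex_mem_complexify, Submodule.neg_mem_iff] at hw
    refine hx ?_
    have : x = (x + c.re • u) + (-c.re) • u := by rw [neg_smul]; abel
    rw [this]
    exact Submodule.add_mem_sup hw (Submodule.smul_mem _ _ (Submodule.mem_span_singleton_self _))
  · exact h.real _ hx' z hz (by rw [hzx']; exact complexify_mono le_sup_left hw)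

end hyperbolicity

/-! ### From projective varieties to affine cones. -/

section affineCone
variable {d : ℕ} {X : Set (CP d)}

theorem zero_mem_affineCone : (0 : Fin (d + 1) → ℂ) ∈ affineCone X := fun h => absurd rfl h

theorem mem_affineCone_iff {z : Fin (d + 1) → ℂ} (hz : z ≠ 0) :
    z ∈ affineCone X ↔ Projectivization.mk ℂ z hz ∈ X := ⟨fun h => h hz, fun h _ => h⟩

theorem smul_mem_affineCone {z : Fin (d + 1) → ℂ} (hz : z ∈ affineCone X) (c : ℂ) :
    c • z ∈ affineCone X := by
  intro hcz
  have hz0 : z ≠ 0 := by rintro rfl; simp at hcz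
  have hc : c ≠ 0 := by rintro rfl; simp at hcz
  have : Projectivization.mk ℂ (c • z) hcz = Projectivization.mk ℂ z hz0 := by
    rw [Projectivization.mk_eq_mk_iff']
    exact ⟨c, rfl⟩
  rw [this]
  exact hz hz0

/-- The cone over the empty set is the apex, whose coordinate ring is a field, of dimension `0 ≠ k +
1`. -/
theorem nonempty_of_hasPureDim {k : ℕ} (hX : HasPureDim X k) : X.Nonempty := by
  by_contra hne
  have hcone : affineCone X = {0} := by
    ext z
    refine ⟨fun h => ?_, fun h => ?_⟩
    · by_contra hz
      exact hne ⟨_, h hz⟩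
    · rw [Set.mem_singleton_iff.1 h]
      exact zero_mem_affineCone
  have hmax : (homIdeal X).IsMaximal := by
    rw [homIdeal, hcone]
    infer_instance
  have h1 := hX (homIdeal X) (by
    rw [Ideal.minimalPrimes_eq_subsingleton_self]
    rfl)
  let _ := Ideal.Quotient.field (homIdeal X)
  rw [ringKrullDim_eq_zero_of_field] at h1
  have h2 : ((0 : ℕ) : WithBot ℕ∞) = ((k + 1 : ℕ) : WithBot ℕ∞) := by exact_mod_cast h1
  have h3 : (0 : ℕ) = k + 1 := by exact_mod_cast h2
  omega

/-- The real equations of `X` belong to its homogeneous ideal. Nonemptiness is needed at the apex: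
it excludes a nonzero constant among the equations. -/
theorem zeroLocus_homIdeal_subset (hX : IsRealSubvariety X) (hne : X.Nonempty) :
    zeroLocus ℂ (homIdeal X) ⊆ affineCone X := by
  obtain ⟨T, hT, rfl⟩ := hX
  intro z hz hz0 p hp w hw
  obtain ⟨m, hm⟩ := hT p hp
  rw [Projectivization.submodule_mk, Submodule.mem_span_singleton] at hw
  obtain ⟨c, rfl⟩ := hw
  rw [aeval_smul_of_isHomogeneous hm]
  have hmap : map (algebraMap ℝ ℂ) p ∈ homIdeal {x : CP d | ∀ p ∈ T, ∀ z ∈ x.submodule,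
      aeval z p = 0} := by
    intro u hu
    rw [aeval_map_algebraMap]
    by_cases hu0 : u = 0
    · obtain ⟨x, hx⟩ := hne
      have h1 := hx p hp 0 (Submodule.zero_mem _)
      rwa [hu0]
    · exact hu hu0 p hp u (by
        rw [Projectivization.submodule_mk]; exact Submodule.mem_span_singleton_self u)
  have := hz _ hmap
  rw [aeval_map_algebraMap] at this
  rw [this, mul_zero]

/-- The dimensions match: `W₀ + ℝv` has dimension `ℓ`, the components of the cone have dimension `k
+ 1`, and these add up to `d + 1`. -/
theorem isProjectableCone_affineCone {k ℓ : ℕ} (hd : k + ℓ = d) (hX : IsRealSubvariety X)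
    (hdim : HasPureDim X k) : IsProjectableCone ℓ (affineCone X) := by
  have hcl := zeroLocus_homIdeal_subset hX (nonempty_of_hasPureDim hdim)
  refine ⟨zero_mem_affineCone, fun z hz c => smul_mem_affineCone hz c, ?_, ?_⟩
  · have : affineCone X = ⋂ p ∈ homIdeal X, (fun z => aeval z p) ⁻¹' {(0 : ℂ)} := by
      ext z
      simp only [Set.mem_iInter, Set.mem_preimage, Set.mem_singleton_iff]
      exact ⟨fun h p hp => hp z h, fun h => hcl h⟩
    rw [this]
    exact isClosed_biInter fun p _ => isClosed_singleton.preimage p.continuous_eval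
  · intro W₀ v hv hfin hav
    have hv' : toComplex v ∉ complexify W₀ := fun h => hv (toComplex_mem_complexify.1 h)
    rw [Avoids, complexify_sup_span] at hav
    have hfin' : Module.finrank ℂ (complexify W₀ ⊔ Submodule.span ℂ {toComplex v} :
        Submodule ℂ (Fin (d + 1) → ℂ)) + (k + 1) = d + 1 := by
      rw [← complexify_sup_span, finrank_complexify, Submodule.finrank_sup_span_singleton hv]
      omega
    obtain ⟨p, hp⟩ := exists_polynomial_cone_add (affineCone X)
      (fun z hz c => smul_mem_affineCone hz c) hcl hdim (complexify W₀) (toComplex v) hv' hfin' hav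
    refine ⟨?_, p, fun z => (hp z).symm⟩
    rintro z ⟨w, hw, hzw⟩ c
    exact ⟨c • w, Submodule.smul_mem _ _ hw, by
      rw [← smul_add]; exact smul_mem_affineCone hzw c⟩

theorem inter_pointsOn_eq_empty_iff {V : Submodule ℝ (RV d)} :
    X ∩ pointsOn V = ∅ ↔ Avoids (affineCone X) V := by
  constructor
  · intro h z hz hzV
    by_contra hz0
    have : Projectivization.mk ℂ z hz0 ∈ X ∩ pointsOn V := by
      refine ⟨hz hz0, ?_⟩
      change (Projectivization.mk ℂ z hz0).submodule ≤ _
      rw [Projectivization.submodule_mk, Submodule.span_singleton_le_iff_mem]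
      exact hzV
    rw [h] at this
    exact this
  · intro h
    rw [Set.eq_empty_iff_forall_notMem]
    rintro x ⟨hx, hxV⟩
    refine x.rep_nonzero (h x.rep ?_ ?_)
    · rw [mem_affineCone_iff x.rep_nonzero, x.mk_rep]; exact hx
    · refine hxV ?_
      rw [Projectivization.submodule_eq]
      exact Submodule.mem_span_singleton_self _

/-- A point of `X` on `V + ℝu` has a nonzero `u`-coordinate and can be scaled to make it `1`. If a
multiple `c z` of such a representative is real, its `u`-coordinate `c` is real modulo `V`, so `z`
itself is real. -/
theorem isHyperbolic_iff {ℓ : ℕ} (V : RealGr ℓ d) :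
    IsHyperbolic X V ↔ IsHyperbolicCone (affineCone X) V.space := by
  constructor
  · rintro ⟨h1, h2⟩
    refine ⟨inter_pointsOn_eq_empty_iff.1 h1, fun u hu z hz hzu => ?_⟩
    have hz0 : z ≠ 0 := by
      rintro rfl
      rw [zero_sub, Submodule.neg_mem_iff, toComplex_mem_complexify] at hzu
      exact hu hzu
    have hr : Projectivization.mk ℂ z hz0 ∈ realPoints d := by
      refine h2 ⟨V.space ⊔ Submodule.span ℝ {u}, by
        rw [Submodule.finrank_sup_span_singleton hu]; exact congrArg (· + 1) V.2⟩ le_sup_left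
        ⟨hz hz0, ?_⟩
      change (Projectivization.mk ℂ z hz0).submodule ≤ complexify (V.space ⊔ Submodule.span ℝ {u})
      rw [Projectivization.submodule_mk, Submodule.span_singleton_le_iff_mem]
      exact mem_complexify_sup_span.2 ⟨_, hzu, 1, by rw [one_smul, sub_add_cancel]⟩
    obtain ⟨r, hr0, hr⟩ := hr
    rw [Projectivization.submodule_mk, Submodule.mem_span_singleton] at hr
    obtain ⟨c, hc⟩ := hr
    have hc0 : c ≠ 0 := by
      rintro rfl
      rw [zero_smul, ← toComplex_zero] at hc
      exact hr0 (toComplex_injective hc.symm)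
    have hmem := Submodule.smul_mem _ c hzu
    have h3 : c • (z - toComplex u) =
        toComplex (r - c.re • u) + Complex.I • toComplex (-(c.im • u)) := by
      rw [smul_sub, hc, toComplex_sub, toComplex_neg, toComplex_smul, toComplex_smul]
      conv_lhs => rw [← Complex.re_add_im c]
      rw [add_smul, smul_neg, smul_smul, mul_comm Complex.I]
      abel
    rw [h3, re_add_im_mem_complexify, Submodule.neg_mem_iff] at hmem
    have hcim : c.im = 0 := by
      by_contra him
      exact hu ((Submodule.smul_mem_iff _ him).1 hmem.2)
    have hcre : c = (c.re : ℂ) := by apply Complex.ext <;> simp [hcim]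
    refine ⟨c.re⁻¹ • r, ?_⟩
    rw [toComplex_smul, ← hc, Complex.ofReal_inv, ← hcre, smul_smul, inv_mul_cancel₀ hc0, one_smul]
  · rintro ⟨h1, h2⟩
    refine ⟨inter_pointsOn_eq_empty_iff.2 h1, ?_⟩
    rintro U hVU x ⟨hx, hxU⟩
    have hxS : x.rep ∈ affineCone X := by
      rw [mem_affineCone_iff x.rep_nonzero, x.mk_rep]; exact hx
    have hxU' : x.rep ∈ complexify U.space := hxU (by
      rw [Projectivization.submodule_eq]; exact Submodule.mem_span_singleton_self _)
    obtain ⟨u, hu, huV⟩ : ∃ u ∈ U.space, u ∉ V.space := by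
      by_contra! hcon
      have h3 : Module.finrank ℝ U.space ≤ Module.finrank ℝ V.space :=
        Submodule.finrank_mono hcon
      have hU : Module.finrank ℝ U.space = ℓ + 1 := U.2
      have hV : Module.finrank ℝ V.space = ℓ := V.2
      omega
    have hU : V.space ⊔ Submodule.span ℝ {u} = U.space := by
      refine Submodule.eq_of_le_of_finrank_eq
        (sup_le hVU (by rwa [Submodule.span_singleton_le_iff_mem])) ?_
      rw [Submodule.finrank_sup_span_singleton huV]
      exact (congrArg (· + 1) V.2).trans U.2.symm
    rw [← hU] at hxU'
    obtain ⟨w, hw, c, hc⟩ := mem_complexify_sup_span.1 hxU'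
    have hc0 : c ≠ 0 := by
      rintro rfl
      exact x.rep_nonzero (h1 _ hxS (by rw [hc]; simpa using hw))
    obtain ⟨r, hr⟩ := h2 u huV (c⁻¹ • x.rep) (smul_mem_affineCone hxS _) (by
      rw [hc, smul_add, smul_smul, inv_mul_cancel₀ hc0, one_smul, add_sub_cancel_right]
      exact Submodule.smul_mem _ _ hw)
    refine ⟨r, ?_, ?_⟩
    · rintro rfl
      rw [toComplex_zero, smul_eq_zero] at hr
      exact hr.elim (inv_ne_zero hc0) x.rep_nonzero
    · rw [← hr, Projectivization.submodule_eq]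
      exact Submodule.smul_mem _ _ (Submodule.mem_span_singleton_self _)

theorem mem_compl_associatedReal_iff {ℓ : ℕ} {V : RealGr ℓ d} :
    V ∈ (associatedReal ℓ X)ᶜ ↔ Avoids (affineCone X) V.space := by
  rw [← inter_pointsOn_eq_empty_iff, Set.mem_compl_iff, associatedReal, Set.mem_ofPred_eq,
    Set.not_nonempty_iff_eq_empty]

end affineCone

/-! ### Exchange of basis vectors. -/

section tuples
variable {d ℓ : ℕ}

/-- Families of real vectors no nontrivial complex combination of which lies in `S`. -/
def avoidingTuples (ℓ : ℕ) (S : Set (Fin (d + 1) → ℂ)) : Set (Fin ℓ → RV d) :=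
  {w | ∀ c : Fin ℓ → ℂ, c ≠ 0 → ∑ j, c j • toComplex (w j) ∉ S}

/-- By homogeneity it suffices to test coefficient vectors of norm one, and these form a compact
set. -/
theorem isOpen_avoidingTuples {S : Set (Fin (d + 1) → ℂ)} (hcl : IsClosed S)
    (hsm : ∀ z ∈ S, ∀ c : ℂ, c • z ∈ S) : IsOpen (avoidingTuples ℓ S) := by
  rw [isOpen_iff_eventually]
  intro w hw
  have hev : ∀ᶠ w' in 𝓝 w, ∀ c ∈ Metric.sphere (0 : Fin ℓ → ℂ) 1,
      ∑ j, c j • toComplex (w' j) ∉ S := by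
    refine (isCompact_sphere (0 : Fin ℓ → ℂ) 1).eventually_forall_of_forall_eventually ?_
    intro c hc
    have hcont : Continuous fun q : (Fin ℓ → RV d) × (Fin ℓ → ℂ) =>
        ∑ j, q.2 j • toComplex (q.1 j) := by
      refine continuous_finsetSum _ fun j _ => ?_
      exact ((continuous_apply j).comp continuous_snd).smul
        (continuous_toComplex.comp ((continuous_apply j).comp continuous_fst))
    refine (hcl.isOpen_compl.preimage hcont).mem_nhds ?_
    refine hw c ?_
    rintro rfl
    simp at hc
  filter_upwards [hev] with w' hw' c hc hmem
  have hn : ‖c‖ ≠ 0 := norm_ne_zero_iff.2 hc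
  refine hw' ((‖c‖ : ℂ)⁻¹ • c) ?_ ?_
  · rw [mem_sphere_zero_iff_norm, norm_smul, norm_inv, Complex.norm_real, norm_norm,
      inv_mul_cancel₀ hn]
  · have := hsm _ hmem ((‖c‖ : ℂ)⁻¹)
    rw [Finset.smul_sum] at this
    simpa [smul_smul] using this

theorem mem_avoidingTuples_iff {S : Set (Fin (d + 1) → ℂ)} (h0 : (0 : Fin (d + 1) → ℂ) ∈ S)
    {w : Fin ℓ → RV d} : w ∈ avoidingTuples ℓ S ↔
      LinearIndependent ℝ w ∧ Avoids S (Submodule.span ℝ (Set.range w)) := by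
  constructor
  · intro hw
    refine ⟨?_, ?_⟩
    · rw [Fintype.linearIndependent_iff]
      intro g hg
      by_contra! hcon
      obtain ⟨i, hi⟩ := hcon
      refine hw (fun j => (g j : ℂ)) (fun h => hi (by simpa using congrFun h i)) ?_
      have : ∑ j, (g j : ℂ) • toComplex (w j) = toComplex (∑ j, g j • w j) := by
        rw [toComplex_sum]
        simp_rw [toComplex_smul]
      rw [this, hg, toComplex_zero]
      exact h0
    · intro z hz hzW
      rw [complexify_span_range, Submodule.mem_span_range_iff_exists_fun] at hzW
      obtain ⟨c, rfl⟩ := hzW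
      by_cases hc : c = 0
      · simp [hc]
      · exact absurd hz (hw c hc)
  · rintro ⟨hli, hav⟩ c hc hmem
    have h1 := hav _ hmem (by
      rw [complexify_span_range, Submodule.mem_span_range_iff_exists_fun]
      exact ⟨c, rfl⟩)
    exact hc (funext (Fintype.linearIndependent_iff.1 (linearIndependent_toComplex hli) c h1))

theorem span_range_update (w : Fin ℓ → RV d) (j : Fin ℓ) (v : RV d) :
    Submodule.span ℝ (Set.range (Function.update w j v)) =
      Submodule.span ℝ (w '' {j}ᶜ) ⊔ Submodule.span ℝ {v} := by
  rw [← Submodule.span_union]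
  congr 1
  ext x
  constructor
  · rintro ⟨i, rfl⟩
    by_cases hi : i = j
    · subst hi; simp
    · left
      exact ⟨i, hi, by rw [Function.update_of_ne hi]⟩
  · rintro (⟨i, hi, rfl⟩ | hx)
    · exact ⟨i, by rw [Function.update_of_ne hi]⟩
    · exact ⟨j, by rw [Function.update_self, Set.mem_singleton_iff.1 hx]⟩

theorem notMem_span_image_compl {w : Fin ℓ → RV d} (hw : LinearIndependent ℝ w) (j : Fin ℓ) :
    w j ∉ Submodule.span ℝ (w '' {j}ᶜ) := hw.notMem_span_image (by simp)

theorem finrank_span_image_compl {w : Fin ℓ → RV d} (hw : LinearIndependent ℝ w) (j : Fin ℓ) :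
    Module.finrank ℝ (Submodule.span ℝ (w '' {j}ᶜ)) + 1 = ℓ := by
  have h1 := span_range_update w j (w j)
  rw [Function.update_eq_self] at h1
  rw [← Submodule.finrank_sup_span_singleton (notMem_span_image_compl hw j), ← h1,
    finrank_span_eq_card hw, Fintype.card_fin]

variable {S : Set (Fin (d + 1) → ℂ)} (hS : IsProjectableCone ℓ S)
include hS

/-- Replacing one vector moves the span inside the pencil of the span of the others. Convexity of
`K` keeps the connecting segment among avoiding tuples, so hyperbolicity propagates along it. -/
theorem IsProjectableCone.isHyperbolicCone_update {K : Set (Fin ℓ → RV d)} (hK : Convex ℝ K)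
    (hKS : K ⊆ avoidingTuples ℓ S) {w : Fin ℓ → RV d} (hw : w ∈ K) {j : Fin ℓ} {v : RV d}
    (hv : Function.update w j v ∈ K)
    (h : IsHyperbolicCone S (Submodule.span ℝ (Set.range w))) :
    IsHyperbolicCone S (Submodule.span ℝ (Set.range (Function.update w j v))) := by
  have hli := ((mem_avoidingTuples_iff hS.zero_mem).1 (hKS hw)).1
  have h1 := span_range_update w j (w j)
  rw [Function.update_eq_self] at h1
  rw [h1] at h
  have hfin := finrank_span_image_compl hli j
  have hZ := hS.isConicHypersurface _ _ (notMem_span_image_compl hli j) hfin h.avoids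
  rw [span_range_update]
  refine hS.isHyperbolicCone_of_segment hfin h (notMem_span_image_compl hli j) ?_
  intro a b ha hb hab hmem
  have h2 : toComplex ((a / (a + b)) • w j + (b / (a + b)) • v) ∈
      coneAlong S (Submodule.span ℝ (w '' {j}ᶜ)) := by
    have := hZ.smul_mem _ hmem (((a + b)⁻¹ : ℝ) : ℂ)
    rw [← toComplex_smul, smul_add, smul_smul, smul_smul] at this
    rwa [div_eq_inv_mul, div_eq_inv_mul]
  have h3 : Function.update w j ((a / (a + b)) • w j + (b / (a + b)) • v) ∈ K := by
    have := hK hw hv (a := a / (a + b)) (b := b / (a + b)) (by positivity) (by positivity)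
      (by field_simp)
    convert this using 1
    ext i : 1
    by_cases hi : i = j
    · subst hi; simp
    · simp only [Function.update_of_ne hi, Pi.add_apply, Pi.smul_apply]
      rw [← add_smul, ← add_div, div_self hab.ne', one_smul]
  obtain ⟨hli', hav'⟩ := (mem_avoidingTuples_iff hS.zero_mem).1 (hKS h3)
  rw [span_range_update] at hav'
  refine (hS.notMem_coneAlong_iff (h.avoids.mono le_sup_left)).2 ⟨?_, hav'⟩ h2
  have h4 := notMem_span_image_compl hli' j
  have h5 : Function.update w j ((a / (a + b)) • w j + (b / (a + b)) • v) '' {j}ᶜ = w '' {j}ᶜ :=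
    Set.image_congr fun i hi => Function.update_of_ne hi _ _
  rwa [h5, Function.update_self] at h4

/-- The ball is a product of balls, so all tuples that mix entries of `w` and `w'` lie in it, and
the entries can be exchanged one at a time. -/
theorem IsProjectableCone.isHyperbolicCone_of_mem_ball {w₀ w w' : Fin ℓ → RV d} {r : ℝ}
    (hball : Metric.ball w₀ r ⊆ avoidingTuples ℓ S) (hw : w ∈ Metric.ball w₀ r)
    (hw' : w' ∈ Metric.ball w₀ r) (h : IsHyperbolicCone S (Submodule.span ℝ (Set.range w))) :
    IsHyperbolicCone S (Submodule.span ℝ (Set.range w')) := by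
  classical
  have hr : 0 < r := dist_nonneg.trans_lt hw
  have hmem : ∀ T : Finset (Fin ℓ), T.piecewise w' w ∈ Metric.ball w₀ r := by
    intro T
    rw [Metric.mem_ball, dist_pi_lt_iff hr]
    intro i
    by_cases hi : i ∈ T
    · rw [Finset.piecewise_eq_of_mem _ _ _ hi]
      exact (dist_pi_lt_iff hr).1 hw' i
    · rw [Finset.piecewise_eq_of_notMem _ _ _ hi]
      exact (dist_pi_lt_iff hr).1 hw i
  have key : ∀ T : Finset (Fin ℓ),
      IsHyperbolicCone S (Submodule.span ℝ (Set.range (T.piecewise w' w))) := by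
    intro T
    induction T using Finset.induction_on with
    | empty => simpa using h
    | insert j T _ ih =>
      have h1 := hmem (insert j T)
      rw [Finset.piecewise_insert] at h1 ⊢
      exact hS.isHyperbolicCone_update (convex_ball w₀ r) hball (hmem T) h1 ih
  simpa using key Finset.univ

end tuples

/-! ### Hyperbolicity is constant on connected sets of avoiding subspaces. -/

section grassmannian
variable {d ℓ : ℕ}

theorem continuous_starProjection_space :
    Continuous fun V : RealGr ℓ d => V.space.starProjection := continuous_induced_dom

theorem RealGr.finrank_space (V : RealGr ℓ d) : Module.finrank ℝ V.space = ℓ := V.2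

theorem RealGr.exists_tuple (V : RealGr ℓ d) : ∃ w : Fin ℓ → RV d, LinearIndependent ℝ w ∧
    Submodule.span ℝ (Set.range w) = V.space := by
  let b := Module.finBasisOfFinrankEq ℝ V.space V.finrank_space
  refine ⟨fun i => b i, b.linearIndependent.map' V.space.subtype V.space.ker_subtype, ?_⟩
  have : (Set.range fun i => (b i : RV d)) = V.space.subtype '' Set.range b := by
    rw [← Set.range_comp]; rfl
  rw [this, Submodule.span_image, b.span_eq, Submodule.map_top, Submodule.range_subtype]

variable {S : Set (Fin (d + 1) → ℂ)} (hS : IsProjectableCone ℓ S)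
include hS

/-- The orthogonal projections of a basis of `V` to a nearby `W` form a basis of `W` close to the
given one, in a ball of avoiding tuples. -/
theorem IsProjectableCone.eventually_isHyperbolicCone_iff {V : RealGr ℓ d}
    (hV : Avoids S V.space) : ∀ᶠ W in 𝓝 V, Avoids S W.space ∧
      (IsHyperbolicCone S W.space ↔ IsHyperbolicCone S V.space) := by
  obtain ⟨w, hli, hsp⟩ := V.exists_tuple
  have hw : w ∈ avoidingTuples ℓ S := (mem_avoidingTuples_iff hS.zero_mem).2 ⟨hli, by rwa [hsp]⟩
  obtain ⟨r, hr, hball⟩ := Metric.isOpen_iff.1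
    (isOpen_avoidingTuples hS.isClosed hS.smul_mem) w hw
  have hc : Continuous fun W : RealGr ℓ d => fun j => W.space.starProjection (w j) :=
    continuous_pi fun j => continuous_starProjection_space.clm_apply continuous_const
  have hVw : (fun j => V.space.starProjection (w j)) = w := by
    funext j
    rw [Submodule.starProjection_eq_self_iff, ← hsp]
    exact Submodule.subset_span ⟨j, rfl⟩
  have hev : ∀ᶠ W in 𝓝 V, (fun j => W.space.starProjection (w j)) ∈ Metric.ball w r := by
    refine hc.continuousAt.eventually (Metric.isOpen_ball.mem_nhds ?_)
    change (fun j => V.space.starProjection (w j)) ∈ _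
    rw [hVw]
    exact Metric.mem_ball_self hr
  filter_upwards [hev] with W hW
  obtain ⟨hli', hav'⟩ := (mem_avoidingTuples_iff hS.zero_mem).1 (hball hW)
  have hspW : Submodule.span ℝ (Set.range fun j => W.space.starProjection (w j)) = W.space := by
    refine Submodule.eq_of_le_of_finrank_eq ?_ ?_
    · rw [Submodule.span_le]
      rintro _ ⟨j, rfl⟩
      exact Submodule.starProjection_apply_mem _ _
    · rw [finrank_span_eq_card hli', Fintype.card_fin, W.finrank_space]
  rw [hspW] at hav'
  refine ⟨hav', ?_⟩
  rw [← hspW, ← hsp]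
  exact ⟨hS.isHyperbolicCone_of_mem_ball hball hW (Metric.mem_ball_self hr),
    hS.isHyperbolicCone_of_mem_ball hball (Metric.mem_ball_self hr) hW⟩

theorem IsProjectableCone.isHyperbolicCone_of_isPreconnected {A : Set (RealGr ℓ d)}
    (hA : IsPreconnected A) (hAS : ∀ V ∈ A, Avoids S V.space) {V W : RealGr ℓ d} (hV : V ∈ A)
    (hVh : IsHyperbolicCone S V.space) (hW : W ∈ A) : IsHyperbolicCone S W.space := by
  let U : Set (RealGr ℓ d) := {W | Avoids S W.space ∧ IsHyperbolicCone S W.space}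
  let U' : Set (RealGr ℓ d) := {W | Avoids S W.space ∧ ¬ IsHyperbolicCone S W.space}
  have hU : IsOpen U := by
    rw [isOpen_iff_eventually]
    intro W hW
    filter_upwards [hS.eventually_isHyperbolicCone_iff hW.1] with W' hW'
    exact ⟨hW'.1, hW'.2.2 hW.2⟩
  have hU' : IsOpen U' := by
    rw [isOpen_iff_eventually]
    intro W hW
    filter_upwards [hS.eventually_isHyperbolicCone_iff hW.1] with W' hW'
    exact ⟨hW'.1, fun h => hW.2 (hW'.2.1 h)⟩
  have hsub : A ⊆ U := IsPreconnected.subset_left_of_subset_union hU hU'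
    (Set.disjoint_left.2 fun W h h' => h'.2 h.2)
    (fun W hW => by
      by_cases h : IsHyperbolicCone S W.space
      · exact Or.inl ⟨hAS W hW, h⟩
      · exact Or.inr ⟨hAS W hW, h⟩) ⟨V, hV, hAS V hV, hVh⟩ hA
  exact (hsub hW).2

end grassmannian

/-! ### Continuity of the parametrization of a pencil by `W₀ᗮ`. -/

section pencil
variable {d ℓ : ℕ}

theorem starProjection_sup_span_singleton (W₀ : Submodule ℝ (RV d)) {u : RV d} (hu : u ∈ W₀ᗮ)
    (hu0 : u ≠ 0) (x : RV d) : (W₀ ⊔ Submodule.span ℝ {u}).starProjection x =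
      W₀.starProjection x + (inner ℝ u x / ‖u‖ ^ 2) • u := by
  refine Submodule.eq_starProjection_of_mem_of_inner_eq_zero ?_ ?_
  · exact Submodule.add_mem_sup (Submodule.starProjection_apply_mem _ _)
      (Submodule.smul_mem _ _ (Submodule.mem_span_singleton_self _))
  · intro w hw
    obtain ⟨a, ha, b, hb, rfl⟩ := Submodule.mem_sup.1 hw
    obtain ⟨c, rfl⟩ := Submodule.mem_span_singleton.1 hb
    have h1 : inner ℝ (x - W₀.starProjection x) a = 0 :=
      Submodule.starProjection_inner_eq_zero x a ha
    have h2 : inner ℝ u a = 0 := Submodule.inner_left_of_mem_orthogonal ha hu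
    have h3 : inner ℝ (W₀.starProjection x) u = 0 :=
      Submodule.inner_right_of_mem_orthogonal (Submodule.starProjection_apply_mem _ _) hu
    have h4 : ‖u‖ ^ 2 ≠ 0 := by positivity
    rw [← sub_sub, inner_sub_left, inner_add_right, inner_add_right, h1, inner_smul_right,
      inner_sub_left, h3, inner_smul_left, inner_smul_left, inner_smul_right, h2,
      real_inner_self_eq_norm_sq, real_inner_comm u x]
    simp only [conj_trivial]
    field_simp
    ring

theorem notMem_of_mem_orthogonal {W₀ : Submodule ℝ (RV d)} {u : RV d} (hu : u ∈ W₀ᗮ)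
    (hu0 : u ≠ 0) : u ∉ W₀ := fun h =>
  hu0 (Submodule.disjoint_def.1 W₀.orthogonal_disjoint u h hu)

/-- The member `W₀ + ℝ u` of the pencil of `W₀`. -/
def pencilPoint (W₀ : Submodule ℝ (RV d)) (hW₀ : Module.finrank ℝ W₀ + 1 = ℓ)
    (u : {u : RV d // u ∈ W₀ᗮ ∧ u ≠ 0}) : RealGr ℓ d :=
  ⟨W₀ ⊔ Submodule.span ℝ {u.1}, by
    rw [Submodule.finrank_sup_span_singleton (notMem_of_mem_orthogonal u.2.1 u.2.2), hW₀]⟩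

theorem continuous_pencilPoint (W₀ : Submodule ℝ (RV d)) (hW₀ : Module.finrank ℝ W₀ + 1 = ℓ) :
    Continuous (pencilPoint W₀ hW₀) := by
  rw [continuous_induced_rng, continuous_clm_apply]
  intro x
  have : (fun u => ((fun V : RealGr ℓ d => V.space.starProjection) ∘ pencilPoint W₀ hW₀) u x) =
      fun u => W₀.starProjection x + (inner ℝ u.1 x / ‖u.1‖ ^ 2) • u.1 := by
    funext u
    exact starProjection_sup_span_singleton W₀ u.2.1 u.2.2 x
  rw [this]
  have h : ∀ u : {u : RV d // u ∈ W₀ᗮ ∧ u ≠ 0}, ‖u.1‖ ^ 2 ≠ 0 := fun u => by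
    have := u.2.2
    positivity
  exact continuous_const.add (((continuous_subtype_val.inner continuous_const).div
    (continuous_subtype_val.norm.pow 2) h).smul continuous_subtype_val)

theorem isPreconnected_pencilPoint_segment (W₀ : Submodule ℝ (RV d))
    (hW₀ : Module.finrank ℝ W₀ + 1 = ℓ) {A : Set (RV d)} (hA : Convex ℝ A)
    (hAW : ∀ u ∈ A, u ∈ W₀ᗮ ∧ u ≠ 0) :
    IsPreconnected (pencilPoint W₀ hW₀ '' (Subtype.val ⁻¹' A)) := by
  refine IsPreconnected.image ?_ _ (continuous_pencilPoint W₀ hW₀).continuousOn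
  have himg : (Subtype.val : {u : RV d // u ∈ W₀ᗮ ∧ u ≠ 0} → RV d) '' (Subtype.val ⁻¹' A) = A :=
    Set.image_preimage_eq_of_subset fun u hu => ⟨⟨u, hAW u hu⟩, rfl⟩
  have hind : Topology.IsInducing (Subtype.val : {u : RV d // u ∈ W₀ᗮ ∧ u ≠ 0} → RV d) := ⟨rfl⟩
  refine hind.isPreconnected_image.1 ?_
  rw [himg]
  exact hA.isPreconnected

end pencil

/-! ### Real points over `Wᗮ`: finiteness, properness, openness and slopes. -/

section realFibres
variable {d ℓ : ℕ}

/-- The real points of a cone. -/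
def realCone (S : Set (Fin (d + 1) → ℂ)) : Set (RV d) := {x | toComplex x ∈ S}

/-- `u` is a vector of a real subspace with respect to which `S` is hyperbolic. -/
def IsHyperbolicVector (ℓ : ℕ) (S : Set (Fin (d + 1) → ℂ)) (u : RV d) : Prop :=
  ∃ W₀ : Submodule ℝ (RV d), Module.finrank ℝ W₀ + 1 = ℓ ∧ u ∉ W₀ ∧
    IsHyperbolicCone S (W₀ ⊔ Submodule.span ℝ {u})

theorem exists_hyperplane_dual {W : Submodule ℝ (RV d)} (hW : Module.finrank ℝ W = ℓ)
    {v : RV d} (hv : v ∈ W) (f : Module.Dual ℝ (RV d)) (hf : f v ≠ 0) :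
    v ∉ W ⊓ LinearMap.ker f ∧ (W ⊓ LinearMap.ker f) ⊔ Submodule.span ℝ {v} = W ∧
      Module.finrank ℝ ↥(W ⊓ LinearMap.ker f) + 1 = ℓ := by
  have h1 : v ∉ W ⊓ LinearMap.ker f := fun h => hf h.2
  have h2 : (W ⊓ LinearMap.ker f) ⊔ Submodule.span ℝ {v} = W := by
    apply le_antisymm
    · exact sup_le inf_le_left (by rwa [Submodule.span_singleton_le_iff_mem])
    · intro x hx
      have : x = (x - (f x / f v) • v) + (f x / f v) • v := by abel
      rw [this]
      refine Submodule.add_mem_sup ⟨Submodule.sub_mem _ hx (Submodule.smul_mem _ _ hv), ?_⟩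
        (Submodule.smul_mem _ _ (Submodule.mem_span_singleton_self _))
      change f (x - (f x / f v) • v) = 0
      rw [map_sub, map_smul, smul_eq_mul, div_mul_cancel₀ _ hf, sub_self]
  refine ⟨h1, h2, ?_⟩
  rw [← Submodule.finrank_sup_span_singleton h1, h2, hW]

theorem exists_hyperplane {W : Submodule ℝ (RV d)} (hW : Module.finrank ℝ W = ℓ)
    {v : RV d} (hv : v ∈ W) (hv0 : v ≠ 0) : ∃ W₀ ≤ W, v ∉ W₀ ∧ W₀ ⊔ Submodule.span ℝ {v} = W ∧
      Module.finrank ℝ W₀ + 1 = ℓ := by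
  have h := exists_hyperplane_dual hW hv (innerSL ℝ v).toLinearMap
    (by simpa using hv0)
  exact ⟨_, inf_le_left, h⟩

theorem IsHyperbolicCone.isHyperbolicVector {S : Set (Fin (d + 1) → ℂ)}
    {W : Submodule ℝ (RV d)} (h : IsHyperbolicCone S W) (hW : Module.finrank ℝ W = ℓ)
    {v : RV d} (hv : v ∈ W) (hv0 : v ≠ 0) : IsHyperbolicVector ℓ S v := by
  obtain ⟨W₀, -, h1, h2, h3⟩ := exists_hyperplane hW hv hv0
  exact ⟨W₀, h3, h1, by rwa [h2]⟩

variable {S : Set (Fin (d + 1) → ℂ)} (hS : IsProjectableCone ℓ S)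
include hS

theorem IsProjectableCone.isClosed_realCone : IsClosed (realCone S) :=
  hS.isClosed.preimage continuous_toComplex

theorem IsProjectableCone.smul_mem_realCone {x : RV d} (hx : x ∈ realCone S) (r : ℝ) :
    r • x ∈ realCone S := by
  change toComplex (r • x) ∈ S
  rw [toComplex_smul]
  exact hS.smul_mem _ hx _

theorem IsProjectableCone.isOpen_isHyperbolicVector : IsOpen {u | IsHyperbolicVector ℓ S u} := by
  rw [Metric.isOpen_iff]
  rintro u ⟨W₀, h1, h2, h3⟩
  have hZ := hS.isConicHypersurface W₀ u h2 h1 h3.avoids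
  have h0 : Avoids S W₀ := h3.avoids.mono le_sup_left
  obtain ⟨r, hr, hball⟩ := hZ.exists_ball_segment_notMem
    ((h3.isHyperbolicDirection h2).notMem hZ)
  refine ⟨r, hr, fun u' hu' => ⟨W₀, h1, ?_, ?_⟩⟩
  · have := hball u' (by rwa [← dist_eq_norm]) 0 1 le_rfl zero_le_one (by norm_num)
    rw [zero_smul, zero_add, one_smul] at this
    exact ((hS.notMem_coneAlong_iff h0).1 this).1
  · exact hS.isHyperbolicCone_of_segment h1 h3 h2 (hball u' (by rwa [← dist_eq_norm]))

/-- The real points of `S` have no secant directions near a point that are close to a vector of a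
subspace with respect to which `S` is hyperbolic. -/
theorem IsProjectableCone.exists_doubleCone_notMem {u : RV d} (hu : IsHyperbolicVector ℓ S u)
    (x : RV d) : ∃ δ > 0, ∀ u' : RV d, ‖u' - u‖ < δ → ∀ τ : ℝ, τ ≠ 0 → |τ| < δ →
      x + τ • u' ∉ realCone S := by
  obtain ⟨W₀, h1, h2, h3⟩ := hu
  have hZ := hS.isConicHypersurface W₀ u h2 h1 h3.avoids
  obtain ⟨δ, hδ, h⟩ := hZ.exists_doubleCone_notMem (h3.isHyperbolicDirection h2) x
  refine ⟨δ, hδ, fun u' hu' τ hτ hτδ hmem => h u' hu' τ hτ hτδ ⟨0, Submodule.zero_mem _, ?_⟩⟩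
  rw [add_zero]
  exact hmem

variable {W : Submodule ℝ (RV d)} (hW : Module.finrank ℝ W = ℓ) (hWS : IsHyperbolicCone S W)
include hW hWS

/-- All nonzero vectors of `W` are hyperbolic. The unit vectors that are not form a compact set
disjoint from `W`, hence at positive distance from it. -/
theorem IsProjectableCone.exists_slope_isHyperbolicVector : ∃ η > 0, ∀ v : RV d, ‖v‖ = 1 →
    ‖Wᗮ.orthogonalProjectionOnto v‖ ≤ η → IsHyperbolicVector ℓ S v := by
  have hK : IsCompact (Metric.sphere (0 : RV d) 1 \ {u | IsHyperbolicVector ℓ S u}) :=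
    (isCompact_sphere _ _).diff hS.isOpen_isHyperbolicVector
  have hc : Continuous fun v : RV d => ‖Wᗮ.orthogonalProjectionOnto v‖ := by fun_prop
  rcases Set.eq_empty_or_nonempty (Metric.sphere (0 : RV d) 1 \ {u | IsHyperbolicVector ℓ S u})
    with h | h
  · refine ⟨1, one_pos, fun v hv _ => ?_⟩
    by_contra hcon
    have : v ∈ Metric.sphere (0 : RV d) 1 \ {u | IsHyperbolicVector ℓ S u} :=
      ⟨by simpa using hv, hcon⟩
    rw [h] at this
    exact this
  · obtain ⟨v₀, hv₀, hmin⟩ := hK.exists_isMinOn h hc.continuousOn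
    have hpos : 0 < ‖Wᗮ.orthogonalProjectionOnto v₀‖ := by
      rw [norm_pos_iff]
      intro h0
      rw [Submodule.orthogonalProjectionOnto_eq_zero_iff, Submodule.orthogonal_orthogonal] at h0
      refine hv₀.2 (hWS.isHyperbolicVector hW h0 ?_)
      rintro rfl
      simpa using hv₀.1
    refine ⟨‖Wᗮ.orthogonalProjectionOnto v₀‖ / 2, by positivity, fun v hv hle => ?_⟩
    by_contra hcon
    have := hmin (show v ∈ Metric.sphere (0 : RV d) 1 \ {u | IsHyperbolicVector ℓ S u} from
      ⟨by simpa using hv, hcon⟩)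
    simp only [Set.mem_ofPred_eq] at this
    linarith

/-- A chord from `x` of small slope over `Wᗮ` has a hyperbolic direction, and short chords of that
kind do not exist; compactness of the set of directions makes this uniform near `x`. The constant
`η` does not depend on `x`, which later gives a Lipschitz bound for sections. -/
theorem IsProjectableCone.exists_forall_eventually_norm_le : ∃ η > 0, ∀ x : RV d,
    ∀ᶠ x' in 𝓝 x, x' ∈ realCone S → η * ‖x' - x‖ ≤ ‖Wᗮ.orthogonalProjectionOnto (x' - x)‖ := by
  obtain ⟨η, hη, h⟩ := hS.exists_slope_isHyperbolicVector hW hWS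
  refine ⟨η, hη, fun x => ?_⟩
  let K : Set (RV d) := {v | ‖v‖ = 1 ∧ ‖Wᗮ.orthogonalProjectionOnto v‖ ≤ η}
  have hK : IsCompact K := by
    have : K = Metric.sphere (0 : RV d) 1 ∩ {v | ‖Wᗮ.orthogonalProjectionOnto v‖ ≤ η} := by
      ext v; simp [K]
    rw [this]
    exact (isCompact_sphere _ _).inter_right (isClosed_le (by fun_prop) continuous_const)
  have hev : ∀ᶠ τ : ℝ in 𝓝 0, ∀ v ∈ K, τ ≠ 0 → x + τ • v ∉ realCone S := by
    refine hK.eventually_forall_of_forall_eventually fun v hv => ?_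
    obtain ⟨δ, hδ, hδ'⟩ := hS.exists_doubleCone_notMem (h v hv.1 hv.2) x
    have : ∀ᶠ q in 𝓝 ((0 : ℝ), v), dist q (0, v) < δ := Metric.eventually_nhds_iff.2
      ⟨δ, hδ, fun y hy => hy⟩
    filter_upwards [this] with q hq hq0
    rw [Prod.dist_eq, max_lt_iff, dist_eq_norm, dist_eq_norm] at hq
    exact hδ' q.2 hq.2 q.1 hq0 (by simpa using hq.1)
  have ht : Tendsto (fun x' : RV d => ‖x' - x‖) (𝓝 x) (𝓝 0) := by
    have : Continuous fun x' : RV d => ‖x' - x‖ := by fun_prop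
    simpa using this.tendsto x
  filter_upwards [ht.eventually hev] with x' hx' hmem
  by_contra! hcon
  have hne : ‖x' - x‖ ≠ 0 := by
    intro h0
    rw [h0, mul_zero] at hcon
    exact absurd hcon (not_lt.2 (norm_nonneg _))
  refine hx' (‖x' - x‖⁻¹ • (x' - x)) ⟨?_, ?_⟩ hne ?_
  · rw [norm_smul, norm_inv, norm_norm, inv_mul_cancel₀ hne]
  · rw [map_smul, norm_smul, norm_inv, norm_norm, inv_mul_le_iff₀ (by positivity), mul_comm]
    exact hcon.le
  · rwa [smul_smul, mul_inv_cancel₀ hne, one_smul, add_sub_cancel]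

-- Properness of the projection along `W` on real points: by avoidance it has no zero on the compact
-- set of unit vectors of the cone.
omit hW in
theorem IsProjectableCone.exists_norm_le : ∃ M : ℝ, 0 < M ∧ ∀ x ∈ realCone S,
    ‖x‖ ≤ M * ‖Wᗮ.orthogonalProjectionOnto x‖ := by
  have hK : IsCompact (Metric.sphere (0 : RV d) 1 ∩ realCone S) :=
    (isCompact_sphere _ _).inter_right hS.isClosed_realCone
  have hc : Continuous fun v : RV d => ‖Wᗮ.orthogonalProjectionOnto v‖ := by fun_prop
  obtain ⟨m, hm, hmin⟩ : ∃ m > 0, ∀ v ∈ Metric.sphere (0 : RV d) 1 ∩ realCone S,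
      m ≤ ‖Wᗮ.orthogonalProjectionOnto v‖ := by
    rcases Set.eq_empty_or_nonempty (Metric.sphere (0 : RV d) 1 ∩ realCone S) with h | h
    · exact ⟨1, one_pos, fun v hv => by rw [h] at hv; exact hv.elim⟩
    · obtain ⟨v₀, hv₀, hmin⟩ := hK.exists_isMinOn h hc.continuousOn
      refine ⟨_, norm_pos_iff.2 fun h0 => ?_, fun v hv => hmin hv⟩
      rw [Submodule.orthogonalProjectionOnto_eq_zero_iff, Submodule.orthogonal_orthogonal] at h0
      have h1 := hWS.avoids _ hv₀.2 (toComplex_mem_complexify.2 h0)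
      rw [← toComplex_zero] at h1
      have h2 := hv₀.1
      rw [toComplex_injective h1] at h2
      simp at h2
  refine ⟨m⁻¹, inv_pos.2 hm, fun x hx => ?_⟩
  by_cases hx0 : x = 0
  · simp [hx0]
  have hn : ‖x‖ ≠ 0 := norm_ne_zero_iff.2 hx0
  have h1 := hmin (‖x‖⁻¹ • x) ⟨by
    rw [mem_sphere_zero_iff_norm, norm_smul, norm_inv, norm_norm, inv_mul_cancel₀ hn],
    hS.smul_mem_realCone hx _⟩
  rw [map_smul, norm_smul, norm_inv, norm_norm, inv_mul_eq_div, le_div_iff₀ (by positivity)] at h1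
  rwa [inv_mul_eq_div, le_div_iff₀ hm, mul_comm]

/-- The real fibres of the projection along `W` have bounded cardinality. -/
theorem IsProjectableCone.exists_ncard_fibre_le : ∃ N : ℕ, ∀ u : RV d,
    {x | x ∈ realCone S ∧ x - u ∈ W}.Finite ∧ {x | x ∈ realCone S ∧ x - u ∈ W}.ncard ≤ N := by
  classical
  obtain ⟨w, hli, hsp⟩ := RealGr.exists_tuple (⟨W, hW⟩ : RealGr ℓ d)
  change _ = W at hsp
  -- Projecting along the span of the other basis vectors of `W` gives a hypersurface, so the `j`-th
  -- coordinate of a fibre point is a root of a nonzero polynomial in one variable whose degree is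
  -- bounded independently of `u`.
  have hj : ∀ j, ∃ p : MvPolynomial (Fin (d + 1)) ℂ,
      ∀ u, restrictLine p (toComplex u) (toComplex (w j)) ≠ 0 ∧
      ∀ x ∈ realCone S, ∀ c : Fin ℓ → ℝ, x - u = ∑ i, c i • w i →
        (restrictLine p (toComplex u) (toComplex (w j))).eval (c j : ℂ) = 0 := by
    intro j
    have hnot := notMem_span_image_compl hli j
    have hfin := finrank_span_image_compl hli j
    have hsup := span_range_update w j (w j)
    rw [Function.update_eq_self, hsp] at hsup
    have hav : Avoids S (Submodule.span ℝ (w '' {j}ᶜ) ⊔ Submodule.span ℝ {w j}) := by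
      rw [← hsup]; exact hWS.avoids
    have hZ := hS.isConicHypersurface _ _ hnot hfin hav
    have hwZ := (hS.notMem_coneAlong_iff (hav.mono le_sup_left)).2 ⟨hnot, hav⟩
    obtain ⟨p, hp⟩ := hZ.exists_polynomial
    refine ⟨p, fun u => ⟨fun h0 => ?_, fun x hx c hc => ?_⟩⟩
    · obtain ⟨R, hR, hb⟩ := hZ.exists_bound hwZ
      have h1 := hb (toComplex u) ((R * ‖toComplex u‖ + 1 : ℝ) : ℂ) ((hp _).2 (by
        rw [← eval_restrictLine, h0, Polynomial.eval_zero]))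
      rw [Complex.norm_real, Real.norm_of_nonneg (by positivity)] at h1
      linarith
    · rw [eval_restrictLine, ← hp, ← toComplex_smul, ← toComplex_add]
      refine ⟨toComplex (∑ i ∈ Finset.univ.erase j, c i • w i), ?_, ?_⟩
      · rw [toComplex_mem_complexify]
        refine Submodule.sum_mem _ fun i hi => Submodule.smul_mem _ _ (Submodule.subset_span
          ⟨i, by simpa using hi, rfl⟩)
      · rw [← toComplex_add, add_assoc, Finset.add_sum_erase _ (fun i => c i • w i)
          (Finset.mem_univ j), ← hc, add_sub_cancel]
        exact hx
  choose p hp using hj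
  refine ⟨∏ j, (p j).totalDegree, fun u => ?_⟩
  let F : Fin ℓ → Finset ℂ := fun j =>
    (restrictLine (p j) (toComplex u) (toComplex (w j))).roots.toFinset
  have hsub : {x | x ∈ realCone S ∧ x - u ∈ W} ⊆
      ((Fintype.piFinset F).image fun t => u + ∑ j, (t j).re • w j : Finset (RV d)) := by
    rintro x ⟨hx, hxW⟩
    rw [← hsp, Submodule.mem_span_range_iff_exists_fun] at hxW
    obtain ⟨c, hc⟩ := hxW
    rw [Finset.coe_image]
    refine ⟨fun j => (c j : ℂ), ?_, ?_⟩
    · rw [Finset.mem_coe, Fintype.mem_piFinset]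
      intro j
      rw [Multiset.mem_toFinset, Polynomial.mem_roots ((hp j u).1)]
      exact (hp j u).2 x hx c hc.symm
    · simp only [Complex.ofReal_re]
      rw [hc, add_sub_cancel]
  refine ⟨(Finset.finite_toSet _).subset hsub, ?_⟩
  refine (Set.ncard_le_ncard hsub (Finset.finite_toSet _)).trans ?_
  rw [Set.ncard_coe_finset]
  refine Finset.card_image_le.trans ?_
  rw [Fintype.card_piFinset]
  refine Finset.prod_le_prod' fun j _ => ?_
  refine (Multiset.toFinset_card_le _).trans ((Polynomial.card_roots' _).trans ?_)
  refine (MvPolynomial.aeval_natDegree_le (p j) le_rfl _ (n := 1) fun i => ?_).trans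
    (by rw [mul_one])
  compute_degree

/-- The projection of the real points of `S` along `W` is open. -/
theorem IsProjectableCone.eventually_exists_mem_realCone (hℓ : 1 ≤ ℓ) {x : RV d}
    (hx : x ∈ realCone S) (hxW : x ∉ W) {ε : ℝ} (hε : 0 < ε) :
    ∀ᶠ u in 𝓝 x, ∃ x' ∈ realCone S, x' - u ∈ W ∧ ‖x' - x‖ < ε := by
  obtain ⟨N, hN⟩ := hS.exists_ncard_fibre_le hW hWS
  have hF := (hN x).1
  obtain ⟨v, hvW, hv0⟩ : ∃ v ∈ W, v ≠ 0 := by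
    refine Submodule.exists_mem_ne_zero_of_ne_bot ?_
    rintro rfl
    rw [finrank_bot] at hW
    omega
  -- A functional `f` that is nonzero on `v` and on all differences within the finite fibre makes
  -- `x` the only real point of its fibre at the level `f = f x`.
  let G : Set (RV d) := insert v
    (((fun x' => x' - x) '' {x' | x' ∈ realCone S ∧ x' - x ∈ W}) \ {0})
  have hG : G.Finite := ((hF.image _).subset Set.sdiff_subset).insert v
  have : Finite G := hG
  obtain ⟨f, hf⟩ := Module.exists_dual_forall_apply_ne_zero (K := ℝ) (fun g : G => (g : RV d))
    (by
      rintro ⟨g, rfl | hg⟩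
      · exact hv0
      · exact hg.2)
  have hfv : f v ≠ 0 := hf ⟨v, Set.mem_insert _ _⟩
  have hsep : ∀ x' ∈ realCone S, x' - x ∈ W → f (x' - x) = 0 → x' = x := by
    intro x' h1 h2 h3
    by_contra hne
    exact hf ⟨x' - x, Or.inr ⟨⟨x', ⟨h1, h2⟩, rfl⟩, sub_ne_zero.2 hne⟩⟩ h3
  obtain ⟨hvW₀, hsup, hfin⟩ := exists_hyperplane_dual hW hvW f hfv
  have hav : Avoids S ((W ⊓ LinearMap.ker f) ⊔ Submodule.span ℝ {v}) := by
    rw [hsup]; exact hWS.avoids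
  have hZ := hS.isConicHypersurface _ _ hvW₀ hfin hav
  have hvZ := (hS.notMem_coneAlong_iff (hav.mono le_sup_left)).2 ⟨hvW₀, hav⟩
  have hxZ : toComplex x ∈ coneAlong S (W ⊓ LinearMap.ker f) :=
    ⟨0, Submodule.zero_mem _, by rw [add_zero]; exact hx⟩
  have hWcl : IsClosed (W : Set (RV d)) := W.closed_of_finiteDimensional
  -- Persistence of roots for the hypersurface along `W ∩ ker f` in direction `v` gives a point of
  -- `S` over `u` with nearly the right value of `f`. Hyperbolicity makes it real, since `u ∉ W`. It
  -- remains to see that it is close to `x`.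
  have key : ∀ η > 0, ∀ᶠ u in 𝓝 x, ∃ r ∈ realCone S, r - u ∈ W ∧ |f (r - u)| ≤ η * |f v| := by
    intro η hη
    filter_upwards [continuous_toComplex.continuousAt.eventually
      (hZ.eventually_exists_add_smul_mem hvZ hxZ hη), hWcl.isOpen_compl.mem_nhds hxW] with u hu huW
    obtain ⟨s, hs, w, hw, hmem⟩ := hu
    obtain ⟨a, ha, b, hb, rfl⟩ := mem_complexify_iff.1 hw
    have hw' := complexify_mono (inf_le_left : W ⊓ LinearMap.ker f ≤ W) hw
    obtain ⟨r, hr⟩ := hWS.real u huW _ hmem (by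
      rw [add_assoc, add_sub_cancel_left]
      exact Submodule.add_mem _ (Submodule.smul_mem _ _ (toComplex_mem_complexify.2 hvW)) hw')
    have h1 : r - u = s.re • v + a := by
      have h2 : toComplex (u + (s.re • v + a)) + Complex.I • toComplex (s.im • v + b) =
          toComplex r + Complex.I • toComplex 0 := by
        rw [toComplex_zero, smul_zero, add_zero, ← hr, toComplex_add, toComplex_add, toComplex_add,
          toComplex_smul, toComplex_smul, smul_add, smul_smul]
        conv_rhs => rw [← Complex.re_add_im s]
        rw [add_smul, mul_comm Complex.I]
        abel
      rw [← (re_add_im_injective h2).1, add_sub_cancel_left]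
    refine ⟨r, ?_, ?_, ?_⟩
    · change toComplex r ∈ S
      rw [← hr]; exact hmem
    · rw [h1]
      exact Submodule.add_mem _ (Submodule.smul_mem _ _ hvW) ha.1
    · have h3 : f a = 0 := ha.2
      rw [h1, map_add, h3, add_zero, map_smul, smul_eq_mul, abs_mul]
      gcongr
      exact (Complex.abs_re_le_norm s).trans hs.le
  obtain ⟨M, hM, hMle⟩ := hS.exists_norm_le hWS
  let K : Set (RV d) := Metric.closedBall 0 (M * (‖x‖ + 1)) ∩ (realCone S ∩ {r | ε ≤ ‖r - x‖})
  have hK : IsCompact K := (isCompact_closedBall _ _).inter_right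
    (hS.isClosed_realCone.inter (isClosed_le continuous_const (by fun_prop)))
  have hfc : Continuous f := f.continuous_of_finiteDimensional
  -- On the real cone `g` vanishes only at `x`, so it has a positive minimum `m` on the compact set
  -- of real points in a fixed ball at distance at least `ε` from `x`; the point found by `key` has
  -- `g < m`.
  let g : RV d → ℝ := fun r => ‖Wᗮ.orthogonalProjectionOnto (r - x)‖ + |f (r - x)|
  have hg : Continuous g := by
    have : Continuous fun r => f (r - x) := hfc.comp (by fun_prop)
    have h2 : Continuous fun r => ‖Wᗮ.orthogonalProjectionOnto (r - x)‖ := by fun_prop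
    exact h2.add this.abs
  obtain ⟨m, hm, hmin⟩ : ∃ m > 0, ∀ r ∈ K, m ≤ g r := by
    rcases Set.eq_empty_or_nonempty K with h | h
    · exact ⟨1, one_pos, fun v hv => by rw [h] at hv; exact hv.elim⟩
    · obtain ⟨r₀, hr₀, hmin⟩ := hK.exists_isMinOn h hg.continuousOn
      refine ⟨g r₀, lt_of_le_of_ne (by positivity) fun h0 => ?_, fun r hr => hmin hr⟩
      have h1 : ‖Wᗮ.orthogonalProjectionOnto (r₀ - x)‖ = 0 := by
        have := abs_nonneg (f (r₀ - x))
        have := norm_nonneg (Wᗮ.orthogonalProjectionOnto (r₀ - x))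
        simp only [g] at h0
        linarith
      have h2 : |f (r₀ - x)| = 0 := by
        simp only [g] at h0
        linarith
      rw [norm_eq_zero, Submodule.orthogonalProjectionOnto_eq_zero_iff,
        Submodule.orthogonal_orthogonal] at h1
      have h3 := hsep r₀ hr₀.2.1 h1 (abs_eq_zero.1 h2)
      have h4 : ε ≤ ‖r₀ - x‖ := hr₀.2.2
      rw [h3, sub_self, norm_zero] at h4
      linarith
  have hfv' : 0 < |f v| := abs_pos.2 hfv
  have hev1 : ∀ᶠ u in 𝓝 x, g u < m / 2 := by
    have := hg.tendsto x
    simp only [g, sub_self, map_zero, norm_zero, abs_zero, add_zero] at this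
    exact this.eventually (gt_mem_nhds (by positivity))
  have hev2 : ∀ᶠ u in 𝓝 x, ‖u‖ < ‖x‖ + 1 :=
    continuous_norm.continuousAt.eventually (gt_mem_nhds (by linarith))
  filter_upwards [key (m / 4 / |f v|) (by positivity), hev1, hev2] with u hu hu1 hu2
  obtain ⟨r, hr, hruW, hrf⟩ := hu
  refine ⟨r, hr, hruW, ?_⟩
  by_contra! hcon
  have hQ : Wᗮ.orthogonalProjectionOnto (r - u) = 0 := by
    rw [Submodule.orthogonalProjectionOnto_eq_zero_iff, Submodule.orthogonal_orthogonal]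
    exact hruW
  have hQr : Wᗮ.orthogonalProjectionOnto r = Wᗮ.orthogonalProjectionOnto u := by
    rwa [map_sub, sub_eq_zero] at hQ
  have hrK : r ∈ K := by
    refine ⟨?_, hr, hcon⟩
    rw [mem_closedBall_zero_iff]
    refine (hMle r hr).trans ?_
    rw [hQr]
    gcongr
    exact (Submodule.norm_orthogonalProjectionOnto_apply_le _ _).trans hu2.le
  have h1 := hmin r hrK
  have h2 : Wᗮ.orthogonalProjectionOnto (r - x) = Wᗮ.orthogonalProjectionOnto (u - x) := by
    rw [map_sub, hQr, map_sub]
  have h3 : |f (r - x)| ≤ |f (r - u)| + |f (u - x)| := by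
    have : r - x = (r - u) + (u - x) := by abel
    rw [this, map_add]
    exact abs_add_le _ _
  have h4 : m / 4 / |f v| * |f v| = m / 4 := by field_simp
  simp only [g] at h1 hu1
  rw [h2] at h1
  linarith

end realFibres

/-! ### Differentiable local sections of the projection along `W`. -/

section sections
variable {d ℓ : ℕ}

theorem orthogonalProjectionOnto_orthogonal_eq_zero {W : Submodule ℝ (RV d)} {x : RV d} :
    Wᗮ.orthogonalProjectionOnto x = 0 ↔ x ∈ W := by
  rw [Submodule.orthogonalProjectionOnto_eq_zero_iff, Submodule.orthogonal_orthogonal]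

theorem orthogonalProjectionOnto_orthogonal_eq_iff {W : Submodule ℝ (RV d)} {x : RV d} {y : Wᗮ} :
    Wᗮ.orthogonalProjectionOnto x = y ↔ x - y ∈ W := by
  rw [← orthogonalProjectionOnto_orthogonal_eq_zero, map_sub,
    Submodule.orthogonalProjectionOnto_mem_subspace_eq_self, sub_eq_zero]

/-- The real points of `S` over a point of `Wᗮ`. -/
def realFibre (S : Set (Fin (d + 1) → ℂ)) (W : Submodule ℝ (RV d)) (y : Wᗮ) : Set (RV d) :=
  {x | x ∈ realCone S ∧ Wᗮ.orthogonalProjectionOnto x = y}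

/-- A map on a convex set that is continuous and pointwise Lipschitz is Lipschitz. -/
theorem norm_sub_le_of_eventually_norm_le {E F : Type*} [NormedAddCommGroup E] [NormedSpace ℝ E]
    [NormedAddCommGroup F] {s : Set E} (hs : Convex ℝ s) {g : E → F}
    (hg : ContinuousOn g s) {L : ℝ} (hL : 0 < L)
    (h : ∀ y ∈ s, ∀ᶠ y' in 𝓝[s] y, ‖g y' - g y‖ ≤ L * ‖y' - y‖) {a b : E} (ha : a ∈ s)
    (hb : b ∈ s) : ‖g b - g a‖ ≤ 2 * L * ‖b - a‖ := by
  by_cases hab : a = b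
  · simp [hab]
  have hn : 0 < ‖b - a‖ := norm_pos_iff.2 (sub_ne_zero.2 (Ne.symm hab))
  have hmem : ∀ t ∈ Set.Icc (0 : ℝ) 1, a + t • (b - a) ∈ s := fun t ht =>
    hs.add_smul_sub_mem ha hb ht
  have hcl : Continuous fun t : ℝ => a + t • (b - a) := by fun_prop
  -- The factor `2` supplies the strict inequality between slopes that the comparison argument
  -- requires.
  have key := image_norm_le_of_liminf_right_slope_norm_lt_deriv_boundary (a := 0) (b := 1)
    (f := fun t : ℝ => g (a + t • (b - a)) - g a) (f' := fun _ => L * ‖b - a‖)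
    (B := fun t => 2 * L * ‖b - a‖ * t) (B' := fun _ => 2 * L * ‖b - a‖)
    ((hg.comp hcl.continuousOn hmem).sub continuousOn_const) ?_ (by simp)
    (by fun_prop) (fun x _ => by
      simpa using (hasDerivWithinAt_id x (Set.Ici x)).const_mul (2 * L * ‖b - a‖))
    (fun x _ _ => by nlinarith [mul_pos hL hn])
  · simpa using key (x := 1) (by simp)
  · intro x hx r hr
    have ht : Tendsto (fun t : ℝ => a + t • (b - a)) (𝓝[>] x) (𝓝[s] (a + x • (b - a))) := by
      refine tendsto_nhdsWithin_iff.2 ⟨(hcl.tendsto x).mono_left nhdsWithin_le_nhds, ?_⟩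
      filter_upwards [Ioc_mem_nhdsGT hx.2] with t ht
      exact hmem t ⟨hx.1.trans ht.1.le, ht.2⟩
    refine Eventually.frequently ?_
    filter_upwards [ht.eventually (h _ (hmem x ⟨hx.1, hx.2.le⟩)), self_mem_nhdsWithin] with t h1 h2
    have h3 : 0 < t - x := sub_pos.2 h2
    refine lt_of_le_of_lt ?_ hr
    rw [slope_def_field, div_le_iff₀ h3]
    simp only [Function.comp_apply]
    refine (norm_sub_norm_le _ _).trans ?_
    have e1 : a + t • (b - a) - (a + x • (b - a)) = (t - x) • (b - a) := by module
    rw [e1, norm_smul, Real.norm_of_nonneg h3.le] at h1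
    rw [sub_sub_sub_cancel_right]
    linarith

/-- `D` is the derivative at the image of `x` of a local section of the projection along `W` of the
real points of `S`, which near `x` are the values of that section. -/
def IsSectionDeriv (S : Set (Fin (d + 1) → ℂ)) (W : Submodule ℝ (RV d)) (D : Wᗮ →L[ℝ] RV d)
    (x : RV d) : Prop :=
  ∃ g : Wᗮ → RV d, HasFDerivAt g D (Wᗮ.orthogonalProjectionOnto x) ∧
    g (Wᗮ.orthogonalProjectionOnto x) = x ∧
    (∀ᶠ y in 𝓝 (Wᗮ.orthogonalProjectionOnto x), g y ∈ realCone S ∧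
      Wᗮ.orthogonalProjectionOnto (g y) = y) ∧
    ∀ᶠ x' in 𝓝 x, x' ∈ realCone S → g (Wᗮ.orthogonalProjectionOnto x') = x'

variable {S : Set (Fin (d + 1) → ℂ)} (hS : IsProjectableCone ℓ S)
variable {W : Submodule ℝ (RV d)} (hW : Module.finrank ℝ W = ℓ) (hWS : IsHyperbolicCone S W)
include hS hW hWS

theorem IsProjectableCone.exists_ncard_realFibre_le : ∃ N : ℕ, ∀ y : Wᗮ,
    (realFibre S W y).Finite ∧ (realFibre S W y).ncard ≤ N := by
  obtain ⟨N, hN⟩ := hS.exists_ncard_fibre_le hW hWS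
  refine ⟨N, fun y => ?_⟩
  have := hN y
  have e : realFibre S W y = {x | x ∈ realCone S ∧ x - (y : RV d) ∈ W} := by
    ext x
    exact and_congr_right fun _ => orthogonalProjectionOnto_orthogonal_eq_iff
  rwa [e]

theorem IsProjectableCone.eventually_exists_mem_realFibre (hℓ : 1 ≤ ℓ) {y : Wᗮ} (hy : y ≠ 0)
    {x : RV d} (hx : x ∈ realFibre S W y) {U : Set (RV d)} (hU : U ∈ 𝓝 x) :
    ∀ᶠ y' in 𝓝 y, ∃ x' ∈ realFibre S W y', x' ∈ U := by
  obtain ⟨ε, hε, hεU⟩ := Metric.mem_nhds_iff.1 hU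
  have hxW : x ∉ W := fun h => hy (by
    rw [← hx.2]; exact orthogonalProjectionOnto_orthogonal_eq_zero.2 h)
  have hc : Continuous fun y' : Wᗮ => x + ((y' - y : Wᗮ) : RV d) := by fun_prop
  have ht : Tendsto (fun y' : Wᗮ => x + ((y' - y : Wᗮ) : RV d)) (𝓝 y) (𝓝 x) := by
    simpa using hc.tendsto y
  filter_upwards [ht.eventually (hS.eventually_exists_mem_realCone hW hWS hℓ hx.1 hxW hε)]
    with y' ⟨x', h1, h2, h3⟩
  refine ⟨x', ⟨h1, ?_⟩, hεU (by rwa [Metric.mem_ball, dist_eq_norm])⟩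
  have h4 := orthogonalProjectionOnto_orthogonal_eq_zero.2 h2
  rw [map_sub, map_add, Submodule.orthogonalProjectionOnto_mem_subspace_eq_self, hx.2,
    add_sub_cancel, sub_eq_zero] at h4
  exact h4

/-- Near a suitable point of an open set, the real fibres consist of the values of sections. -/
theorem IsProjectableCone.exists_forall_existsUnique_mem_realFibre (hℓ : 1 ≤ ℓ) {O : Set Wᗮ}
    (hO : IsOpen O) (hne : O.Nonempty) (h0 : (0 : Wᗮ) ∉ O) :
    ∃ y₀ ∈ O, ∃ U : RV d → Set (RV d), (∀ x, IsOpen (U x)) ∧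
      ∀ᶠ y in 𝓝 y₀, (∀ x ∈ realFibre S W y₀, ∃! x', x' ∈ realFibre S W y ∧ x' ∈ U x) ∧
        ∀ x' ∈ realFibre S W y, ∃ x ∈ realFibre S W y₀, x' ∈ U x := by
  obtain ⟨N, hN⟩ := hS.exists_ncard_realFibre_le hW hWS
  -- At a point with the largest fibre in `O`, openness continues every fibre point into its own
  -- disjoint neighbourhood, and maximality leaves no room for further points.
  obtain ⟨y₀, hy₀, hmax⟩ : ∃ y₀ ∈ O, ∀ y ∈ O,
      (realFibre S W y).ncard ≤ (realFibre S W y₀).ncard := by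
    have hfin : ((fun y => (realFibre S W y).ncard) '' O).Finite :=
      (Set.finite_Iic N).subset (by rintro _ ⟨y, -, rfl⟩; exact (hN y).2)
    obtain ⟨_, ⟨y₀, hy₀, rfl⟩, hm⟩ := Set.exists_max_image _ id hfin (hne.image _)
    exact ⟨y₀, hy₀, fun y hy => hm _ ⟨y, hy, rfl⟩⟩
  have hy₀0 : y₀ ≠ 0 := fun h => h0 (h ▸ hy₀)
  obtain ⟨U, hU, hdisj⟩ := (hN y₀).1.t2_separation
  refine ⟨y₀, hy₀, U, fun x => (hU x).2, ?_⟩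
  have hev : ∀ᶠ y in 𝓝 y₀, ∀ x ∈ realFibre S W y₀, ∃ x' ∈ realFibre S W y, x' ∈ U x :=
    ((hN y₀).1.eventually_all).2 fun x hx =>
      hS.eventually_exists_mem_realFibre hW hWS hℓ hy₀0 hx ((hU x).2.mem_nhds (hU x).1)
  filter_upwards [hev, hO.mem_nhds hy₀] with y hy hyO
  choose! s hs hsU using hy
  have hinj : Set.InjOn s (realFibre S W y₀) := by
    intro a ha b hb hab
    by_contra hne
    exact (Set.disjoint_left.1 (hdisj ha hb hne)) (hsU a ha) (hab ▸ hsU b hb)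
  have himg : s '' realFibre S W y₀ = realFibre S W y := by
    refine Set.eq_of_subset_of_ncard_le ?_ ?_ (hN y).1
    · rintro _ ⟨x, hx, rfl⟩
      exact hs x hx
    · rw [hinj.ncard_image]
      exact hmax y hyO
  refine ⟨fun x hx => ⟨s x, ⟨hs x hx, hsU x hx⟩, ?_⟩, ?_⟩
  · rintro x' ⟨hx', hx'U⟩
    rw [← himg] at hx'
    obtain ⟨b, hb, rfl⟩ := hx'
    by_contra hne
    exact (Set.disjoint_left.1 (hdisj hb hx fun h => hne (by rw [h]))) (hsU b hb) hx'U
  · intro x' hx'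
    rw [← himg] at hx'
    obtain ⟨b, hb, rfl⟩ := hx'
    exact ⟨b, hb, hsU b hb⟩

-- Openness of the projection and uniqueness in `U` give continuity. The slope bound `η` then gives
-- a pointwise Lipschitz estimate with constant `η⁻¹`, which integrates along segments.
omit hWS in
theorem IsProjectableCone.exists_lipschitzOnWith_section (hℓ : 1 ≤ ℓ)
    (hWS : IsHyperbolicCone S W) : ∃ C, ∀ {y₀ : Wᗮ} {ρ : ℝ}, (0 : Wᗮ) ∉ Metric.ball y₀ ρ →
    ∀ {U : Set (RV d)}, IsOpen U → ∀ {g : Wᗮ → RV d},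
    (∀ y ∈ Metric.ball y₀ ρ, g y ∈ realFibre S W y ∧ g y ∈ U ∧
      ∀ x' ∈ realFibre S W y, x' ∈ U → x' = g y) → LipschitzOnWith C g (Metric.ball y₀ ρ) := by
  obtain ⟨η, hη, hlip⟩ := hS.exists_forall_eventually_norm_le hW hWS
  refine ⟨(2 * η⁻¹).toNNReal, fun {y₀ ρ} h0 {U} hU {g} hg => ?_⟩
  have hcont : ContinuousOn g (Metric.ball y₀ ρ) := by
    intro y hy
    rw [ContinuousWithinAt, tendsto_def]
    intro V hV
    have hy0 : y ≠ 0 := fun h => h0 (h ▸ hy)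
    have := hS.eventually_exists_mem_realFibre hW hWS hℓ hy0 (hg y hy).1
      (inter_mem hV (hU.mem_nhds (hg y hy).2.1))
    filter_upwards [mem_nhdsWithin_of_mem_nhds this, self_mem_nhdsWithin] with y' ⟨x', h1, h2⟩ h3
    rw [Set.mem_preimage, ← (hg y' h3).2.2 x' h1 h2.2]
    exact h2.1
  refine LipschitzOnWith.of_dist_le_mul fun a ha b hb => ?_
  rw [dist_eq_norm, dist_eq_norm, Real.coe_toNNReal _ (by positivity)]
  refine norm_sub_le_of_eventually_norm_le (convex_ball y₀ ρ) hcont (inv_pos.2 hη) ?_ hb ha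
  intro y hy
  filter_upwards [(hcont y hy).eventually (hlip (g y)), self_mem_nhdsWithin] with y' h1 h2
  have h3 := h1 (hg y' h2).1.1
  rw [map_sub, (hg y' h2).1.2, (hg y hy).1.2] at h3
  rw [inv_mul_eq_div, le_div_iff₀ hη, mul_comm]
  simpa using h3

/-- Over a suitable point of an open set, all real points have differentiable local sections. -/
theorem IsProjectableCone.exists_forall_isSectionDeriv (hℓ : 1 ≤ ℓ) {O : Set Wᗮ}
    (hO : IsOpen O) (hne : O.Nonempty) (h0 : (0 : Wᗮ) ∉ O) :
    ∃ y ∈ O, ∀ x ∈ realFibre S W y, ∃ D, IsSectionDeriv S W D x := by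
  obtain ⟨y₀, hy₀, U, hU, hev⟩ := hS.exists_forall_existsUnique_mem_realFibre hW hWS hℓ hO hne h0
  obtain ⟨C, hC⟩ := hS.exists_lipschitzOnWith_section hW hℓ hWS
  obtain ⟨ρ, hρ, hball⟩ := Metric.mem_nhds_iff.1 (inter_mem hev (hO.mem_nhds hy₀))
  have hex : ∀ x, ∃ g : Wᗮ → RV d, x ∈ realFibre S W y₀ → ∀ y ∈ Metric.ball y₀ ρ,
      g y ∈ realFibre S W y ∧ g y ∈ U x ∧ ∀ x' ∈ realFibre S W y, x' ∈ U x → x' = g y := by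
    intro x
    have h : ∀ y, ∃ x', x ∈ realFibre S W y₀ → y ∈ Metric.ball y₀ ρ →
        x' ∈ realFibre S W y ∧ x' ∈ U x ∧ ∀ x'' ∈ realFibre S W y, x'' ∈ U x → x'' = x' := by
      intro y
      by_cases hxy : x ∈ realFibre S W y₀ ∧ y ∈ Metric.ball y₀ ρ
      · obtain ⟨x', h1, h2⟩ := (hball hxy.2).1.1 x hxy.1
        exact ⟨x', fun _ _ => ⟨h1.1, h1.2, fun x'' h3 h4 => h2 x'' ⟨h3, h4⟩⟩⟩
      · exact ⟨0, fun h1 h2 => absurd ⟨h1, h2⟩ hxy⟩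
    choose g hg using h
    exact ⟨g, fun hx y hy => hg y hx hy⟩
  choose g hg using hex
  have h0' : (0 : Wᗮ) ∉ Metric.ball y₀ ρ := fun h => h0 (hball h).2
  obtain ⟨N, hN⟩ := hS.exists_ncard_realFibre_le hW hWS
  -- Rademacher's theorem, applied to the finitely many Lipschitz sections simultaneously.
  have hae : ∀ᵐ y ∂(MeasureTheory.volume : MeasureTheory.Measure Wᗮ), ∀ x ∈ realFibre S W y₀,
      y ∈ Metric.ball y₀ ρ → DifferentiableWithinAt ℝ (g x) (Metric.ball y₀ ρ) y :=
    (MeasureTheory.ae_ball_iff (hN y₀).1.countable).2 fun x hx =>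
      (hC h0' (hU x) (hg x hx)).ae_differentiableWithinAt_of_mem
  have hpos : MeasureTheory.volume (Metric.ball y₀ ρ) ≠ 0 := (Metric.measure_ball_pos _ _ hρ).ne'
  obtain ⟨y, hy, hyd⟩ : ∃ y ∈ Metric.ball y₀ ρ, ∀ x ∈ realFibre S W y₀,
      DifferentiableWithinAt ℝ (g x) (Metric.ball y₀ ρ) y := by
    by_contra! hcon
    refine hpos (MeasureTheory.measure_mono_null ?_ hae)
    intro y hy hall
    obtain ⟨x, hx, hnd⟩ := hcon y hy
    exact hnd (hall x hx hy)
  have hnhds : Metric.ball y₀ ρ ∈ 𝓝 y := Metric.isOpen_ball.mem_nhds hy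
  refine ⟨y, (hball hy).2, fun x' hx' => ?_⟩
  obtain ⟨x, hx, hxU⟩ := (hball hy).1.2 x' hx'
  have hgx : g x y = x' := ((hg x hx y hy).2.2 x' hx' hxU).symm
  refine ⟨fderiv ℝ (g x) y, g x, ?_⟩
  rw [hx'.2]
  refine ⟨((hyd x hx).differentiableAt hnhds).hasFDerivAt, hgx, ?_, ?_⟩
  · filter_upwards [hnhds] with y' hy'
    exact (hg x hx y' hy').1
  · have hc : Continuous fun x'' : RV d => Wᗮ.orthogonalProjectionOnto x'' := by fun_prop
    have ht := hc.tendsto x'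
    rw [hx'.2] at ht
    filter_upwards [ht.eventually hnhds, (hU x).mem_nhds hxU] with x'' h1 h2 h3
    exact ((hg x hx _ h1).2.2 x'' ⟨h3, rfl⟩ h2).symm

end sections

/-! ### Tangent directions at real points. -/

section derivatives
variable {d ℓ : ℕ} {S : Set (Fin (d + 1) → ℂ)} {W : Submodule ℝ (RV d)}

theorem IsSectionDeriv.orthogonalProjectionOnto_apply {D : Wᗮ →L[ℝ] RV d} {x : RV d}
    (h : IsSectionDeriv S W D x) (q : Wᗮ) : Wᗮ.orthogonalProjectionOnto (D q) = q := by
  obtain ⟨g, h1, h2, h3, h4⟩ := h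
  have h5 := (Wᗮ.orthogonalProjectionOnto).hasFDerivAt.comp _ h1
  have h6 : HasFDerivAt (Wᗮ.orthogonalProjectionOnto ∘ g) (ContinuousLinearMap.id ℝ Wᗮ)
      (Wᗮ.orthogonalProjectionOnto x) :=
    (hasFDerivAt_id _).congr_of_eventuallyEq (h3.mono fun y hy => hy.2)
  exact congrArg (fun T => T q) (h5.unique h6)

/-- Euler's relation: `S` is a cone, so near the base point the section satisfies `g ((1 + t) y) =
(1 + t) x`. -/
theorem IsSectionDeriv.apply_orthogonalProjectionOnto {D : Wᗮ →L[ℝ] RV d} {x : RV d}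
    (hS : IsProjectableCone ℓ S)
    (h : IsSectionDeriv S W D x) : D (Wᗮ.orthogonalProjectionOnto x) = x := by
  obtain ⟨g, h1, h2, h3, h4⟩ := h
  set y := Wᗮ.orthogonalProjectionOnto x with hy
  have hxS : x ∈ realCone S := by
    have := h3.self_of_nhds.1
    rwa [h2] at this
  have h5 : HasDerivAt (fun t : ℝ => (1 + t) • y) y 0 := by
    simpa using ((hasDerivAt_id (0 : ℝ)).const_add 1).smul_const y
  have h6 : HasDerivAt (fun t : ℝ => (1 + t) • x) x 0 := by
    simpa using ((hasDerivAt_id (0 : ℝ)).const_add 1).smul_const x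
  have h7 : HasDerivAt (fun t : ℝ => g ((1 + t) • y)) (D y) 0 := by
    refine HasFDerivAt.comp_hasDerivAt (𝕜 := ℝ) (0 : ℝ) ?_ h5
    simpa using h1
  have hc : Continuous fun t : ℝ => (1 + t) • x := by fun_prop
  have ht : Tendsto (fun t : ℝ => (1 + t) • x) (𝓝 0) (𝓝 x) := by simpa using hc.tendsto 0
  refine h7.unique (h6.congr_of_eventuallyEq ?_)
  filter_upwards [ht.eventually h4] with t h8
  have h9 := h8 (hS.smul_mem_realCone hxS _)
  rwa [map_smul] at h9

/-- The derivative of a section has no directions in a subspace with respect to which `S` is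
hyperbolic. -/
theorem IsSectionDeriv.not_isHyperbolicVector {D : Wᗮ →L[ℝ] RV d} {x : RV d}
    (hS : IsProjectableCone ℓ S)
    (h : IsSectionDeriv S W D x) (q : Wᗮ) : ¬IsHyperbolicVector ℓ S (D q) := by
  intro hq
  obtain ⟨g, h1, h2, h3, h4⟩ := h
  -- Difference quotients of `g` approach `D q`, so nearby points of the graph would enter the small
  -- double cone around `D q`, which contains no other real point of `S`.
  obtain ⟨δ, hδ, hδ'⟩ := hS.exists_doubleCone_notMem hq x
  set y := Wᗮ.orthogonalProjectionOnto x with hy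
  have h5 : HasDerivAt (fun t : ℝ => y + t • q) q 0 := by
    simpa using ((hasDerivAt_id (0 : ℝ)).smul_const q).const_add y
  have h7 : HasDerivAt (fun t : ℝ => g (y + t • q)) (D q) 0 := by
    refine HasFDerivAt.comp_hasDerivAt (𝕜 := ℝ) (0 : ℝ) ?_ h5
    simpa using h1
  have hs := hasDerivAt_iff_tendsto_slope.1 h7
  have hc : Continuous fun t : ℝ => y + t • q := by fun_prop
  have ht : Tendsto (fun t : ℝ => y + t • q) (𝓝 0) (𝓝 y) := by simpa using hc.tendsto 0
  have e1 : ∀ᶠ t in 𝓝[≠] (0 : ℝ), ‖slope (fun t : ℝ => g (y + t • q)) 0 t - D q‖ < δ := by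
    have := Metric.tendsto_nhds.1 hs δ hδ
    simpa only [dist_eq_norm] using this
  have e2 : ∀ᶠ t in 𝓝[≠] (0 : ℝ), |t| < δ := by
    refine nhdsWithin_le_nhds (Metric.eventually_nhds_iff.2 ⟨δ, hδ, fun t ht => ?_⟩)
    rwa [Real.dist_eq, sub_zero] at ht
  have e3 : ∀ᶠ t in 𝓝[≠] (0 : ℝ), g (y + t • q) ∈ realCone S :=
    nhdsWithin_le_nhds (ht.eventually (h3.mono fun y hy => hy.1))
  have e4 : ∀ᶠ t in 𝓝[≠] (0 : ℝ), t ≠ 0 := self_mem_nhdsWithin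
  obtain ⟨t, ⟨⟨ht1, ht2⟩, ht3⟩, ht4⟩ := (((e1.and e2).and e3).and e4).exists
  refine hδ' _ ht1 t ht4 ht2 ?_
  rw [slope_def_module, sub_zero, smul_smul, mul_inv_cancel₀ ht4, one_smul, zero_smul, add_zero, h2,
    add_sub_cancel]
  exact ht3

end derivatives

/-! ### The sign of the pairing of two sections. -/

section determinant
variable {d ℓ : ℕ} {S : Set (Fin (d + 1) → ℂ)} {W : Submodule ℝ (RV d)}

/-- The pairing of two maps `D₁, D₂ : Wᗮ → ℝ^(d+1)` after projection along `V`. -/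
def sectionPairing (D₁ D₂ : Wᗮ →L[ℝ] RV d) (V : Submodule ℝ (RV d)) : Wᗮ →L[ℝ] Wᗮ :=
  ContinuousLinearMap.adjoint D₂ ∘L
    ((ContinuousLinearMap.id ℝ (RV d) - V.starProjection) ∘L D₁)

theorem inner_sectionPairing (D₁ D₂ : Wᗮ →L[ℝ] RV d) (V : Submodule ℝ (RV d)) (p q : Wᗮ) :
    inner ℝ (sectionPairing D₁ D₂ V p) q = inner ℝ (D₁ p - V.starProjection (D₁ p)) (D₂ q) := by
  rw [sectionPairing, ContinuousLinearMap.comp_apply, ContinuousLinearMap.adjoint_inner_left]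
  rfl

theorem continuous_det_sectionPairing (D₁ D₂ : Wᗮ →L[ℝ] RV d) :
    Continuous fun V : RealGr ℓ d => (sectionPairing D₁ D₂ V.space).det := by
  have h : Continuous fun V : RealGr ℓ d => sectionPairing D₁ D₂ V.space :=
    continuous_const.clm_comp
      ((continuous_const.sub continuous_starProjection_space).clm_comp continuous_const)
  exact ContinuousLinearMap.continuous_det.comp h

/-- Modulo `W`, both maps are the identity of `Wᗮ`. -/
theorem det_sectionPairing_self {D₁ D₂ : Wᗮ →L[ℝ] RV d}
    (h₁ : ∀ q, Wᗮ.orthogonalProjectionOnto (D₁ q) = q)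
    (h₂ : ∀ q, Wᗮ.orthogonalProjectionOnto (D₂ q) = q) : (sectionPairing D₁ D₂ W).det = 1 := by
  have h : sectionPairing D₁ D₂ W = ContinuousLinearMap.id ℝ Wᗮ := by
    ext1 p
    refine ext_inner_right ℝ fun q => ?_
    rw [inner_sectionPairing]
    have e : D₁ p - W.starProjection (D₁ p) = (p : RV d) := by
      have h3 := Submodule.starProjection_add_starProjection_orthogonal (K := W) (D₁ p)
      rw [sub_eq_iff_eq_add', ← h3]
      congr 1
      · rw [h3]
      · rw [Submodule.starProjection_apply, h₁]
    rw [e]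
    have h4 := Submodule.inner_orthogonalProjectionOnto_eq_of_mem_left p (D₂ q)
    rw [h₂] at h4
    exact h4.symm
  rw [h]
  exact LinearMap.det_id

/-- If two maps into `ℝ^(d+1)` have no directions in `V`, their pairing is nondegenerate. -/
theorem det_sectionPairing_ne_zero (hW : Module.finrank ℝ W = ℓ) {V : Submodule ℝ (RV d)}
    (hV : Module.finrank ℝ V = ℓ) {D₁ D₂ : Wᗮ →L[ℝ] RV d}
    (h₁ : ∀ q, D₁ q ∈ V → q = 0) (h₂ : ∀ q, D₂ q ∈ V → q = 0) :
    (sectionPairing D₁ D₂ V).det ≠ 0 := by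
  intro hdet
  obtain ⟨q, hq, hq0⟩ := Submodule.exists_mem_ne_zero_of_ne_bot
    (LinearMap.bot_lt_ker_of_det_eq_zero hdet).ne'
  have hq' : sectionPairing D₁ D₂ V q = 0 := hq
  refine hq0 (h₁ q ?_)
  -- `D₂` followed by projection to `Vᗮ` is injective between spaces of equal dimension, hence onto.
  -- So the component of `D₁ q` in `Vᗮ`, being orthogonal to the whole image, vanishes.
  let B : Wᗮ →ₗ[ℝ] Vᗮ := (Vᗮ.orthogonalProjectionOnto : RV d →ₗ[ℝ] Vᗮ) ∘ₗ (D₂ : Wᗮ →ₗ[ℝ] RV d)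
  have hBinj : Function.Injective B := by
    rw [← LinearMap.ker_eq_bot, LinearMap.ker_eq_bot']
    intro p hp
    exact h₂ p (orthogonalProjectionOnto_orthogonal_eq_zero.1 hp)
  have hdim : Module.finrank ℝ Wᗮ = Module.finrank ℝ Vᗮ := by
    have e1 := W.finrank_add_finrank_orthogonal
    have e2 := V.finrank_add_finrank_orthogonal
    omega
  obtain ⟨p, hp⟩ := (LinearMap.injective_iff_surjective_of_finrank_eq_finrank hdim).1 hBinj
    (Vᗮ.orthogonalProjectionOnto (D₁ q))
  have hv : ∀ x : RV d, x - V.starProjection x = (Vᗮ.orthogonalProjectionOnto x : RV d) := by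
    intro x
    rw [sub_eq_iff_eq_add']
    exact (Submodule.starProjection_add_starProjection_orthogonal (K := V) x).symm
  have h := inner_sectionPairing D₁ D₂ V q p
  rw [hq', inner_zero_left, hv,
    ← Submodule.inner_orthogonalProjectionOnto_eq_of_mem_left] at h
  change 0 = inner ℝ _ (B p) at h
  rw [hp, Submodule.coe_inner, real_inner_self_eq_norm_sq, eq_comm, sq_eq_zero_iff, norm_eq_zero,
    Submodule.coe_eq_zero] at h
  exact orthogonalProjectionOnto_orthogonal_eq_zero.1 h

theorem IsSectionDeriv.eq_zero_of_mem (hS : IsProjectableCone ℓ S) {D : Wᗮ →L[ℝ] RV d} {x : RV d}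
    (h : IsSectionDeriv S W D x) {V : Submodule ℝ (RV d)} (hV : Module.finrank ℝ V = ℓ)
    (hVS : IsHyperbolicCone S V) (q : Wᗮ) (hq : D q ∈ V) : q = 0 := by
  by_contra hq0
  refine h.not_isHyperbolicVector hS q (hVS.isHyperbolicVector hV hq fun h0 => hq0 ?_)
  rw [← h.orthogonalProjectionOnto_apply q, h0, map_zero]

/-- The determinant is continuous, has no zero on the connected set `A`, and equals `1` at `W`. -/
theorem det_sectionPairing_pos (hS : IsProjectableCone ℓ S) {A : Set (RealGr ℓ d)}
    (hA : IsPreconnected A) (hAS : ∀ V ∈ A, IsHyperbolicCone S V.space) {W V : RealGr ℓ d}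
    (hW : W ∈ A) (hV : V ∈ A) {D₁ D₂ : W.spaceᗮ →L[ℝ] RV d} {x₁ x₂ : RV d}
    (h₁ : IsSectionDeriv S W.space D₁ x₁) (h₂ : IsSectionDeriv S W.space D₂ x₂) :
    0 < (sectionPairing D₁ D₂ V.space).det := by
  have hne : ∀ V ∈ A, (sectionPairing D₁ D₂ V.space).det ≠ 0 := fun V hV =>
    det_sectionPairing_ne_zero W.finrank_space V.finrank_space
      (h₁.eq_zero_of_mem hS V.finrank_space (hAS V hV))
      (h₂.eq_zero_of_mem hS V.finrank_space (hAS V hV))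
  by_contra! hle
  obtain ⟨V', hV', h0⟩ := hA.intermediate_value hV hW
    (continuous_det_sectionPairing D₁ D₂).continuousOn
    (show (0 : ℝ) ∈ _ from ⟨hle, by
      change 0 ≤ (sectionPairing D₁ D₂ W.space).det
      rw [det_sectionPairing_self h₁.orthogonalProjectionOnto_apply
        h₂.orthogonalProjectionOnto_apply]
      exact zero_le_one⟩)
  exact hne V' hV' h0

/-- Two real points over the same point of `Wᗮ`, where `W = W₀ + ℝ e`, differ from a point `u`
with `W₀ + ℝ u` in the component of `W` by multiples of `e` of the same sign modulo `W₀`. -/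
theorem mul_nonneg_of_isSectionDeriv (hS : IsProjectableCone ℓ S) {A : Set (RealGr ℓ d)}
    (hA : IsPreconnected A) (hAS : ∀ V ∈ A, IsHyperbolicCone S V.space) {W V : RealGr ℓ d}
    (hW : W ∈ A) (hV : V ∈ A) {W₀ : Submodule ℝ (RV d)} {e u : RV d} (he : e ≠ 0)
    (heW₀ : e ∈ W₀ᗮ)
    (hWe : W.space = W₀ ⊔ Submodule.span ℝ {e}) (hVu : V.space = W₀ ⊔ Submodule.span ℝ {u})
    {D₁ D₂ : W.spaceᗮ →L[ℝ] RV d} {x₁ x₂ : RV d}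
    (h₁ : IsSectionDeriv S W.space D₁ x₁) (h₂ : IsSectionDeriv S W.space D₂ x₂)
    {c₁ c₂ : ℝ} (hc₁ : x₁ - (u + c₁ • e) ∈ W₀) (hc₂ : x₂ - (u + c₂ • e) ∈ W₀) :
    0 ≤ c₁ * c₂ := by
  by_contra! hneg
  have hc₂0 : c₂ ≠ 0 := fun h => by simp [h] at hneg
  have heW : e ∈ W.space := by
    rw [hWe]; exact Submodule.mem_sup_right (Submodule.mem_span_singleton_self _)
  have hW₀W : W₀ ≤ W.space := by rw [hWe]; exact le_sup_left
  have huV : u ∈ V.space := by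
    rw [hVu]; exact Submodule.mem_sup_right (Submodule.mem_span_singleton_self _)
  have hW₀V : W₀ ≤ V.space := by rw [hVu]; exact le_sup_left
  let y : W.spaceᗮ := W.spaceᗮ.orthogonalProjectionOnto u
  have hproj : ∀ {x : RV d} {c : ℝ}, x - (u + c • e) ∈ W₀ →
      W.spaceᗮ.orthogonalProjectionOnto x = y := by
    intro x c hx
    have := orthogonalProjectionOnto_orthogonal_eq_zero.2 (hW₀W hx)
    rw [map_sub, map_add, orthogonalProjectionOnto_orthogonal_eq_zero.2
      (W.space.smul_mem c heW), add_zero, sub_eq_zero] at this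
    exact this
  have hy₁ : D₁ y = x₁ := by
    rw [← hproj hc₁]; exact h₁.apply_orthogonalProjectionOnto hS
  have hy₂ : D₂ y = x₂ := by
    rw [← hproj hc₂]; exact h₂.apply_orthogonalProjectionOnto hS
  have hee : (‖e‖ ^ 2 : ℝ) ≠ 0 := by positivity
  -- `D₁ q - D₂ q` lies in `W = W₀ + ℝe`, and `φ q` is its coefficient at `e` modulo `W₀`.
  let φ : Module.Dual ℝ W.spaceᗮ :=
    (‖e‖ ^ 2)⁻¹ • ((innerSL ℝ e).comp (D₁ - D₂)).toLinearMap
  have hφ : ∀ q, φ q = (‖e‖ ^ 2)⁻¹ * inner ℝ e (D₁ q - D₂ q) := fun q => rfl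
  have hφ' : ∀ q, D₁ q - D₂ q - φ q • e ∈ W₀ := by
    intro q
    have hmem : D₁ q - D₂ q ∈ W.space := by
      rw [← orthogonalProjectionOnto_orthogonal_eq_zero, map_sub,
        h₁.orthogonalProjectionOnto_apply, h₂.orthogonalProjectionOnto_apply, sub_self]
    obtain ⟨w, hw, b, hb, hwb⟩ := Submodule.mem_sup.1 (hWe.le hmem)
    obtain ⟨c, rfl⟩ := Submodule.mem_span_singleton.1 hb
    have : φ q = c := by
      rw [hφ, ← hwb, inner_add_right, Submodule.inner_left_of_mem_orthogonal hw heW₀,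
        inner_smul_right, real_inner_self_eq_norm_sq]
      field_simp
      ring
    rw [this, ← hwb, add_sub_cancel_right]
    exact hw
  have hφy : φ y = c₁ - c₂ := by
    have h3 : x₁ - x₂ - (c₁ - c₂) • e ∈ W₀ := by
      have := W₀.sub_mem hc₁ hc₂
      convert this using 1
      module
    have h4 := Submodule.inner_left_of_mem_orthogonal h3 heW₀
    rw [inner_sub_right, inner_smul_right, real_inner_self_eq_norm_sq, sub_eq_zero] at h4
    rw [hφ, hy₁, hy₂, h4]
    field_simp
  -- Modulo `V = W₀ + ℝu` one has `D₂ y = x₂ ≡ c₂ e`, so `e ≡ D₂ (c₂⁻¹ y)` and `D₁ q ≡ D₂ (q + φ q •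
  -- c₂⁻¹ y)`. The determinant of this transvection is `1 + (c₁ - c₂) / c₂ = c₁ / c₂`.
  let T : W.spaceᗮ →ₗ[ℝ] W.spaceᗮ := LinearMap.transvection φ (c₂⁻¹ • y)
  have hT : T.det = c₁ / c₂ := by
    rw [LinearMap.transvection.det, map_smul, hφy, smul_eq_mul]
    field_simp
    ring
  have hP : ∀ x ∈ V.space, x - V.space.starProjection x = 0 := fun x hx => by
    rw [Submodule.starProjection_eq_self_iff.2 hx, sub_self]
  have hcomp : ((sectionPairing D₁ D₂ V.space : W.spaceᗮ →L[ℝ] W.spaceᗮ) :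
      W.spaceᗮ →ₗ[ℝ] W.spaceᗮ) =
      ((sectionPairing D₂ D₂ V.space : W.spaceᗮ →L[ℝ] W.spaceᗮ) :
        W.spaceᗮ →ₗ[ℝ] W.spaceᗮ) ∘ₗ T := by
    ext1 q
    refine ext_inner_right ℝ fun p => ?_
    change inner ℝ (sectionPairing D₁ D₂ V.space q) p =
      inner ℝ (sectionPairing D₂ D₂ V.space (T q)) p
    rw [inner_sectionPairing, inner_sectionPairing]
    congr 1
    have hTq : T q = q + φ q • c₂⁻¹ • y := rfl
    have hmem : D₁ q - D₂ (T q) ∈ V.space := by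
      rw [hTq, map_add, map_smul, map_smul, hy₂]
      have e1 : D₁ q - (D₂ q + φ q • c₂⁻¹ • x₂) = (D₁ q - D₂ q - φ q • e) -
          (φ q * c₂⁻¹) • (x₂ - (u + c₂ • e)) - (φ q * c₂⁻¹) • u := by
        have : φ q • e = (φ q * c₂⁻¹) • c₂ • e := by
          rw [smul_smul, mul_assoc, inv_mul_cancel₀ hc₂0, mul_one]
        rw [this]
        module
      rw [e1]
      exact V.space.sub_mem (V.space.sub_mem (hW₀V (hφ' q)) (V.space.smul_mem _ (hW₀V hc₂)))
        (V.space.smul_mem _ huV)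
    have := hP _ hmem
    rw [map_sub] at this
    rw [← sub_eq_zero, ← this]
    abel
  have hpos₁ := det_sectionPairing_pos hS hA hAS hW hV h₁ h₂
  have hpos₂ := det_sectionPairing_pos hS hA hAS hW hV h₂ h₂
  rw [ContinuousLinearMap.det, hcomp, LinearMap.det_comp, hT] at hpos₁
  have h5 : 0 < c₁ / c₂ := (pos_iff_pos_of_mul_pos hpos₁).1 hpos₂
  have h6 : c₁ * c₂ = c₁ / c₂ * c₂ ^ 2 := by field_simp
  have h7 : 0 < c₂ ^ 2 := by positivity
  nlinarith [mul_pos h5 h7]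

end determinant

/-! ### Slices of the component are double hyperbolicity cones. -/

section slices
variable {d ℓ : ℕ} {S : Set (Fin (d + 1) → ℂ)}

/-- `A` is a union of connected components of the set of subspaces that avoid `S`. -/
def IsComponentUnion (S : Set (Fin (d + 1) → ℂ)) (A : Set (RealGr ℓ d)) : Prop :=
  ∀ B : Set (RealGr ℓ d), IsPreconnected B → (∀ V ∈ B, Avoids S V.space) → (A ∩ B).Nonempty → B ⊆ A

theorem pencilPoint_mem_of_convex (hS : IsProjectableCone ℓ S) {A : Set (RealGr ℓ d)}
    (hA : IsComponentUnion S A) {W₀ : Submodule ℝ (RV d)}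
    (hW₀ : Module.finrank ℝ W₀ + 1 = ℓ) (h0 : Avoids S W₀) {B : Set (RV d)} (hB : Convex ℝ B)
    (hBS : ∀ u ∈ B, u ∈ W₀ᗮ ∧ toComplex u ∉ coneAlong S W₀)
    {u v : {u : RV d // u ∈ W₀ᗮ ∧ u ≠ 0}} (hu : u.1 ∈ B) (huA : pencilPoint W₀ hW₀ u ∈ A)
    (hv : v.1 ∈ B) : pencilPoint W₀ hW₀ v ∈ A := by
  refine hA _ (isPreconnected_pencilPoint_segment W₀ hW₀ hB fun x hx => ⟨(hBS x hx).1, ?_⟩) ?_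
    ⟨_, huA, u, hu, rfl⟩ ⟨v, hv, rfl⟩
  · rintro rfl
    exact ((hS.notMem_coneAlong_iff h0).1 (hBS _ hx).2).1 W₀.zero_mem
  · rintro _ ⟨w, hw, rfl⟩
    exact ((hS.notMem_coneAlong_iff h0).1 (hBS _ hw).2).2

/-- A direction outside of the hyperbolicity cone yields a real point of `S` on one side. -/
theorem exists_mem_realCone_of_notMem_hyperbolicityCone (hS : IsProjectableCone ℓ S)
    {W₀ : Submodule ℝ (RV d)} (hW₀ : Module.finrank ℝ W₀ + 1 = ℓ) {e u : RV d}
    (he : IsHyperbolicCone S (W₀ ⊔ Submodule.span ℝ {e})) (heW₀ : e ∉ W₀)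
    (huS : toComplex u ∉ coneAlong S W₀) (huW : u ∉ W₀ ⊔ Submodule.span ℝ {e})
    (hu : ¬∀ a b : ℝ, 0 ≤ a → 0 ≤ b → 0 < a + b → toComplex (a • e + b • u) ∉ coneAlong S W₀) :
    ∃ x ∈ realCone S, ∃ c : ℝ, 0 < c ∧ x - (u + c • e) ∈ W₀ := by
  push Not at hu
  obtain ⟨a, b, ha, hb, hab, hmem⟩ := hu
  have hZ := hS.isConicHypersurface W₀ e heW₀ hW₀ he.avoids
  have hb0 : 0 < b := by
    refine lt_of_le_of_ne hb fun h => ?_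
    rw [← h, zero_smul, add_zero, toComplex_smul, hZ.smul_mem_iff (by
      rw [← h, add_zero] at hab; exact_mod_cast hab.ne')] at hmem
    exact (he.isHyperbolicDirection heW₀).notMem hZ hmem
  have ha0 : 0 < a := by
    refine lt_of_le_of_ne ha fun h => ?_
    rw [← h, zero_smul, zero_add, toComplex_smul, hZ.smul_mem_iff (by exact_mod_cast hb0.ne')]
      at hmem
    exact huS hmem
  have hmem' : toComplex (u + (a / b) • e) ∈ coneAlong S W₀ := by
    rw [← hZ.smul_mem_iff (c := (b : ℂ)) (by exact_mod_cast hb0.ne'), ← toComplex_smul]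
    convert hmem using 2
    rw [smul_add, smul_smul, mul_div_cancel₀ _ hb0.ne', add_comm (b • u)]
  obtain ⟨w, hw, hz⟩ := hmem'
  have hW₀W : W₀ ≤ W₀ ⊔ Submodule.span ℝ {e} := le_sup_left
  obtain ⟨r, hr⟩ := he.real (u + (a / b) • e) (fun h => huW (by
    have := Submodule.sub_mem _ h (Submodule.smul_mem _ (a / b)
      (Submodule.mem_sup_right (Submodule.mem_span_singleton_self e)))
    rwa [add_sub_cancel_right] at this)) _ hz (by
      rw [add_sub_cancel_left]; exact complexify_mono hW₀W hw)
  refine ⟨r, ?_, a / b, by positivity, ?_⟩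
  · change toComplex r ∈ S
    rwa [← hr]
  · rw [← toComplex_mem_complexify, toComplex_sub, ← hr, add_sub_cancel_left]
    exact hw

theorem mem_span_of_mem_sup_of_mem_orthogonal {W₀ : Submodule ℝ (RV d)} {e u : RV d}
    (he : e ∈ W₀ᗮ) (hu : u ∈ W₀ᗮ) (h : u ∈ W₀ ⊔ Submodule.span ℝ {e}) : ∃ c : ℝ, u = c • e := by
  obtain ⟨w, hw, b, hb, hwb⟩ := Submodule.mem_sup.1 h
  obtain ⟨c, rfl⟩ := Submodule.mem_span_singleton.1 hb
  have h1 : w ∈ W₀ᗮ := by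
    rw [← add_sub_cancel_right w (c • e), hwb]
    exact Submodule.sub_mem _ hu (Submodule.smul_mem _ _ he)
  have h2 : w = 0 := Submodule.disjoint_def.1 W₀.orthogonal_disjoint w hw h1
  exact ⟨c, by rw [← hwb, h2, zero_add]⟩

/-- Tangent spaces are available only over suitable points, so `u` is first moved slightly. The
opposite signs and membership of the pencil point in `A` are open conditions along this move, and
the sign lemma `mul_nonneg_of_isSectionDeriv` then applies. -/
theorem not_exists_opposite_mem_realCone (hS : IsProjectableCone ℓ S) (hℓ : 1 ≤ ℓ)
    {A : Set (RealGr ℓ d)} (hA : IsPreconnected A) (hA' : IsComponentUnion S A)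
    (hAS : ∀ V ∈ A, IsHyperbolicCone S V.space) {W₀ : Submodule ℝ (RV d)}
    (hW₀ : Module.finrank ℝ W₀ + 1 = ℓ) {W : RealGr ℓ d} (hW : W ∈ A) {e : RV d} (heW₀' : e ∈ W₀ᗮ)
    (he0 : e ≠ 0) (hWe : W.space = W₀ ⊔ Submodule.span ℝ {e})
    {u : {u : RV d // u ∈ W₀ᗮ ∧ u ≠ 0}} (hu : pencilPoint W₀ hW₀ u ∈ A) (huW : u.1 ∉ W.space)
    {x₁ x₂ : RV d} (hx₁ : x₁ ∈ realCone S) (hx₂ : x₂ ∈ realCone S) {c₁ c₂ : ℝ} (hc₁ : 0 < c₁)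
    (hc₂ : c₂ < 0) (h₁ : x₁ - (u.1 + c₁ • e) ∈ W₀) (h₂ : x₂ - (u.1 + c₂ • e) ∈ W₀) : False := by
  have heW : e ∈ W.space := hWe.ge (Submodule.mem_sup_right (Submodule.mem_span_singleton_self _))
  have hW₀W : W₀ ≤ W.space := le_sup_left.trans hWe.ge
  have hWW₀ : W.spaceᗮ ≤ W₀ᗮ := Submodule.orthogonal_le hW₀W
  let y : W.spaceᗮ := W.spaceᗮ.orthogonalProjectionOnto u.1
  have hy0 : y ≠ 0 := fun h => huW (orthogonalProjectionOnto_orthogonal_eq_zero.1 h)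
  have hproj : ∀ {x : RV d} {c : ℝ}, x - (u.1 + c • e) ∈ W₀ →
      W.spaceᗮ.orthogonalProjectionOnto x = y := by
    intro x c hx
    have := orthogonalProjectionOnto_orthogonal_eq_zero.2 (hW₀W hx)
    rw [map_sub, map_add, orthogonalProjectionOnto_orthogonal_eq_zero.2
      (W.space.smul_mem c heW), add_zero, sub_eq_zero] at this
    exact this
  have hee : 0 < ‖e‖ ^ 2 := by
    positivity
  have hinner : ∀ {x v : RV d} {c : ℝ}, x - (v + c • e) ∈ W₀ →
      inner ℝ e (x - v) = c * ‖e‖ ^ 2 := by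
    intro x v c hx
    have h4 := Submodule.inner_left_of_mem_orthogonal hx heW₀'
    rw [← sub_sub, inner_sub_right, inner_smul_right, real_inner_self_eq_norm_sq,
      sub_eq_zero] at h4
    exact h4
  -- The perturbation of `u`: the point `v y'` stays in `W₀ᗮ`, lies over `y'`, and equals `u` at `y'
  -- = y`.
  let v : W.spaceᗮ → RV d := fun y' => u.1 + ((y' - y : W.spaceᗮ) : RV d)
  have hvc : Continuous v := by fun_prop
  have hvy : v y = u.1 := by simp [v]
  have hvW₀ : ∀ y', v y' ∈ W₀ᗮ := fun y' =>
    Submodule.add_mem _ u.2.1 (hWW₀ (y' - y : W.spaceᗮ).2)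
  have hvproj : ∀ y', W.spaceᗮ.orthogonalProjectionOnto (v y') = y' := by
    intro y'
    rw [map_add, Submodule.orthogonalProjectionOnto_mem_subspace_eq_self]
    exact add_sub_cancel _ _
  have hcoef : ∀ {y' : W.spaceᗮ} {x : RV d}, x ∈ realFibre S W.space y' →
      ∃ c : ℝ, x - (v y' + c • e) ∈ W₀ := by
    intro y' x hx
    have : x - v y' ∈ W.space := by
      rw [← orthogonalProjectionOnto_orthogonal_eq_zero, map_sub, hx.2, hvproj, sub_self]
    obtain ⟨w, hw, b, hb, hwb⟩ := Submodule.mem_sup.1 (hWe.le this)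
    obtain ⟨c, rfl⟩ := Submodule.mem_span_singleton.1 hb
    refine ⟨c, ?_⟩
    rwa [← sub_sub, ← hwb, add_sub_cancel_right]
  have hWh := hAS W hW
  have h0 : Avoids S W₀ := hWh.avoids.mono hW₀W
  have heW₀ : e ∉ W₀ := notMem_of_mem_orthogonal heW₀' he0
  have hZ := hS.isConicHypersurface W₀ e heW₀ hW₀ (hWe ▸ hWh.avoids)
  have huS : toComplex u.1 ∉ coneAlong S W₀ := (hS.notMem_coneAlong_iff h0).2
    ⟨notMem_of_mem_orthogonal u.2.1 u.2.2, (hAS _ hu).avoids⟩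
  have hOpen : IsOpen {x : RV d | toComplex x ∉ coneAlong S W₀} :=
    hZ.isClosed.isOpen_compl.preimage continuous_toComplex
  obtain ⟨r, hr, hball⟩ := Metric.isOpen_iff.1 hOpen u.1 huS
  have hev1 : ∀ᶠ y' in 𝓝 y, v y' ∈ Metric.ball u.1 r :=
    (hvc.tendsto y).eventually (by
      rw [hvy]; exact Metric.ball_mem_nhds _ hr)
  -- The coefficient at `e` modulo `W₀` is read off by the inner product with `e`, so its sign `σ`
  -- survives when a real point is continued to neighbouring fibres.
  have hside : ∀ {x : RV d} {c : ℝ} (σ : ℝ), x ∈ realCone S → x - (u.1 + c • e) ∈ W₀ →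
      0 < σ * c → ∀ᶠ y' in 𝓝 y, ∃ x' ∈ realFibre S W.space y',
        ∃ c' : ℝ, 0 < σ * c' ∧ x' - (v y' + c' • e) ∈ W₀ := by
    intro x c σ hx hxc hσ
    have hcont : Continuous fun q : RV d × W.spaceᗮ => σ * inner ℝ e (q.1 - v q.2) := by
      fun_prop
    have hpos : 0 < σ * inner ℝ e (x - v y) := by
      rw [hvy, hinner hxc, ← mul_assoc]
      exact mul_pos hσ hee
    have hnhds := (hcont.tendsto (x, y)).eventually (lt_mem_nhds hpos)
    rw [nhds_prod_eq] at hnhds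
    obtain ⟨p, hp, q, hq, hpq⟩ := Filter.eventually_prod_iff.1 hnhds
    filter_upwards [hS.eventually_exists_mem_realFibre W.finrank_space hWh hℓ hy0
      ⟨hx, hproj hxc⟩ hp, hq] with y' ⟨x', hx', hx'p⟩ hy'
    obtain ⟨c', hc'⟩ := hcoef hx'
    refine ⟨x', hx', c', ?_, hc'⟩
    have := hpq hx'p hy'
    simp only at this
    rw [hinner hc', ← mul_assoc] at this
    exact (mul_pos_iff_of_pos_right hee).1 this
  have hall := ((hside 1 hx₁ h₁ (by linarith)).and (hside (-1) hx₂ h₂ (by linarith))).and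
    (hev1.and (isOpen_ne.mem_nhds hy0))
  obtain ⟨O, hOsub, hOo, hyO⟩ := eventually_nhds_iff.1 hall |>.imp fun _ h => h
  obtain ⟨y', hy'O, hder⟩ := hS.exists_forall_isSectionDeriv W.finrank_space hWh hℓ hOo ⟨y, hyO⟩
    (fun h => (hOsub 0 h).2.2 rfl)
  obtain ⟨⟨⟨z₁, hz₁, a₁, ha₁, hza₁⟩, ⟨z₂, hz₂, a₂, ha₂, hza₂⟩⟩, hvb, hy'0⟩ := hOsub y' hy'O
  obtain ⟨D₁, hD₁⟩ := hder z₁ hz₁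
  obtain ⟨D₂, hD₂⟩ := hder z₂ hz₂
  have hv0 : v y' ≠ 0 := fun h => hy'0 (by
    have := hvproj y'
    rwa [h, map_zero, eq_comm] at this)
  have hVA : pencilPoint W₀ hW₀ ⟨v y', hvW₀ y', hv0⟩ ∈ A :=
    pencilPoint_mem_of_convex hS hA' hW₀ h0
      (B := Metric.ball u.1 r ∩ (W₀ᗮ : Set (RV d)))
      ((convex_ball _ _).inter W₀ᗮ.convex) (fun x hx => ⟨hx.2, hball hx.1⟩)
      ⟨Metric.mem_ball_self hr, u.2.1⟩ hu ⟨hvb, hvW₀ y'⟩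
  have := mul_nonneg_of_isSectionDeriv hS hA hAS hW hVA he0 heW₀' hWe rfl hD₁ hD₂ hza₁ hza₂
  nlinarith

/-- After normalizing to `a + b = 1`, the condition ranges over a compact interval. -/
theorem isOpen_hyperbolicityCone {Z : Set (Fin (d + 1) → ℂ)} (hZ : IsConicHypersurface Z)
    {e : RV d} (he : IsHyperbolicDirection Z e) :
    IsOpen (hZ.hyperbolicityCone he : Set (RV d)) := by
  have heq : ∀ u, u ∈ hZ.hyperbolicityCone he ↔
      ∀ s ∈ Set.Icc (0 : ℝ) 1, toComplex ((1 - s) • e + s • u) ∉ Z := by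
    intro u
    rw [hZ.mem_hyperbolicityCone]
    refine ⟨fun h s hs => h _ _ (by linarith [hs.2]) hs.1 (by linarith), ?_⟩
    intro h a b ha hb hab hmem
    refine h (b / (a + b)) ⟨by positivity, (div_le_one hab).2 (by linarith)⟩ ?_
    rw [← hZ.smul_mem_iff (c := ((a + b : ℝ) : ℂ)) (by exact_mod_cast hab.ne'), ← toComplex_smul]
    convert hmem using 2
    rw [smul_add, smul_smul, smul_smul, mul_sub, mul_div_cancel₀ _ hab.ne', mul_one,
      add_sub_cancel_right]
  rw [isOpen_iff_eventually]
  intro u hu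
  have hO : IsOpen {x : RV d | toComplex x ∉ Z} :=
    hZ.isClosed.isOpen_compl.preimage continuous_toComplex
  have h : ∀ᶠ u' in 𝓝 u, ∀ s ∈ Set.Icc (0 : ℝ) 1, toComplex ((1 - s) • e + s • u') ∉ Z := by
    refine isCompact_Icc.eventually_forall_of_forall_eventually fun s hs => ?_
    have hc : Continuous fun q : RV d × ℝ => (1 - q.2) • e + q.2 • q.1 := by fun_prop
    exact (hc.tendsto (u, s)).eventually (hO.mem_nhds ((heq u).1 hu s hs))
  exact h.mono fun u' hu' => (heq u').2 hu'

theorem exists_sup_span_singleton_eq {W₀ W : Submodule ℝ (RV d)} (hle : W₀ ≤ W)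
    (hW₀ : Module.finrank ℝ W₀ + 1 = ℓ) (hW : Module.finrank ℝ W = ℓ) :
    ∃ e ∈ W₀ᗮ, e ≠ 0 ∧ W = W₀ ⊔ Submodule.span ℝ {e} := by
  obtain ⟨e, he, he0⟩ : ∃ e ∈ W₀ᗮ ⊓ W, e ≠ 0 := by
    refine Submodule.exists_mem_ne_zero_of_ne_bot fun hbot => ?_
    have := Submodule.sup_orthogonal_inf_of_hasOrthogonalProjection hle
    rw [hbot, sup_bot_eq] at this
    rw [this] at hW₀
    omega
  refine ⟨e, he.1, he0, ?_⟩
  symm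
  refine Submodule.eq_of_le_of_finrank_eq
    (sup_le hle ((Submodule.span_singleton_le_iff_mem _ _).2 he.2)) ?_
  rw [Submodule.finrank_sup_span_singleton (notMem_of_mem_orthogonal he.1 he0), hW₀, hW]

theorem mem_sliceCone_iff {A : Set (RealGr ℓ d)} {W₀ : Submodule ℝ (RV d)}
    (hW₀ : Module.finrank ℝ W₀ + 1 = ℓ) {u : W₀ᗮ} :
    u ∈ sliceCone W₀ (A ∩ pencil ℓ W₀) ↔
      ∃ hu : (u : RV d) ≠ 0, pencilPoint W₀ hW₀ ⟨u, u.2, hu⟩ ∈ A := by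
  constructor
  · rintro ⟨hu, W, hW, hWu⟩
    refine ⟨fun h => hu (Subtype.ext h), ?_⟩
    have : pencilPoint W₀ hW₀ ⟨u, u.2, fun h => hu (Subtype.ext h)⟩ = W := Subtype.ext hWu.symm
    rw [this]
    exact hW.1
  · rintro ⟨hu, h⟩
    refine ⟨fun h0 => hu (by rw [h0]; rfl), _, ⟨h, ?_⟩, rfl⟩
    exact (le_sup_left : W₀ ≤ W₀ ⊔ Submodule.span ℝ {(u : RV d)})

/-- A member of a slice of `A` is in the hyperbolicity cone up to sign. -/
theorem mem_or_neg_mem_hyperbolicityCone (hS : IsProjectableCone ℓ S) (hℓ : 1 ≤ ℓ)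
    {A : Set (RealGr ℓ d)} (hA : IsPreconnected A) (hA' : IsComponentUnion S A)
    (hAS : ∀ V ∈ A, IsHyperbolicCone S V.space) {W₀ : Submodule ℝ (RV d)}
    (hW₀ : Module.finrank ℝ W₀ + 1 = ℓ) {W : RealGr ℓ d} (hW : W ∈ A) {e : RV d} (heW₀' : e ∈ W₀ᗮ)
    (he0 : e ≠ 0) (hWe : W.space = W₀ ⊔ Submodule.span ℝ {e})
    (hWh : IsHyperbolicCone S (W₀ ⊔ Submodule.span ℝ {e})) (heW₀ : e ∉ W₀)
    (hZ : IsConicHypersurface (coneAlong S W₀)) (heZ : IsHyperbolicDirection (coneAlong S W₀) e)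
    {u : RV d} (hu : u ∈ W₀ᗮ) (hu0 : u ≠ 0) (huA : pencilPoint W₀ hW₀ ⟨u, hu, hu0⟩ ∈ A) :
    u ∈ hZ.hyperbolicityCone heZ ∨ -u ∈ hZ.hyperbolicityCone heZ := by
  by_contra hcon
  obtain ⟨hu₁, hu₂⟩ := not_or.1 hcon
  have h0 : Avoids S W₀ := hWh.avoids.mono le_sup_left
  have huS : toComplex u ∉ coneAlong S W₀ := (hS.notMem_coneAlong_iff h0).2
    ⟨notMem_of_mem_orthogonal hu hu0, (hAS _ huA).avoids⟩
  have huS' : toComplex (-u) ∉ coneAlong S W₀ := by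
    rw [toComplex_neg, ← neg_one_smul ℂ, hZ.smul_mem_iff (by norm_num)]
    exact huS
  have heK : e ∈ hZ.hyperbolicityCone heZ := by
    intro a b ha hb hab
    rw [← add_smul, toComplex_smul, hZ.smul_mem_iff (by exact_mod_cast hab.ne')]
    exact heZ.notMem hZ
  have huW : u ∉ W₀ ⊔ Submodule.span ℝ {e} := by
    intro h
    obtain ⟨c, hc⟩ := mem_span_of_mem_sup_of_mem_orthogonal heW₀' hu h
    rcases lt_trichotomy c 0 with h1 | h1 | h1
    · refine hu₂ ?_
      rw [hc, ← neg_smul]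
      exact ConvexCone.smul_mem _ (neg_pos.2 h1) heK
    · exact hu0 (by rw [hc, h1, zero_smul])
    · refine hu₁ ?_
      rw [hc]
      exact ConvexCone.smul_mem _ h1 heK
  obtain ⟨x₁, hx₁, c₁, hc₁, h₁⟩ := exists_mem_realCone_of_notMem_hyperbolicityCone hS hW₀ hWh
    heW₀ huS huW hu₁
  obtain ⟨x₂, hx₂, c₂, hc₂, h₂⟩ := exists_mem_realCone_of_notMem_hyperbolicityCone hS hW₀ hWh
    heW₀ huS' (fun h => huW (by simpa using h)) hu₂
  -- The segment towards `-u` yields a point over `-u + c₂ e`; its negative lies over `u - c₂ e`, on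
  -- the side opposite to `x₁`.
  have h₃ : -x₂ - (u + -c₂ • e) ∈ W₀ := by
    have := W₀.neg_mem h₂
    rwa [show -(x₂ - (-u + c₂ • e)) = -x₂ - (u + -c₂ • e) by module] at this
  have hx₂' : -x₂ ∈ realCone S := by
    have := hS.smul_mem_realCone hx₂ (-1)
    rwa [neg_one_smul] at this
  exact not_exists_opposite_mem_realCone hS hℓ hA hA' hAS hW₀ hW heW₀' he0 hWe
    (u := ⟨u, hu, hu0⟩) huA (hWe ▸ huW) hx₁ hx₂' hc₁ (neg_neg_of_pos hc₂) h₁ h₃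

/-- The convex cone is the hyperbolicity cone of `e` restricted to `W₀ᗮ`. It lies over `A` because
the segment from `e` to each of its vectors is a connected family of avoiding subspaces, and
`mem_or_neg_mem_hyperbolicityCone` shows that, with its negative, it is everything. -/
theorem isConvexDoubleCone_sliceCone (hS : IsProjectableCone ℓ S) (hℓ : 1 ≤ ℓ)
    {A : Set (RealGr ℓ d)} (hA : IsPreconnected A) (hA' : IsComponentUnion S A)
    (hAS : ∀ V ∈ A, IsHyperbolicCone S V.space) {W : RealGr ℓ d} (hW : W ∈ A)
    {W₀ : Submodule ℝ (RV d)} (hle : W₀ ≤ W.space) (hW₀ : Module.finrank ℝ W₀ + 1 = ℓ) :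
    IsConvexDoubleCone (sliceCone W₀ (A ∩ pencil ℓ W₀)) := by
  obtain ⟨e, heW₀', he0, hWe⟩ := exists_sup_span_singleton_eq hle hW₀ W.finrank_space
  have heA : pencilPoint W₀ hW₀ ⟨e, heW₀', he0⟩ ∈ A := by
    have : pencilPoint W₀ hW₀ ⟨e, heW₀', he0⟩ = W := Subtype.ext hWe.symm
    rwa [this]
  have hWh : IsHyperbolicCone S (W₀ ⊔ Submodule.span ℝ {e}) := hAS _ heA
  have heW₀ : e ∉ W₀ := notMem_of_mem_orthogonal heW₀' he0
  have h0 : Avoids S W₀ := hWh.avoids.mono le_sup_left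
  have hZ := hS.isConicHypersurface W₀ e heW₀ hW₀ hWh.avoids
  have heZ := hWh.isHyperbolicDirection heW₀
  set K := hZ.hyperbolicityCone heZ with hK
  have h0K : (0 : RV d) ∉ K := by
    intro h
    refine h 0 1 le_rfl zero_le_one (by norm_num) ⟨0, Submodule.zero_mem _, ?_⟩
    rw [smul_zero, zero_smul, zero_add, toComplex_zero, zero_add]
    exact hS.zero_mem
  have hKA : ∀ u : RV d, ∀ hu : u ∈ W₀ᗮ, u ∈ K →
      ∃ hu0 : u ≠ 0, pencilPoint W₀ hW₀ ⟨u, hu, hu0⟩ ∈ A := by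
    intro u hu huK
    refine ⟨fun h => h0K (h ▸ huK), ?_⟩
    refine pencilPoint_mem_of_convex hS hA' hW₀ h0 (B := segment ℝ e u) (convex_segment _ _) ?_
      (left_mem_segment ℝ e u) heA (right_mem_segment ℝ e u)
    rintro _ ⟨a, b, ha, hb, hab, rfl⟩
    exact ⟨W₀ᗮ.add_mem (W₀ᗮ.smul_mem _ heW₀') (W₀ᗮ.smul_mem _ hu), huK a b ha hb (by linarith)⟩
  have hneg : ∀ (u : RV d) (hu : u ∈ W₀ᗮ) (hu0 : u ≠ 0) (hu' : -u ∈ W₀ᗮ) (hu0' : -u ≠ 0),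
      pencilPoint W₀ hW₀ ⟨-u, hu', hu0'⟩ = pencilPoint W₀ hW₀ ⟨u, hu, hu0⟩ := by
    intro u hu hu0 hu' hu0'
    refine Subtype.ext ?_
    change W₀ ⊔ Submodule.span ℝ {-u} = W₀ ⊔ Submodule.span ℝ {u}
    rw [← Set.neg_singleton, Submodule.span_neg]
  refine ⟨K.comap W₀ᗮ.subtype, ?_, ?_⟩
  · ext u
    rw [mem_sliceCone_iff hW₀]
    constructor
    · rintro ⟨hu0, huA⟩
      exact mem_or_neg_mem_hyperbolicityCone hS hℓ hA hA' hAS hW₀ hW heW₀' he0 hWe hWh heW₀ hZ heZ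
        u.2 hu0 huA
    · rintro (h | h)
      · exact hKA u u.2 h
      · obtain ⟨h1, h2⟩ := hKA (-u : RV d) (W₀ᗮ.neg_mem u.2) h
        have hu0 : (u : RV d) ≠ 0 := neg_ne_zero.1 h1
        exact ⟨hu0, by rwa [← hneg u u.2 hu0 (W₀ᗮ.neg_mem u.2) h1]⟩
  · intro x hx hxK
    -- `-K` is open, so if it met the closure of `K` it would meet `K`, and convexity would put `0`
    -- in `K`.
    have hopen : IsOpen {u : W₀ᗮ | -(u : RV d) ∈ K} :=
      (isOpen_hyperbolicityCone hZ heZ).preimage (continuous_subtype_val.neg)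
    obtain ⟨x', h1, h2⟩ := mem_closure_iff.1 hx _ hopen hxK
    refine h0K ?_
    have h3 := K.add_mem (show (x' : RV d) ∈ K from h2) h1
    rwa [add_neg_cancel] at h3

end slices

/-! ### Transfer to Plücker coordinates. -/

section pluckerEmbedding
variable {d : ℕ}

/-- An injective linear map from a finite-dimensional space is a closed embedding, so taking
closures commutes with taking images and separation is preserved. -/
theorem IsConvexDoubleCone.image {M N : Type*} [NormedAddCommGroup M] [NormedSpace ℝ M]
    [FiniteDimensional ℝ M] [NormedAddCommGroup N] [NormedSpace ℝ N] {S : Set M}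
    (hS : IsConvexDoubleCone S) (L : M →ₗ[ℝ] N) (hL : Function.Injective L) :
    IsConvexDoubleCone (L '' S) := by
  obtain ⟨K, rfl, hK⟩ := hS
  have hcl := LinearMap.isClosedEmbedding_of_injective (LinearMap.ker_eq_bot.2 hL)
  have hmem : ∀ x, L x ∈ K.map L ↔ x ∈ K := fun x => by
    rw [ConvexCone.mem_map]
    exact ⟨fun ⟨y, hy, h⟩ => hL h ▸ hy, fun h => ⟨x, h, rfl⟩⟩
  refine ⟨K.map L, ?_, ?_⟩
  · ext y
    constructor
    · rintro ⟨x, h, rfl⟩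
      rw [Set.mem_ofPred_eq, ← map_neg, hmem, hmem]
      exact h
    · rintro (h | h)
      · obtain ⟨x, hx, rfl⟩ := ConvexCone.mem_map.1 h
        exact ⟨x, Or.inl hx, rfl⟩
      · obtain ⟨x, hx, hxy⟩ := ConvexCone.mem_map.1 h
        exact ⟨-x, Or.inr (by rwa [neg_neg]), by rw [map_neg, hxy, neg_neg]⟩
  · intro y hy
    rw [ConvexCone.coe_map, hcl.closure_image_eq] at hy
    obtain ⟨x, hx, rfl⟩ := hy
    rw [← map_neg, hmem]
    exact hK x hx

/-- The Plücker coordinates of linearly independent vectors do not all vanish. -/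
theorem plucker_ne_zero {ℓ : ℕ} {w : Fin ℓ → RV d} (hw : LinearIndependent ℝ w) :
    plucker w ≠ 0 := by
  let M : Matrix (Fin ℓ) (Fin (d + 1)) ℝ := Matrix.of fun i j => w i j
  have hrow : LinearIndependent ℝ M.row :=
    hw.map' (WithLp.linearEquiv 2 ℝ (Fin (d + 1) → ℝ)).toLinearMap (LinearEquiv.ker _)
  obtain ⟨κ, a, ha, hspan, hli⟩ := exists_linearIndependent' ℝ M.col
  have : Finite κ := Finite.of_injective a ha
  have : Fintype κ := Fintype.ofFinite κ
  have hcard : Fintype.card κ = ℓ := by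
    rw [← finrank_span_eq_card hli, hspan, ← Matrix.rank_eq_finrank_span_cols, hrow.rank_matrix,
      Fintype.card_fin]
  have hcard' : (Finset.univ.image a).card = ℓ := by
    rw [Finset.card_image_of_injective _ ha, Finset.card_univ, hcard]
  let J : Fin ℓ ↪o Fin (d + 1) := (Finset.univ.image a).orderEmbOfFin hcard'
  have hJ : ∀ i, ∃ k, a k = J i := fun i => by
    obtain ⟨k, -, hk⟩ := Finset.mem_image.1 (Finset.orderEmbOfFin_mem _ hcard' i)
    exact ⟨k, hk⟩
  choose k hk using hJ
  have hkinj : Function.Injective k := fun i j hij => J.injective (by rw [← hk, ← hk, hij])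
  have hliJ : LinearIndependent ℝ (M.submatrix id J).col := by
    have h := hli.comp k hkinj
    have e : (M.col ∘ a) ∘ k = (M.submatrix id J).col := by
      funext i
      simp only [Function.comp_apply, hk]
      rfl
    rwa [e] at h
  intro h0
  have hunit := (Matrix.isUnit_iff_isUnit_det _).1
    (Matrix.linearIndependent_cols_iff_isUnit.1 hliJ)
  exact hunit.ne_zero (congrFun h0 J)

theorem plucker_eq_det_smul {ℓ : ℕ} (A : Matrix (Fin ℓ) (Fin ℓ) ℝ) {w w' : Fin ℓ → RV d}
    (h : ∀ i, w i = ∑ k, A i k • w' k) : plucker w = A.det • plucker w' := by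
  funext J
  rw [Pi.smul_apply, smul_eq_mul, plucker, plucker, ← Matrix.det_mul]
  congr 1
  ext i j
  rw [Matrix.mul_apply, Matrix.of_apply, h i]
  simp

/-- The Plücker coordinates as a linear function of the first vector. -/
def pluckerCons {m : ℕ} (w : Fin m → RV d) : RV d →ₗ[ℝ] ((Fin (m + 1) ↪o Fin (d + 1)) → ℝ) :=
  LinearMap.pi fun J =>
    { toFun := fun u => plucker (Fin.cons u w : Fin (m + 1) → RV d) J
      map_add' := fun u v => by
        have h : ∀ u : RV d, (Matrix.of fun i j => (Fin.cons u w : Fin (m + 1) → RV d) i (J j)) =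
            (Matrix.of fun i j => (Fin.cons 0 w : Fin (m + 1) → RV d) i (J j)).updateRow 0
              fun j => u (J j) := by
          intro u
          ext i j
          refine Fin.cases ?_ (fun i => ?_) i <;> simp [Matrix.updateRow_apply]
        simp only [plucker]
        rw [h (u + v), h u, h v, ← Matrix.det_updateRow_add]
        rfl
      map_smul' := fun c u => by
        have h : ∀ u : RV d, (Matrix.of fun i j => (Fin.cons u w : Fin (m + 1) → RV d) i (J j)) =
            (Matrix.of fun i j => (Fin.cons 0 w : Fin (m + 1) → RV d) i (J j)).updateRow 0
              fun j => u (J j) := by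
          intro u
          ext i j
          refine Fin.cases ?_ (fun i => ?_) i <;> simp [Matrix.updateRow_apply]
        simp only [plucker]
        rw [h (c • u), h u, RingHom.id_apply, smul_eq_mul, ← Matrix.det_updateRow_smul]
        rfl }

theorem span_range_cons {m : ℕ} (w : Fin m → RV d) (u : RV d) :
    Submodule.span ℝ (Set.range (Fin.cons u w : Fin (m + 1) → RV d)) =
      Submodule.span ℝ (Set.range w) ⊔ Submodule.span ℝ {u} := by
  rw [Fin.range_cons, Submodule.span_insert, sup_comm]

theorem linearIndependent_cons {m : ℕ} {w : Fin m → RV d} (hw : LinearIndependent ℝ w) {u : RV d}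
    (hu : u ∈ (Submodule.span ℝ (Set.range w))ᗮ) (hu0 : u ≠ 0) :
    LinearIndependent ℝ (Fin.cons u w : Fin (m + 1) → RV d) :=
  linearIndependent_finCons.2 ⟨hw, notMem_of_mem_orthogonal hu hu0⟩

/-- The Plücker cone over a slice is the image of the cone over that slice in the orthogonal
complement of the axis of the pencil. -/
theorem pluckerCone_inter_pencil {m : ℕ} {w : Fin m → RV d} (hw : LinearIndependent ℝ w)
    {W₀ : Submodule ℝ (RV d)} (hW₀ : Submodule.span ℝ (Set.range w) = W₀)
    (A : Set (RealGr (m + 1) d)) :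
    pluckerCone (A ∩ pencil (m + 1) W₀) =
      (pluckerCons w ∘ₗ W₀ᗮ.subtype) '' sliceCone W₀ (A ∩ pencil (m + 1) W₀) := by
  have hfin : Module.finrank ℝ W₀ + 1 = m + 1 := by
    rw [← hW₀, finrank_span_eq_card hw, Fintype.card_fin]
  ext ω
  constructor
  · rintro ⟨W, hW, w', hw', hsp, rfl⟩
    obtain ⟨e, he, he0, hWe⟩ := exists_sup_span_singleton_eq hW.2 hfin W.finrank_space
    have hsp' : Submodule.span ℝ (Set.range (Fin.cons e w : Fin (m + 1) → RV d)) = W.space := by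
      rw [span_range_cons, hW₀, hWe]
    have hA : ∀ i, ∃ c : Fin (m + 1) → ℝ,
        ∑ k, c k • (Fin.cons e w : Fin (m + 1) → RV d) k = w' i := fun i => by
      rw [← Submodule.mem_span_range_iff_exists_fun, hsp', ← hsp]
      exact Submodule.subset_span ⟨i, rfl⟩
    choose c hc using hA
    have hpl := plucker_eq_det_smul (Matrix.of c) (w := w')
      (w' := (Fin.cons e w : Fin (m + 1) → RV d)) (fun i => (hc i).symm)
    have hdet : (Matrix.of c).det ≠ 0 := fun h => plucker_ne_zero hw' (by rw [hpl, h, zero_smul])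
    -- Another basis of the same subspace multiplies the Plücker vector by the determinant of the
    -- base change, which is absorbed into the vector of `W₀ᗮ`.
    refine ⟨(Matrix.of c).det • ⟨e, he⟩, ⟨?_, W, hW, ?_⟩, ?_⟩
    · exact smul_ne_zero hdet fun h => he0 (congrArg Subtype.val h)
    · rw [hWe, Submodule.coe_smul, Submodule.span_singleton_smul_eq (IsUnit.mk0 _ hdet)]
    · rw [map_smul, hpl]
      rfl
  · rintro ⟨u, ⟨hu0, W, hW, hWu⟩, rfl⟩
    refine ⟨W, hW, Fin.cons (u : RV d) w, linearIndependent_cons hw ?_ ?_, ?_, rfl⟩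
    · rw [hW₀]; exact u.2
    · exact fun h => hu0 (Subtype.ext h)
    · rw [span_range_cons, hW₀, hWu]

/-- The map `u ↦ u ∧ w₁ ∧ … ∧ w_m`, for a basis `w` of `W₀`, is injective on `W₀ᗮ`, because a
nonzero `u` extends the basis to an independent family. -/
theorem isConvexDoubleCone_pluckerCone {ℓ : ℕ} {A : Set (RealGr ℓ d)} {W₀ : Submodule ℝ (RV d)}
    (hW₀ : Module.finrank ℝ W₀ + 1 = ℓ)
    (h : IsConvexDoubleCone (sliceCone W₀ (A ∩ pencil ℓ W₀))) :
    IsConvexDoubleCone (pluckerCone (A ∩ pencil ℓ W₀)) := by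
  subst hW₀
  obtain ⟨w, hw, hsp⟩ := RealGr.exists_tuple (⟨W₀, rfl⟩ : RealGr (Module.finrank ℝ W₀) d)
  change _ = W₀ at hsp
  rw [pluckerCone_inter_pencil hw hsp]
  refine h.image _ ?_
  rw [← LinearMap.ker_eq_bot, LinearMap.ker_eq_bot']
  intro u hu
  by_contra hu0
  refine plucker_ne_zero (linearIndependent_cons hw (u := u) ?_ fun h => hu0 (Subtype.ext h)) hu
  rw [hsp]; exact u.2

end pluckerEmbedding

/-! ### Assembly of the main theorem. -/

section main
variable {d : ℕ}

theorem isComponentUnion_component {ℓ : ℕ} (X : Set (CP d)) (V : RealGr ℓ d) :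
    IsComponentUnion (affineCone X) (component X V) := by
  rintro B hB hBX ⟨W, hW, hWB⟩
  have hsub : B ⊆ (associatedReal ℓ X)ᶜ := fun V' hV' => mem_compl_associatedReal_iff.2 (hBX V' hV')
  rw [component, connectedComponentIn_eq hW]
  exact hB.subset_connectedComponentIn hWB hsub

end main

end SliceConvex

end

theorem mainTheorem5 (d k ℓ : ℕ) (hℓ : 1 ≤ ℓ) (hd : k + ℓ = d)
    (X : Set (SliceConvex.CP d))
    (hX : SliceConvex.IsRealSubvariety X) (hdim : SliceConvex.HasPureDim X k)
    (V : SliceConvex.RealGr ℓ d) (hV : SliceConvex.IsHyperbolic X V) :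
    SliceConvex.IsSliceConvex (SliceConvex.component X V) ∧
    (∀ W ∈ SliceConvex.component X V, ∀ W₀ : Submodule ℝ (SliceConvex.RV d),
      W₀ ≤ W.space → Module.finrank ℝ W₀ + 1 = ℓ →
        SliceConvex.IsConvexDoubleCone
          (SliceConvex.sliceCone W₀
            (SliceConvex.component X V ∩ SliceConvex.pencil ℓ W₀))) ∧
    (∀ V₀ : Submodule ℝ (SliceConvex.RV d),
      V₀ ≤ V.space → Module.finrank ℝ V₀ + 1 = ℓ →
        ∀ V' ∈ SliceConvex.component X V ∩ SliceConvex.pencil ℓ V₀,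
          SliceConvex.IsHyperbolic X V') := by
  have hS := SliceConvex.isProjectableCone_affineCone hd hX hdim
  have hVh := (SliceConvex.isHyperbolic_iff V).1 hV
  have hA : IsPreconnected (SliceConvex.component X V) := isPreconnected_connectedComponentIn
  have hVA : V ∈ SliceConvex.component X V :=
    mem_connectedComponentIn (SliceConvex.mem_compl_associatedReal_iff.2 hVh.avoids)
  have hAh : ∀ V' ∈ SliceConvex.component X V,
      SliceConvex.IsHyperbolicCone (SliceConvex.affineCone X) V'.space := fun V' hV' =>
    hS.isHyperbolicCone_of_isPreconnected hA (fun W hW =>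
      SliceConvex.mem_compl_associatedReal_iff.1 (connectedComponentIn_subset _ _ hW)) hVA hVh hV'
  have hslice : ∀ W ∈ SliceConvex.component X V, ∀ W₀ : Submodule ℝ (SliceConvex.RV d),
      W₀ ≤ W.space → Module.finrank ℝ W₀ + 1 = ℓ →
        SliceConvex.IsConvexDoubleCone
          (SliceConvex.sliceCone W₀
            (SliceConvex.component X V ∩ SliceConvex.pencil ℓ W₀)) := fun W hW W₀ hle hW₀ =>
    SliceConvex.isConvexDoubleCone_sliceCone hS hℓ hA
      (SliceConvex.isComponentUnion_component X V) hAh hW hle hW₀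
  exact ⟨fun W hW W₀ hle hW₀ =>
      SliceConvex.isConvexDoubleCone_pluckerCone hW₀ (hslice W hW W₀ hle hW₀),
    hslice, fun _ _ _ V' hV' => (SliceConvex.isHyperbolic_iff V').2 (hAh V' hV'.1)⟩
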